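/- All graphs are finite and simple. A graph $G$ is $n$-connected if $|V(G)|>n$ and $G-X$ is connected for every set $X$ of fewer than $n$ vertices. A minimum odd cycle cover of $G$ is a set $X\subseteq V(G)$ of smallest cardinality such that $G-X$ is bipartite. A partition $(A,B)$ of $V(G)$ (parts may be empty) is nice if there is a minimum odd cycle cover $X$ of $G$ such that $G-X$ has no edge with both ends in $A\setminus X$ or both ends in $B\setminus X$, and every vertex of $X$ with more neighbours in $B\setminus X$ than in $A\setminus X$ lies in $A$, and every vertex of $X$ with more neighbours in $A\setminus X$ than in $B\setminus X$ lies in $B$. Theorem. Let $k\in\mathbb{N}$, let $I\subseteq[k]=\{1,\dots,k\}$, let $G$ be a $(26k+24|I|)$-connected graph, and let $s_1,\dots,s_k,t_1,\dots,t_k$ be $2k$ distinct vertices of $G$. Suppose there are a nice partition $(A,B)$ of $G$ and a parity breaking matching for it, that is, pairwise disjoint edges $m_i$ $(i\in I)$ of $G[A]\cup G[B]$ such that $m_i\cap\{s_j,t_j\}=\emptyset$ for all $i\in I$ and $j\in[k]$ with $j\neq i$. Then for every choice of parities $(p_i)_{i\in I}$ in $\mathbb{Z}/2\mathbb{Z}$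 there are pairwise vertex-disjoint paths $P_1,\dots,P_k$ in $G$ such that $P_i$ connects $s_i$ and $t_i$ for every $i\in[k]$, and the length (number of edges) of $P_i$ is congruent to $p_i$ modulo $2$ for every $i\in I$. -/

import Mathlib

namespace ParityLinkage

/-- `G` is `n`-connected: it has more than `n` vertices, and deleting fewer than `n` vertices
never disconnects it. -/
def IsVertexConnected {V : Type*} (G : SimpleGraph V) (n : ℕ) : Prop :=
  n < Nat.card V ∧ ∀ X : Set V, X.ncard < n → (G.induce Xᶜ).Connected

/-- `X` is an odd cycle cover of `G`: the graph `G - X` is bipartite. -/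
def IsOddCycleCover {V : Type*} (G : SimpleGraph V) (X : Set V) : Prop :=
  (G.induce Xᶜ).IsBipartite

/-- `X` is an odd cycle cover of `G` of minimum cardinality. -/
def IsMinOddCycleCover {V : Type*} (G : SimpleGraph V) (X : Set V) : Prop :=
  IsOddCycleCover G X ∧ ∀ Y : Set V, IsOddCycleCover G Y → X.ncard ≤ Y.ncard

/-- The graph `G_{A,B} = G[A] ∪ G[B]`, on the vertex set of `G`. -/
def sideGraph {V : Type*} (G : SimpleGraph V) (A B : Set V) : SimpleGraph V :=
  (G.induce A).spanningCoe ⊔ (G.induce B).spanningCoe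

/-- `(A, B)` partitions the vertex set of `G` and `G[A] ∪ G[B]` has no edges. -/
def IsBipartition {V : Type*} (G : SimpleGraph V) (A B : Set V) : Prop :=
  IsCompl A B ∧ sideGraph G A B = ⊥

/-- The minimum odd cycle cover `X` induces the partition `(A, B)` of the vertex set of `G`:
the traces of `A` and `B` on `G - X` form a bipartition of `G - X`, and each vertex of `X` lies
on the side opposite to the one that contains more of its neighbours outside `X` (in the case of
a tie, on either side). -/
def Induces {V : Type*} (G : SimpleGraph V) (X A B : Set V) : Prop :=
  IsMinOddCycleCover G X ∧ IsCompl A B ∧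
  IsBipartition (G.induce Xᶜ) (Subtype.val ⁻¹' A) (Subtype.val ⁻¹' B) ∧
  ∀ x ∈ X,
    ((G.neighborSet x ∩ (A \ X)).ncard < (G.neighborSet x ∩ (B \ X)).ncard → x ∈ A) ∧
    ((G.neighborSet x ∩ (B \ X)).ncard < (G.neighborSet x ∩ (A \ X)).ncard → x ∈ B)

/-- A nice partition of `G` is one induced by some minimum odd cycle cover. -/
def IsNicePartition {V : Type*} (G : SimpleGraph V) (A B : Set V) : Prop :=
  ∃ X : Set V, Induces G X A B

/-- `(m i)`, `i ∈ I`, is a parity breaking matching for the pairs `{s j, t j}`, `j : Fin k`, and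
the index set `I`: the `m i` are pairwise disjoint edges of `G[A] ∪ G[B]`, and
`m i` contains neither `s j` nor `t j` whenever `j ≠ i`. -/
def IsParityBreakingMatching {V : Type*} (G : SimpleGraph V) (A B : Set V) {k : ℕ}
    (s t : Fin k → V) (I : Finset (Fin k)) (m : I → Sym2 V) : Prop :=
  (∀ i : I, m i ∈ (sideGraph G A B).edgeSet) ∧
  (∀ i j : I, i ≠ j → ∀ v : V, v ∈ m i → v ∉ m j) ∧
  (∀ (i : I) (j : Fin k), (i : Fin k) ≠ j → s j ∉ m i ∧ t j ∉ m i)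

end ParityLinkage

/-! Fix a 2-colouring of the vertices and call an edge breaking if its ends have the same colour.
The parity of the length of a path is determined by the colours of its ends and by the parity of its
number of breaking edges (`breaks`), so prescribing length parities means prescribing `breaks`. Put
K = k + |I|. The aim is to carry all terminals by disjoint paths into a set on which a bipartite
subgraph is linked for any K pairs. Paths of that subgraph never break, so a pair i ∈ I changes its
parity exactly when its route makes a detour through one breaking path; each detour splits one join
into two, which accounts for K.

Since 26k + 24|I| ≥ 25K, a maximum cut of G has minimum degree at least 25K/2, and it is linked on
some set U of at least 12K vertices (`exists_linked_subset`). A parity version of Gallai's theorem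
on disjoint paths (`exists_breaking_paths_or_hitting`) is applied to U in G without the set R of
terminals. If there are 2k + |I| disjoint breaking paths with ends in U, then 2k disjoint walks from
the terminals to U can be chosen so that they meet at most 2k of them (`exists_walks_touching`), and
|I| untouched ones remain as detours. Otherwise fewer than 4k + 2|I| vertices Z meet all breaking
paths. As G - R - Z is still 2-connected, an odd cycle in it would yield another breaking path, so R
∪ Z is an odd cycle cover with at most 6k + 2|I| vertices. The minimum cover X behind the nice
partition is then at most as large, so G - X is a bipartite graph of connectivity at least 20K and
is linked. Niceness gives the vertices of X enough bichromatic edges to leave X, and the matching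
edges serve as breaking detours (`exists_routes_of_small_cover`).

Linkage from density (`Massed.isLinked`) follows the method of Thomas and Wollan. In a minimal
counterexample neither deleting nor contracting an edge is possible, so adjacent vertices have many
common neighbours and some vertex has degree below 12k. Its closed neighbourhood is so dense that it
contains a k-linked set (`denseLinked`), to which X is connected by `menger`, unless a small
separator allows a further reduction.

The parity version of Gallai's theorem is Berge's formula (`exists_matching_or_odd_family`) for an
auxiliary graph with two copies of every vertex outside S and one copy of every vertex of S. -/

section
open scoped Classical
namespace ParityLinkage

/-! ### Connections inside a vertex set. -/

section Connectors
variable {V : Type*} {G G' : SimpleGraph V} {S S' : Finset V} {a b c : V}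

/-- The subgraph of `G` consisting of the edges with both ends in `S`. -/
def res (G : SimpleGraph V) (S : Finset V) : SimpleGraph V where
  Adj a b := G.Adj a b ∧ a ∈ S ∧ b ∈ S
  symm := ⟨fun _ _ h => ⟨h.1.symm, h.2.2, h.2.1⟩⟩
  loopless := ⟨fun _ h => h.1.ne rfl⟩

/-- `a` and `b` are joined by a walk of `G` inside `S` (or are equal). -/
def Conn (G : SimpleGraph V) (S : Finset V) (a b : V) : Prop := (res G S).Reachable a b

@[refl]
protected theorem Conn.refl (G : SimpleGraph V) (S : Finset V) (a : V) : Conn G S a a :=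
  SimpleGraph.Reachable.refl _

protected theorem Conn.rfl : Conn G S a a := Conn.refl G S a

protected theorem Conn.symm (h : Conn G S a b) : Conn G S b a := SimpleGraph.Reachable.symm h

protected theorem Conn.trans (h : Conn G S a b) (h' : Conn G S b c) : Conn G S a c :=
  SimpleGraph.Reachable.trans h h'

theorem res_mono (h : G ≤ G') (hS : S ⊆ S') : res G S ≤ res G' S' :=
  fun _ _ hab => ⟨h hab.1, hS hab.2.1, hS hab.2.2⟩

theorem Conn.mono (h : Conn G S a b) (hS : S ⊆ S') : Conn G S' a b :=
  SimpleGraph.Reachable.mono (res_mono le_rfl hS) h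

theorem Conn.mono_graph (h : Conn G S a b) (hG : G ≤ G') : Conn G' S a b :=
  SimpleGraph.Reachable.mono (res_mono hG subset_rfl) h

theorem Conn.of_adj (h : G.Adj a b) (ha : a ∈ S) (hb : b ∈ S) : Conn G S a b :=
  SimpleGraph.Adj.reachable (G := res G S) ⟨h, ha, hb⟩

/-- A set containing `a` and closed under adjacency inside `S` contains everything joined to `a`. -/
theorem Conn.closed (h : Conn G S a b) (P : V → Prop) (ha : P a)
    (hP : ∀ u v, P u → G.Adj u v → u ∈ S → v ∈ S → P v) : P b := by
  obtain ⟨p⟩ := h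
  induction p with
  | nil => exact ha
  | cons hadj _ ih => exact ih (hP _ _ ha hadj.1 hadj.2.1 hadj.2.2)

theorem Conn.mem (h : Conn G S a b) (ha : a ∈ S) : b ∈ S :=
  h.closed (· ∈ S) ha fun _ _ _ _ _ hv => hv

theorem Conn.of_walk (p : G.Walk a b) (hp : ∀ x ∈ p.support, x ∈ S) : Conn G S a b := by
  induction p with
  | nil => rfl
  | cons hadj p ih =>
    exact (Conn.of_adj hadj (hp _ (by simp)) (hp _ (by simp))).trans
      (ih fun x hx => hp x (by simp [hx]))

theorem Conn.exists_walk (h : Conn G S a b) (ha : a ∈ S) :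
    ∃ p : G.Walk a b, p.IsPath ∧ ∀ x ∈ p.support, x ∈ S := by
  obtain ⟨p⟩ := h
  have : ∃ p : G.Walk a b, ∀ x ∈ p.support, x ∈ S := by
    induction p with
    | nil => exact ⟨.nil, by simpa using ha⟩
    | cons hadj _ ih =>
      obtain ⟨q, hq⟩ := ih hadj.2.2
      refine ⟨.cons hadj.1 q, fun x hx => ?_⟩
      rcases List.mem_cons.1 hx with rfl | hx
      exacts [ha, hq x hx]
  obtain ⟨p, hp⟩ := this
  exact ⟨p.bypass, p.bypass_isPath, fun x hx => hp x (p.support_bypass_subset_support hx)⟩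

/-- Cut a connection short when it first meets `Y`. -/
theorem Conn.trim {Y : Finset V} (h : Conn G S a b) (ha : a ∈ S) (hb : b ∈ Y) :
    ∃ T ⊆ S, ∃ y ∈ Y, a ∈ T ∧ T ∩ Y = {y} ∧ Conn G T a y ∧
      ∀ v ∈ T, v ∉ Y → Conn G (T \ Y) a v := by
  obtain ⟨p, -, hp⟩ := h.exists_walk ha
  clear h
  induction p with
  | nil =>
    rename_i a
    exact ⟨{a}, by simpa using ha, a, hb, by simp, by simpa using hb, Conn.rfl,
      fun v hv _ => by rw [Finset.mem_singleton.1 hv]⟩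
  | cons hadj p ih =>
    rename_i a a' b
    by_cases haY : a ∈ Y
    · exact ⟨{a}, by simpa using ha, a, haY, by simp, by simpa using haY, Conn.rfl,
        fun v hv _ => by rw [Finset.mem_singleton.1 hv]⟩
    have ha' : a' ∈ S := hp _ (by simp)
    by_cases haY' : a' ∈ Y
    · refine ⟨{a, a'}, by simp [Finset.insert_subset_iff, ha, ha'], a', haY', by simp, ?_,
        Conn.of_adj hadj (by simp) (by simp), fun v hv hvY => ?_⟩
      · ext v; simp only [Finset.mem_inter, Finset.mem_insert, Finset.mem_singleton]
        constructor
        · rintro ⟨rfl | rfl, h⟩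
          exacts [absurd h haY, rfl]
        · rintro rfl; exact ⟨Or.inr rfl, haY'⟩
      · simp only [Finset.mem_insert, Finset.mem_singleton] at hv
        rcases hv with rfl | rfl
        exacts [Conn.rfl, absurd haY' hvY]
    · obtain ⟨T, hTS, y, hy, haT, hTY, hT, hTv⟩ := ih ha' hb fun x hx => hp x (by simp [hx])
      have hstep : Conn G (insert a T) a a' := Conn.of_adj hadj (by simp) (by simp [haT])
      refine ⟨insert a T, Finset.insert_subset ha hTS, y, hy, by simp, ?_,
        hstep.trans (hT.mono (Finset.subset_insert _ _)), fun v hv hvY => ?_⟩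
      · rw [Finset.insert_inter_of_notMem haY, hTY]
      · rcases Finset.mem_insert.1 hv with rfl | hv
        · rfl
        · exact (Conn.of_adj hadj (by simp [haY]) (by simp [haT, haY'])).trans
            ((hTv v hv hvY).mono (Finset.sdiff_subset_sdiff (Finset.subset_insert _ _) subset_rfl))

end Connectors

end ParityLinkage
end

section
open scoped Classical
namespace ParityLinkage

/-! ### Menger's theorem for vertex sets. -/

section Menger
variable {V : Type*} [Fintype V] {G G' : SimpleGraph V}

/-- Every walk of `G` from `A` to `B` meets `Z`. -/
def Separates (G : SimpleGraph V) (A B Z : Finset V) : Prop :=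
  ∀ a ∈ A, ∀ b ∈ B, a ∉ Z → b ∉ Z → ¬ Conn G Zᶜ a b

theorem Separates.symm {A B Z : Finset V} (h : Separates G A B Z) : Separates G B A Z :=
  fun a ha b hb ha' hb' hc => h b hb a ha hb' ha' hc.symm

/-- A walk of `G` from `A` avoiding `Z` cannot reach `x` or `Z₀`, since `Z` cuts these off in `G'`.
So it does not use the missing edge from `x`, nor from `y`, which is out of reach; it is a walk of
`G'` avoiding `Z₀` and never arrives in `B`. Thus the lower bound on separators passes from `A`, `B`
in `G` to `A`, `Z₀ + x` in `G'`. -/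
theorem Separates.of_deleteEdge {A B Z₀ Z : Finset V} {x y : V} 
    (hxy : ∀ u v, G.Adj u v → ¬ G'.Adj u v → s(u, v) = s(x, y))
    (hsep : Separates G' A B Z₀) (hy : ∀ a ∈ A, a ∉ Z₀ → ¬ Conn G' Z₀ᶜ a y)
    (h : Separates G' A (insert x Z₀) Z) : Separates G A B Z := by
  intro a ha b hb haZ hbZ hab
  have key : ∀ v, v ∉ Z → Conn G' Zᶜ a v → v ∉ insert x Z₀ := fun v hv hc hvx =>
    h a ha v hvx haZ hv hc
  have haZ₀ : a ∉ Z₀ := fun h' => key a haZ Conn.rfl (Finset.mem_insert_of_mem h')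
  have := hab.closed (fun v => Conn G' Z₀ᶜ a v ∧ Conn G' Zᶜ a v)
    ⟨Conn.rfl, Conn.rfl⟩ (by
      rintro u v ⟨h1, h2⟩ huv hu hv
      rw [Finset.mem_compl] at hu hv
      by_cases h' : G'.Adj u v
      · have h3 : Conn G' Zᶜ a v := h2.trans (Conn.of_adj h' (by simpa) (by simpa))
        have hvx := key v hv h3
        have hux := key u hu h2
        rw [Finset.mem_insert, not_or] at hvx hux
        exact ⟨h1.trans (Conn.of_adj h' (by simpa using hux.2) (by simpa using hvx.2)), h3⟩
      · have hux := key u hu h2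
        have := hxy u v huv h'
        rw [Sym2.eq_iff] at this
        rcases this with ⟨rfl, -⟩ | ⟨rfl, -⟩
        · simp at hux
        · exact absurd h1 (hy a ha haZ₀))
  exact hsep a ha b hb haZ₀ (by simpa using this.1.mem (by simpa using haZ₀)) this.1

/-- Each connector is cut at its first vertex in `P`. As `P` has only `k` vertices, the ends exhaust
`P` and the connectors can be indexed by `P`, with a dummy value elsewhere. Off their ends they are
reachable from `A` outside `Z`, which is what keeps families coming from opposite sides of `Z`
disjoint. -/
theorem exists_connectors_trim {A P Z : Finset V} {k : ℕ} (hP : P.card = k) (hZ : Z ⊆ P)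
    (h : ∃ S : Fin k → Finset V, Pairwise (fun i j => Disjoint (S i) (S j)) ∧
      ∀ i, ∃ a ∈ A, ∃ b ∈ P, a ∈ S i ∧ b ∈ S i ∧ Conn G (S i) a b) :
    ∃ T : V → Finset V, (∀ p ∈ P, p ∈ T p ∧ (∃ a ∈ A, a ∈ T p ∧ Conn G (T p) a p) ∧
      ∀ v ∈ T p, v = p ∨ (v ∉ P ∧ ∃ a ∈ A, a ∉ Z ∧ Conn G Zᶜ a v)) ∧
      ∀ p ∈ P, ∀ q ∈ P, p ≠ q → Disjoint (T p) (T q) := by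
  obtain ⟨S, hS, hSc⟩ := h
  choose a ha b hb haS hbS hc using hSc
  choose T hTS p hp haT hTP hT hTv using fun i => (hc i).trim (haS i) (hb i)
  have hpT : ∀ i, p i ∈ T i := fun i =>
    (Finset.mem_inter.1 ((hTP i).symm ▸ Finset.mem_singleton_self (p i))).1
  have hTd : ∀ i j, i ≠ j → Disjoint (T i) (T j) := fun i j hij =>
    Finset.disjoint_of_subset_left (hTS i) (Finset.disjoint_of_subset_right (hTS j) (hS hij))
  have hinj : Function.Injective (fun i => (⟨p i, hp i⟩ : P)) := by
    intro i j hij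
    by_contra hne
    have : p i = p j := congrArg Subtype.val hij
    exact Finset.disjoint_left.1 (hTd i j hne) (hpT i) (this ▸ hpT j)
  have hbij : Function.Bijective (fun i => (⟨p i, hp i⟩ : P)) :=
    (Fintype.bijective_iff_injective_and_card _).2 ⟨hinj, by simp [hP]⟩
  let e := Equiv.ofBijective _ hbij
  have he : ∀ q (hq : q ∈ P), p (e.symm ⟨q, hq⟩) = q := fun q hq =>
    congrArg Subtype.val (e.apply_symm_apply ⟨q, hq⟩)
  refine ⟨fun q => if hq : q ∈ P then T (e.symm ⟨q, hq⟩) else ∅, fun q hq => ?_,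
    fun q hq q' hq' hne => ?_⟩
  · simp only [hq, dif_pos]
    generalize hi : e.symm ⟨q, hq⟩ = i
    have hpi : p i = q := hi ▸ he q hq
    refine ⟨hpi ▸ hpT i, ⟨a i, ha i, haT i, hpi ▸ hT i⟩, fun v hv => ?_⟩
    by_cases hvP : v ∈ P
    · left
      have : v ∈ T i ∩ P := Finset.mem_inter.2 ⟨hv, hvP⟩
      rw [hTP i, Finset.mem_singleton] at this
      exact this.trans hpi
    · have hc := hTv i v hv hvP
      have haP : a i ∈ T i \ P := hc.symm.mem (Finset.mem_sdiff.2 ⟨hv, hvP⟩)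
      exact Or.inr ⟨hvP, a i, ha i, fun h' => (Finset.mem_sdiff.1 haP).2 (hZ h'),
        hc.mono fun w hw => Finset.mem_compl.2 fun h' => (Finset.mem_sdiff.1 hw).2 (hZ h')⟩
  · simp only [hq, hq', dif_pos]
    refine hTd _ _ fun h' => hne ?_
    have := congrArg p h'
    rwa [he, he] at this

/-- Induction on the number of edges. If after deleting an edge some `Z` with fewer than `k`
vertices separates, then the edge joins a vertex `x` on the side of `A` to a vertex `y` on the side
of `B`, and both `Z + x` and `Z + y` have exactly `k` vertices. Induction applies to `A`, `Z + x`
and to `B`, `Z + y`, and the two families are glued along `Z` and the edge. -/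
theorem menger (A B : Finset V) (k : ℕ) (h : ∀ Z, Separates G A B Z → k ≤ Z.card) :
    ∃ S : Fin k → Finset V, Pairwise (fun i j => Disjoint (S i) (S j)) ∧
      ∀ i, ∃ a ∈ A, ∃ b ∈ B, a ∈ S i ∧ b ∈ S i ∧ Conn G (S i) a b := by
  induction hn : G.edgeSet.ncard using Nat.strong_induction_on generalizing G A B with
  | _ n ih =>
  subst hn
  by_cases hE : ∃ p q, G.Adj p q
  swap
  · push Not at hE
    have hk := h (A ∩ B) (by
      intro a ha b hb haZ _ hc
      have := hc.closed (· = a) rfl fun u v _ huv => absurd huv (hE u v)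
      exact haZ (Finset.mem_inter.2 ⟨ha, this ▸ hb⟩))
    obtain ⟨C, hC, hCk⟩ := Finset.exists_subset_card_eq hk
    let f := (Finset.equivFinOfCardEq hCk).symm
    refine ⟨fun i => {(f i : V)}, fun i j hij => ?_, fun i => ?_⟩
    · simpa [Subtype.coe_inj] using hij
    · have := Finset.mem_inter.1 (hC (f i).2)
      exact ⟨f i, this.1, f i, this.2, by simp, by simp, Conn.rfl⟩
  obtain ⟨p, q, hpq⟩ := hE
  set G' := G.deleteEdges {s(p, q)} with hG'
  have hle : G' ≤ G := SimpleGraph.deleteEdges_le _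
  have hlt : G'.edgeSet.ncard < G.edgeSet.ncard := by
    apply Set.ncard_lt_ncard _ (Set.toFinite _)
    rw [hG', SimpleGraph.edgeSet_deleteEdges]
    exact Set.sdiff_singleton_ssubset.2 hpq
  have hdel : ∀ u v, G.Adj u v → ¬ G'.Adj u v → s(u, v) = s(p, q) := by
    intro u v huv h'
    by_contra hne
    exact h' (by rw [hG', SimpleGraph.deleteEdges_adj]; exact ⟨huv, by simpa using hne⟩)
  by_cases hcase : ∀ Z, Separates G' A B Z → k ≤ Z.card
  · obtain ⟨S, hS, hSc⟩ := ih _ hlt A B hcase rfl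
    refine ⟨S, hS, fun i => ?_⟩
    obtain ⟨a, ha, b, hb, h1, h2, h3⟩ := hSc i
    exact ⟨a, ha, b, hb, h1, h2, h3.mono_graph hle⟩
  push Not at hcase
  obtain ⟨Z, hZ, hZk⟩ := hcase
  have hnot : ¬ Separates G A B Z := fun h' => absurd (h Z h') (by omega)
  simp only [Separates, not_forall, not_not] at hnot
  obtain ⟨a, ha, b, hb, haZ, hbZ, hab⟩ := hnot
  let RA : V → Prop := fun v => ∃ a ∈ A, a ∉ Z ∧ Conn G' Zᶜ a v
  let RB : V → Prop := fun v => ∃ b ∈ B, b ∉ Z ∧ Conn G' Zᶜ b v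
  have hdisj : ∀ v, RA v → RB v → False := by
    rintro v ⟨a, ha, haZ, hav⟩ ⟨b, hb, hbZ, hbv⟩
    exact hZ a ha b hb haZ hbZ (hav.trans hbv.symm)
  -- A walk of `G` that leaves a set closed under the edges of `G'` must leave it along the deleted
  -- edge.
  have hcross : ∀ (R : V → Prop) (a b : V), R a → ¬ R b → Conn G Zᶜ a b →
      (∀ u v, R u → G'.Adj u v → u ∉ Z → v ∉ Z → R v) →
      ∃ x y, G.Adj x y ∧ x ∉ Z ∧ y ∉ Z ∧ R x ∧ ¬ R y ∧ s(x, y) = s(p, q) := by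
    intro R a b hRa hRb hc hcl
    by_contra hno
    push Not at hno
    refine hRb (hc.closed R hRa fun u v hu huv huZ hvZ => ?_)
    rw [Finset.mem_compl] at huZ hvZ
    by_contra hv
    refine hno u v huv huZ hvZ hu hv (hdel u v huv fun h' => hv (hcl u v hu h' huZ hvZ))
  obtain ⟨x, y, hxy, hxZ, hyZ, hRx, hRy, hexy⟩ := hcross RA a b
    ⟨a, ha, haZ, Conn.rfl⟩
    (fun h' => hdisj b h' ⟨b, hb, hbZ, Conn.rfl⟩) hab (by
      rintro u v ⟨a, ha, haZ, hc⟩ huv hu hv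
      exact ⟨a, ha, haZ, hc.trans (Conn.of_adj huv (by simpa) (by simpa))⟩)
  obtain ⟨y', x', -, -, -, hRy', hRx', hexy'⟩ := hcross RB b a
    ⟨b, hb, hbZ, Conn.rfl⟩
    (fun h' => hdisj a ⟨a, ha, haZ, Conn.rfl⟩ h') hab.symm (by
      rintro u v ⟨a, ha, haZ, hc⟩ huv hu hv
      exact ⟨a, ha, haZ, hc.trans (Conn.of_adj huv (by simpa) (by simpa))⟩)
  have hy'y : y' = y := by
    have := hexy'.trans hexy.symm
    rw [Sym2.eq_iff] at this
    rcases this with ⟨h1, -⟩ | ⟨h1, -⟩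
    · exact absurd (h1 ▸ hRy') (fun h' => hdisj x hRx h')
    · exact h1
  subst hy'y
  have hRBx : ¬ RB x := fun h' => hdisj x hRx h'
  have hxyne : x ≠ y' := hxy.ne
  have hdel1 : ∀ u v, G.Adj u v → ¬ G'.Adj u v → s(u, v) = s(x, y') := fun u v h1 h2 =>
    (hdel u v h1 h2).trans hexy.symm
  have hdel2 : ∀ u v, G.Adj u v → ¬ G'.Adj u v → s(u, v) = s(y', x) := fun u v h1 h2 =>
    (hdel1 u v h1 h2).trans Sym2.eq_swap
  have hZx : (insert x Z).card = k := by
    refine le_antisymm (by rw [Finset.card_insert_of_notMem hxZ]; omega) (h _ ?_)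
    refine Separates.of_deleteEdge hdel1 hZ (fun a ha haZ hc => hRy ⟨a, ha, haZ, hc⟩) ?_
    exact fun a ha b hb haZ hbZ => absurd hb hbZ
  have hZy : (insert y' Z).card = k := by
    rw [Finset.card_insert_of_notMem hyZ, ← Finset.card_insert_of_notMem hxZ, hZx]
  obtain ⟨T, hT, hTd⟩ := exists_connectors_trim hZx (Finset.subset_insert x Z)
    (ih _ hlt A (insert x Z) (fun W hW => h W (Separates.of_deleteEdge hdel1 hZ
      (fun a ha haZ hc => hRy ⟨a, ha, haZ, hc⟩) hW)) rfl)
  obtain ⟨T', hT', hTd'⟩ := exists_connectors_trim hZy (Finset.subset_insert y' Z)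
    (ih _ hlt B (insert y' Z) (fun W hW => h W (Separates.of_deleteEdge hdel2 hZ.symm
      (fun a ha haZ hc => hRBx ⟨a, ha, haZ, hc⟩) hW).symm) rfl)
  -- Matches the ends in `Z + x` with the ends in `Z + y'`: the identity on `Z`, and `x` goes to
  -- `y'`.
  let φ : V → V := fun v => if v = x then y' else v
  have hφ : ∀ v ∈ insert x Z, φ v ∈ insert y' Z := by
    intro v hv
    by_cases hvx : v = x
    · simp [φ, hvx]
    · simp only [φ, hvx, if_false]
      exact Finset.mem_insert_of_mem (Finset.mem_of_mem_insert_of_ne hv hvx)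
  have hφinj : ∀ u ∈ insert x Z, ∀ v ∈ insert x Z, u ≠ v → φ u ≠ φ v := by
    intro u hu v hv huv h'
    by_cases hux : u = x <;> by_cases hvx : v = x <;> simp only [φ, hux, hvx, if_true, if_false] at h'
    · exact huv (hux.trans hvx.symm)
    · exact hyZ (h' ▸ Finset.mem_of_mem_insert_of_ne hv hvx)
    · exact hyZ (h' ▸ Finset.mem_of_mem_insert_of_ne hu hux)
    · exact huv h'
  -- Off their ends, the connectors of the first family lie in `RA` and those of the second in `RB`,
  -- so two of them can only meet in a common end in `Z`.
  have hTT : ∀ u ∈ insert x Z, ∀ v ∈ insert x Z, u ≠ v → Disjoint (T u) (T' (φ v)) := by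
    intro u hu v hv huv
    rw [Finset.disjoint_left]
    intro w hw hw'
    rcases (hT u hu).2.2 w hw with rfl | ⟨hwx, hwA⟩ <;>
      rcases (hT' _ (hφ v hv)).2.2 w hw' with h1 | ⟨hwy, hwB⟩
    · by_cases hvx : v = x
      · simp only [φ, hvx, if_true] at h1
        exact (Finset.mem_insert.1 hu).elim (fun h2 => hxyne (h2.symm.trans h1))
          (fun h2 => hyZ (h1 ▸ h2))
      · simp only [φ, hvx, if_false] at h1
        exact huv h1
    · rcases Finset.mem_insert.1 hu with rfl | h2
      · exact hRBx hwB
      · exact hwy (Finset.mem_insert_of_mem h2)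
    · rcases Finset.mem_insert.1 (hφ v hv) with h2 | h2
      · rw [h1, h2] at hwA; exact hRy hwA
      · exact hwx (h1 ▸ Finset.mem_insert_of_mem h2)
    · exact hdisj w hwA hwB
  let f := (Finset.equivFinOfCardEq hZx).symm
  refine ⟨fun i => T (f i) ∪ T' (φ (f i)), fun i j hij => ?_, fun i => ?_⟩
  · have hne : (f i : V) ≠ f j := fun h' => hij (f.injective (Subtype.ext h'))
    simp only [Finset.disjoint_union_left, Finset.disjoint_union_right]
    exact ⟨⟨hTd _ (f i).2 _ (f j).2 hne, (hTT _ (f j).2 _ (f i).2 hne.symm).symm⟩,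
      hTT _ (f i).2 _ (f j).2 hne,
      hTd' _ (hφ _ (f i).2) _ (hφ _ (f j).2) (hφinj _ (f i).2 _ (f j).2 hne)⟩
  · beta_reduce
    generalize hv : (f i : V) = v
    have hvm : v ∈ insert x Z := hv ▸ (f i).2
    obtain ⟨h1, ⟨a, ha, haT, hac⟩, -⟩ := hT v hvm
    obtain ⟨h2, ⟨b, hb, hbT, hbc⟩, -⟩ := hT' _ (hφ v hvm)
    refine ⟨a, ha, b, hb, Finset.mem_union_left _ haT, Finset.mem_union_right _ hbT, ?_⟩
    have h3 : Conn G (T v ∪ T' (φ v)) v (φ v) := by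
      by_cases hvx : v = x
      · subst hvx
        have : φ v = y' := by simp [φ]
        rw [this] at h2 ⊢
        exact Conn.of_adj hxy (Finset.mem_union_left _ h1) (Finset.mem_union_right _ h2)
      · simp only [φ, hvx, if_false]; rfl
    exact ((hac.mono_graph hle).mono Finset.subset_union_left).trans
      (h3.trans ((hbc.mono_graph hle).mono Finset.subset_union_right).symm)

/-- Menger's theorem when the source set `A` is fully linked to `B`. -/
theorem menger_from {A B : Finset V} (h : ∀ Z, Separates G A B Z → A.card ≤ Z.card) :
    ∃ (T : V → Finset V) (e : V → V), (∀ a ∈ A, a ∈ T a ∧ e a ∈ B ∧ T a ∩ B = {e a} ∧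
      T a ∩ A = {a} ∧ Conn G (T a) a (e a)) ∧
      ∀ a ∈ A, ∀ b ∈ A, a ≠ b → Disjoint (T a) (T b) := by
  obtain ⟨S, hS, hSc⟩ := menger A B A.card h
  have hswap : ∃ S : Fin A.card → Finset V, Pairwise (fun i j => Disjoint (S i) (S j)) ∧
      ∀ i, ∃ b ∈ B, ∃ a ∈ A, b ∈ S i ∧ a ∈ S i ∧ Conn G (S i) b a := by
    refine ⟨S, hS, fun i => ?_⟩
    obtain ⟨a, ha, b, hb, h1, h2, h3⟩ := hSc i
    exact ⟨b, hb, a, ha, h2, h1, h3.symm⟩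
  -- The connectors are trimmed twice, first towards `A` and then towards `B`, so that each meets
  -- either set only once.
  obtain ⟨T, hT, hTd⟩ := exists_connectors_trim (Z := ∅) rfl (by simp) hswap
  have key : ∀ a, ∃ (U : Finset V) (y : V), a ∈ A → (U ⊆ T a ∧ y ∈ B ∧ a ∈ U ∧ U ∩ B = {y} ∧
      Conn G U a y) := by
    intro a
    by_cases ha : a ∈ A
    · obtain ⟨h1, ⟨b, hb, hbT, hc⟩, -⟩ := hT a ha
      obtain ⟨U, hU, y, hy, h2, h3, h4, -⟩ := hc.symm.trim h1 hb
      exact ⟨U, y, fun _ => ⟨hU, hy, h2, h3, h4⟩⟩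
    · exact ⟨∅, a, fun h' => absurd h' ha⟩
  choose U e hU using key
  refine ⟨U, e, fun a ha => ?_, fun a ha b hb hab => ?_⟩
  · obtain ⟨h1, h2, h3, h4, h5⟩ := hU a ha
    refine ⟨h3, h2, h4, ?_, h5⟩
    ext v
    simp only [Finset.mem_inter, Finset.mem_singleton]
    constructor
    · rintro ⟨hv, hvA⟩
      rcases (hT a ha).2.2 v (h1 hv) with h' | h'
      exacts [h', absurd hvA h'.1]
    · rintro rfl; exact ⟨h3, ha⟩
  · exact Finset.disjoint_of_subset_left (hU a ha).1
      (Finset.disjoint_of_subset_right (hU b hb).1 (hTd a ha b hb hab))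
end Menger
end ParityLinkage
end

section
open scoped Classical
namespace ParityLinkage

/-! ### Massed pairs, linked sets, and the removal of rigid parts. -/

section Linkage
variable {V : Type*} {G G' : SimpleGraph V} {k : ℕ}

/-- The number of ordered pairs of adjacent vertices of `U` that meet `S`. -/
noncomputable def mass (G : SimpleGraph V) (U S : Finset V) : ℕ :=
  ((U ×ˢ U).filter fun p => G.Adj p.1 p.2 ∧ (p.1 ∈ S ∨ p.2 ∈ S)).card

/-- `(A, B)` is a separation of `G[U]`. -/
def IsSepn (G : SimpleGraph V) (U A B : Finset V) : Prop :=
  A ∪ B = U ∧ ∀ a ∈ A \ B, ∀ b ∈ B \ A, ¬ G.Adj a b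

/-- `G[U]` has many edges outside `X`, and no separation of small order hides too many of them. -/
def Massed (k : ℕ) (G : SimpleGraph V) (U X : Finset V) : Prop :=
  12 * k * (U \ X).card < mass G U (U \ X) ∧
  ∀ A B, IsSepn G U A B → X ⊆ A → (A ∩ B).card < X.card →
    mass G U (B \ A) ≤ 12 * k * (B \ A).card

/-- Any disjoint pairs of vertices of `X` can be joined by disjoint connected subsets of `U`
whose only vertices in `X` are the vertices of the pair. -/
def Linked (G : SimpleGraph V) (U X : Finset V) : Prop :=
  ∀ (ι : Type) (s t : ι → V), Function.Injective (Sum.elim s t) → (∀ i, s i ∈ X) →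
    (∀ i, t i ∈ X) → ∃ S : ι → Finset V, (∀ i, S i ⊆ U ∧ s i ∈ S i ∧ t i ∈ S i ∧
      (∀ x ∈ S i, x ∈ X → x = s i ∨ x = t i) ∧ Conn G (S i) (s i) (t i)) ∧
      Pairwise fun i j => Disjoint (S i) (S j)

theorem mass_le {U U' S S' : Finset V} (h : ∀ a b, G.Adj a b → a ∈ U → b ∈ U → (a ∈ S ∨ b ∈ S) →
    G'.Adj a b ∧ a ∈ U' ∧ b ∈ U' ∧ (a ∈ S' ∨ b ∈ S')) : mass G U S ≤ mass G' U' S' := by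
  refine Finset.card_le_card fun p hp => ?_
  simp only [Finset.mem_filter, Finset.mem_product] at hp ⊢
  obtain ⟨h1, h2, h3, h4⟩ := h p.1 p.2 hp.2.1 hp.1.1 hp.1.2 hp.2.2
  exact ⟨⟨h2, h3⟩, h1, h4⟩

theorem mass_le_add {G'' : SimpleGraph V} {U U' U'' S S' S'' : Finset V}
    (h : ∀ a b, G.Adj a b → a ∈ U → b ∈ U → (a ∈ S ∨ b ∈ S) →
    (G'.Adj a b ∧ a ∈ U' ∧ b ∈ U' ∧ (a ∈ S' ∨ b ∈ S')) ∨
      (G''.Adj a b ∧ a ∈ U'' ∧ b ∈ U'' ∧ (a ∈ S'' ∨ b ∈ S''))) :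
    mass G U S ≤ mass G' U' S' + mass G'' U'' S'' := by
  refine le_trans (Finset.card_le_card fun p hp => ?_) (Finset.card_union_le _ _)
  simp only [Finset.mem_union, Finset.mem_filter, Finset.mem_product] at hp ⊢
  rcases h p.1 p.2 hp.2.1 hp.1.1 hp.1.2 hp.2.2 with ⟨h1, h2, h3, h4⟩ | ⟨h1, h2, h3, h4⟩
  exacts [Or.inl ⟨⟨h2, h3⟩, h1, h4⟩, Or.inr ⟨⟨h2, h3⟩, h1, h4⟩]

theorem IsSepn.mem_of_adj {U A B : Finset V} (h : IsSepn G U A B) {a b : V} (hab : G.Adj a b)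
    (ha : a ∈ U) (hb : b ∈ B) (hbA : b ∉ A) : a ∈ B := by
  by_contra haB
  rw [← h.1, Finset.mem_union] at ha
  exact h.2 a (by simp [haB, ha.resolve_right haB]) b (by simp [hb, hbA]) hab

theorem IsSepn.mass_eq {U A B : Finset V} (h : IsSepn G U A B) :
    mass G U (B \ A) = mass G B (B \ A) := by
  apply le_antisymm <;> apply mass_le
  · intro a b hab ha hb hS
    simp only [Finset.mem_sdiff] at hS
    refine ⟨hab, ?_, ?_, by simpa using hS⟩
    · exact hS.elim (fun h' => h'.1) fun h' => h.mem_of_adj hab ha h'.1 h'.2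
    · exact hS.elim (fun h' => h.mem_of_adj hab.symm hb h'.1 h'.2) fun h' => h'.1
  · intro a b hab ha hb hS
    exact ⟨hab, h.1 ▸ Finset.mem_union_right _ ha, h.1 ▸ Finset.mem_union_right _ hb, hS⟩

/-- Cutting `B` once more, with the old separator kept on the left, changes neither the order of the
new separation nor its right-hand interior. So a violation of the separation condition found inside
`B` is one in `U`. -/
theorem IsSepn.trans {U A B C D : Finset V} (h : IsSepn G U A B) (h' : IsSepn G B C D)
    (hC : A ∩ B ⊆ C) : IsSepn G U (A ∪ C) D ∧ (A ∪ C) ∩ D = C ∩ D ∧ D \ (A ∪ C) = D \ C := by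
  have hD : D ⊆ B := h'.1 ▸ Finset.subset_union_right
  have hCB : C ⊆ B := h'.1 ▸ Finset.subset_union_left
  refine ⟨⟨by rw [Finset.union_assoc, h'.1, h.1], fun a ha b hb hab => ?_⟩, ?_, ?_⟩
  · simp only [Finset.mem_sdiff, Finset.mem_union, not_or] at ha hb
    have haB : a ∈ B := h.mem_of_adj hab
      (h.1 ▸ Finset.mem_union.2 (ha.1.imp_right fun h => hCB h)) (hD hb.1) hb.2.1
    have haC : a ∈ C := ha.1.elim (fun h1 => hC (Finset.mem_inter.2 ⟨h1, haB⟩)) id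
    exact h'.2 a (by simp [haC, ha.2]) b (by simp [hb.1, hb.2.2]) hab
  · ext v
    have h1 := @hC v
    have h2 := @hD v
    simp only [Finset.mem_inter, Finset.mem_union] at *
    tauto
  · ext v
    have h1 := @hC v
    have h2 := @hD v
    simp only [Finset.mem_inter, Finset.mem_union, Finset.mem_sdiff] at *
    tauto

theorem sdiff_inter_left' (A B : Finset V) : B \ (A ∩ B) = B \ A := by
  ext; simp

/-- A part that is too heavy is again massed. -/
theorem IsSepn.massed {U A B : Finset V} (h : IsSepn G U A B)
    (hm : 12 * k * (B \ A).card < mass G U (B \ A))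
    (hM : ∀ C D, IsSepn G B C D → A ∩ B ⊆ C → (C ∩ D).card < (A ∩ B).card →
      mass G U (D \ C) ≤ 12 * k * (D \ C).card) : Massed k G B (A ∩ B) := by
  refine ⟨?_, fun C D hCD hC hlt => ?_⟩
  · rw [sdiff_inter_left', ← h.mass_eq]; exact hm
  · refine le_trans (mass_le fun a b hab ha hb hS => ?_) (hM C D hCD hC hlt)
    exact ⟨hab, h.1 ▸ Finset.mem_union_right _ ha, h.1 ▸ Finset.mem_union_right _ hb, hS⟩

/-- By `IsSepn.trans` a violation inside `B` is a violation inside `U`, of order less than |A ∩ B| ≤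
|X|. -/
theorem Massed.sub {U X A B : Finset V} (hM : Massed k G U X) (h : IsSepn G U A B) (hX : X ⊆ A)
    (hle : (A ∩ B).card ≤ X.card) (hm : 12 * k * (B \ A).card < mass G U (B \ A)) :
    Massed k G B (A ∩ B) := by
  refine h.massed hm fun C D hCD hC hlt => ?_
  obtain ⟨h1, h2, h3⟩ := h.trans hCD hC
  rw [← h3]
  exact hM.2 _ _ h1 (hX.trans Finset.subset_union_left) (by rw [h2]; omega)

/-- If the separation condition fails, then it fails with a massed part. -/
theorem exists_massed_part {U X : Finset V} (h : ¬ ∀ A B, IsSepn G U A B → X ⊆ A →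
    (A ∩ B).card < X.card → mass G U (B \ A) ≤ 12 * k * (B \ A).card) :
    ∃ A B, IsSepn G U A B ∧ X ⊆ A ∧ (A ∩ B).card < X.card ∧
      12 * k * (B \ A).card < mass G U (B \ A) ∧ Massed k G B (A ∩ B) := by
  push Not at h
  obtain ⟨A₀, B₀, h₀⟩ := h
  -- Among all violating separations take one with `B` smallest; a violation inside `B` would extend
  -- to one of `U` with a smaller right side.
  have hex : ∃ n, ∃ A B : Finset V, B.card = n ∧ IsSepn G U A B ∧ X ⊆ A ∧ (A ∩ B).card < X.card ∧
      12 * k * (B \ A).card < mass G U (B \ A) := ⟨_, A₀, B₀, rfl, h₀⟩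
  obtain ⟨A, B, hB, h1, h2, h3, h4⟩ := Nat.find_spec hex
  refine ⟨A, B, h1, h2, h3, h4, h1.massed h4 fun C D hCD hC hlt => ?_⟩
  obtain ⟨h5, h6, h7⟩ := h1.trans hCD hC
  by_contra hcon
  push Not at hcon
  have hDB : D.card < B.card := by
    have hsub : D ⊆ B := hCD.1 ▸ Finset.subset_union_right
    refine Finset.card_lt_card (hsub.ssubset_of_ne fun hDB => ?_)
    have hCB : C ⊆ B := hCD.1 ▸ Finset.subset_union_left
    rw [hDB, Finset.inter_eq_left.2 hCB] at hlt
    exact absurd (Finset.card_le_card hC) (by omega)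
  refine Nat.find_min hex (hB ▸ hDB) ⟨A ∪ C, D, rfl, h5, h2.trans Finset.subset_union_left,
    by rw [h6]; omega, by rw [h7]; exact hcon⟩

theorem Linked.mono {U X Y : Finset V} (h : Linked G U X) (hY : Y ⊆ X) : Linked G U Y := by
  intro ι s t hst hs ht
  obtain ⟨S, hS, hd⟩ := h ι s t hst (fun i => hY (hs i)) (fun i => hY (ht i))
  exact ⟨S, fun i => ⟨(hS i).1, (hS i).2.1, (hS i).2.2.1, fun x hx hxY => (hS i).2.2.2.1 x hx (hY hxY),
    (hS i).2.2.2.2⟩, hd⟩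

theorem Linked.mono_graph {U X : Finset V} (h : Linked G U X) (hG : G ≤ G') : Linked G' U X := by
  intro ι s t hst hs ht
  obtain ⟨S, hS, hd⟩ := h ι s t hst hs ht
  exact ⟨S, fun i => ⟨(hS i).1, (hS i).2.1, (hS i).2.2.1, (hS i).2.2.2.1,
    (hS i).2.2.2.2.mono_graph hG⟩, hd⟩

/-- The complete graph on `Y`, as a graph on the ambient vertex type. -/
def cliqueOn (Y : Finset V) : SimpleGraph V where
  Adj a b := a ≠ b ∧ a ∈ Y ∧ b ∈ Y
  symm := ⟨fun _ _ h => ⟨h.1.symm, h.2.2, h.2.1⟩⟩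
  loopless := ⟨fun _ h => h.1 rfl⟩

/-- Until a vertex of `Y` is reached, only edges of `G` can have been used. -/
theorem exists_exit {S Y : Finset V} {a b : V} (h : Conn (G ⊔ cliqueOn Y) S a b)
    (hn : ¬ Conn G S a b) : ∃ y ∈ S, y ∈ Y ∧ Conn G S a y := by
  by_contra hno
  push Not at hno
  refine hn (h.closed (fun v => Conn G S a v) Conn.rfl fun u v hu huv huS hvS => ?_)
  rcases huv with huv | huv
  · exact hu.trans (Conn.of_adj huv huS hvS)
  · exact absurd hu (hno u huS huv.2.1)

/-- Edges of a clique on `A ∩ B` may be replaced by a linkage in `B`. -/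
theorem Linked.replace {A B X Y : Finset V} (h : Linked (G ⊔ cliqueOn Y) A X) (hB : Linked G B Y)
    (hAB : A ∩ B ⊆ Y) (hX : X ⊆ A) : Linked G (A ∪ B) X := by
  intro ι s t hst hs ht
  obtain ⟨S, hS, hd⟩ := h ι s t hst hs ht
  -- For a pair that depends on clique edges, `y` is a vertex of `Y` reached from `s i` within `G`,
  -- and `y'` one reached from `t i`. A connector in `B` between them replaces the clique edges.
  have key : ∀ i : {i // ¬ Conn G (S i) (s i) (t i)}, ∃ y y', y ∈ S i ∧ y ∈ Y ∧ y' ∈ S i ∧ y' ∈ Y ∧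
      Conn G (S i) (s i) y ∧ Conn G (S i) y' (t i) := by
    rintro ⟨i, hi⟩
    obtain ⟨y, h1, h2, h3⟩ := exists_exit (hS i).2.2.2.2 hi
    obtain ⟨y', h1', h2', h3'⟩ := exists_exit (hS i).2.2.2.2.symm fun h' => hi h'.symm
    exact ⟨y, y', h1, h2, h1', h2', h3, h3'.symm⟩
  choose y y' hy hyY hy' hyY' hc hc' using key
  have hne : ∀ i, y i ≠ y' i := fun i h' => i.2 ((hc i).trans (h' ▸ hc' i))
  have hsep : ∀ i j, ∀ v ∈ S i, v ∈ S j → i = j := fun i j v hv hv' => by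
    by_contra hij
    exact Finset.disjoint_left.1 (hd hij) hv hv'
  obtain ⟨R, hR, hRd⟩ := hB _ y y' (by
    rintro (i | i) (j | j) hij <;> simp only [Sum.elim_inl, Sum.elim_inr] at hij
    · rw [Subtype.ext (hsep i j _ (hy i) (hij ▸ hy j))]
    · have := Subtype.ext (hsep i j _ (hy i) (hij ▸ hy' j))
      subst this
      exact absurd hij (hne i)
    · have := Subtype.ext (hsep i j _ (hy' i) (hij ▸ hy j))
      subst this
      exact absurd hij.symm (hne i)
    · rw [Subtype.ext (hsep i j _ (hy' i) (hij ▸ hy' j))]) hyY hyY'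
  -- The connectors in `B` return to `A` only in their ends, which already belong to the same pair;
  -- this preserves disjointness.
  have hRS : ∀ i, ∀ v ∈ R i, v ∈ A → v ∈ S i := fun i v hv hvA => by
    rcases (hR i).2.2.2.1 v hv (hAB (Finset.mem_inter.2 ⟨hvA, (hR i).1 hv⟩)) with rfl | rfl
    exacts [hy i, hy' i]
  let R' : ι → Finset V := fun i => if hi : ¬ Conn G (S i) (s i) (t i) then R ⟨i, hi⟩ else ∅
  have hR' : ∀ i v, v ∈ R' i → ∃ hi : ¬ Conn G (S i) (s i) (t i), v ∈ R ⟨i, hi⟩ := by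
    intro i v hv
    by_cases hi : ¬ Conn G (S i) (s i) (t i)
    · exact ⟨hi, by simpa [R', hi] using hv⟩
    · simp [R', not_not.1 hi] at hv
  refine ⟨fun i => S i ∪ R' i, fun i => ⟨?_, ?_, ?_, ?_, ?_⟩, fun i j hij => ?_⟩
  · refine Finset.union_subset_union (hS i).1 fun v hv => ?_
    obtain ⟨hi, hv⟩ := hR' i v hv
    exact (hR ⟨i, hi⟩).1 hv
  · exact Finset.mem_union_left _ (hS i).2.1
  · exact Finset.mem_union_left _ (hS i).2.2.1
  · intro x hx hxX
    refine (hS i).2.2.2.1 x ?_ hxX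
    rcases Finset.mem_union.1 hx with hx | hx
    · exact hx
    · obtain ⟨hi, hx⟩ := hR' i x hx
      exact hRS ⟨i, hi⟩ x hx (hX hxX)
  · by_cases hi : ¬ Conn G (S i) (s i) (t i)
    · have hRi : R' i = R ⟨i, hi⟩ := by simp [R', hi]
      beta_reduce
      rw [hRi]
      exact ((hc ⟨i, hi⟩).mono Finset.subset_union_left).trans
        (((hR ⟨i, hi⟩).2.2.2.2.mono Finset.subset_union_right).trans
        ((hc' ⟨i, hi⟩).mono Finset.subset_union_left))
    · exact (not_not.1 hi).mono Finset.subset_union_left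
  · beta_reduce
    rw [Finset.disjoint_left]
    intro v hv hv'
    refine hij ?_
    rcases Finset.mem_union.1 hv with hv | hv <;> rcases Finset.mem_union.1 hv' with hv' | hv'
    · exact hsep i j v hv hv'
    · obtain ⟨hj, hv'⟩ := hR' j v hv'
      exact hsep i j v hv (hRS ⟨j, hj⟩ v hv' ((hS i).1 hv))
    · obtain ⟨hi, hv⟩ := hR' i v hv
      exact hsep i j v (hRS ⟨i, hi⟩ v hv ((hS j).1 hv')) hv'
    · obtain ⟨hi, hv⟩ := hR' i v hv
      obtain ⟨hj, hv'⟩ := hR' j v hv'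
      by_contra hne
      exact Finset.disjoint_left.1 (hRd (i := ⟨i, hi⟩) (j := ⟨j, hj⟩) (by simpa using hne)) hv hv'

/-- The induction hypothesis for the linkage theorem. -/
def LinkedBelow (V : Type*) (k n : ℕ) : Prop :=
  ∀ (G : SimpleGraph V) (U X : Finset V), U.card < n → X ⊆ U → X.card ≤ 2 * k →
    Massed k G U X → Linked G U X

/-- A linked part behind a separator of order less than `|X|` can be removed. -/
theorem Massed.linked_of_rigid {U X : Finset V} (ih : LinkedBelow V k U.card)
    (hXk : X.card ≤ 2 * k) (hM : Massed k G U X) :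
    ∀ A B, IsSepn G U A B → X ⊆ A → (A ∩ B).card < X.card → (B \ A).Nonempty →
      Linked G B (A ∩ B) → Linked G U X := by
  intro A
  induction hn : A.card using Nat.strong_induction_on generalizing A with
  | _ n ihA =>
  subst hn
  intro B hAB hXA hlt hne hB
  have hAU : A ⊆ U := hAB.1 ▸ Finset.subset_union_left
  have hBU : B ⊆ U := hAB.1 ▸ Finset.subset_union_right
  have hcard : (U \ X).card = (A \ X).card + (B \ A).card := by
    rw [← Finset.card_union_of_disjoint]
    · congr 1
      ext v
      have := @hXA v
      rw [← hAB.1]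
      simp only [Finset.mem_sdiff, Finset.mem_union]
      tauto
    · rw [Finset.disjoint_left]; intro v h1 h2
      exact (Finset.mem_sdiff.1 h2).2 (Finset.mem_sdiff.1 h1).1
  have hAcard : A.card < U.card := by
    refine Finset.card_lt_card (hAU.ssubset_of_ne ?_)
    rintro rfl
    obtain ⟨v, hv⟩ := hne
    exact (Finset.mem_sdiff.1 hv).2 (hBU (Finset.mem_sdiff.1 hv).1)
  -- `B` is exchanged for a clique on `A ∩ B`. The lost mass is at most `12k|B \ A|`, so `A` keeps
  -- enough of it. If the separation condition holds too, the induction hypothesis links `X` in `A`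
  -- and `Linked.replace` puts `B` back.
  by_cases hM2 : ∀ C D, IsSepn (G ⊔ cliqueOn (A ∩ B)) A C D → X ⊆ C → (C ∩ D).card < X.card →
      mass (G ⊔ cliqueOn (A ∩ B)) A (D \ C) ≤ 12 * k * (D \ C).card
  · have hMA : Massed k (G ⊔ cliqueOn (A ∩ B)) A X := by
      refine ⟨?_, hM2⟩
      have h1 : mass G U (U \ X) ≤ mass (G ⊔ cliqueOn (A ∩ B)) A (A \ X) + mass G U (B \ A) := by
        refine mass_le_add fun a b hab ha hb hS => ?_
        by_cases h' : a ∈ B \ A ∨ b ∈ B \ A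
        · exact Or.inr ⟨hab, ha, hb, h'⟩
        · rw [← hAB.1] at ha hb
          simp only [Finset.mem_sdiff, Finset.mem_union] at *
          exact Or.inl ⟨Or.inl hab, by tauto, by tauto, by tauto⟩
      have h2 := hM.1
      have h3 := hM.2 A B hAB hXA hlt
      rw [hcard, mul_add] at h2
      omega
    have := (ih _ A X hAcard hXA hXk hMA).replace hB subset_rfl hXA
    rwa [hAB.1] at this
  obtain ⟨C, D, hCD, hXC, hlt', hm, hMD⟩ := exists_massed_part hM2
  have hCA : C ⊆ A := hCD.1 ▸ Finset.subset_union_left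
  have hDA : D ⊆ A := hCD.1 ▸ Finset.subset_union_right
  -- If the clique lies in `C`, then `B` can be returned to that side, and the violation is already
  -- one in `G`.
  by_cases hYC : A ∩ B ⊆ C
  · exfalso
    have hs : IsSepn G U (C ∪ B) D := by
      refine ⟨by rw [← hAB.1, ← hCD.1]; ext; simp; tauto, fun a ha b hb hab => ?_⟩
      simp only [Finset.mem_sdiff, Finset.mem_union, not_or] at ha hb
      rcases ha.1 with h1 | h1
      · exact hCD.2 a (by simp [h1, ha.2]) b (by simp [hb]) (Or.inl hab)
      · by_cases haA : a ∈ A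
        · exact hCD.2 a (by simp [hYC (Finset.mem_inter.2 ⟨haA, h1⟩), ha.2]) b (by simp [hb])
            (Or.inl hab)
        · exact hAB.2 b (by simp [hDA hb.1, hb.2.2]) a (by simp [h1, haA]) hab.symm
    have hBD : ∀ v, v ∈ B → v ∈ D → v ∈ C := fun v h1 h2 =>
      hYC (Finset.mem_inter.2 ⟨hDA h2, h1⟩)
    have h1 : (C ∪ B) ∩ D = C ∩ D := by
      ext v; have := hBD v; simp only [Finset.mem_inter, Finset.mem_union]; tauto
    have h2 : D \ (C ∪ B) = D \ C := by
      ext v; have := hBD v; simp only [Finset.mem_sdiff, Finset.mem_union]; tauto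
    have h3 := hM.2 _ _ hs (hXC.trans Finset.subset_union_left) (by rw [h1]; exact hlt')
    rw [h2] at h3
    have h4 : mass (G ⊔ cliqueOn (A ∩ B)) A (D \ C) ≤ mass G U (D \ C) := by
      refine mass_le fun a b hab ha hb hS => ⟨?_, hAU ha, hAU hb, hS⟩
      refine hab.resolve_right fun h' => ?_
      rcases hS with h5 | h5
      · exact (Finset.mem_sdiff.1 h5).2 (hYC h'.2.1)
      · exact (Finset.mem_sdiff.1 h5).2 (hYC h'.2.2)
    omega
  -- Otherwise the clique, which no separation splits, lies in `D`. Then `D` is linked by induction,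
  -- hence so is `D ∪ B`, and `C` is a smaller left side for the same argument.
  · obtain ⟨y, hy, hyC⟩ := Finset.not_subset.1 hYC
    have hyA := (Finset.mem_inter.1 hy).1
    have hyD : y ∈ D := by
      have := hCD.1.symm ▸ hyA
      exact (Finset.mem_union.1 this).resolve_left hyC
    have hYD : A ∩ B ⊆ D := by
      intro z hz
      by_cases hzy : z = y
      · rwa [hzy]
      · by_contra hzD
        have hzC : z ∈ C := by
          have := hCD.1.symm ▸ (Finset.mem_inter.1 hz).1
          exact (Finset.mem_union.1 this).resolve_right hzD
        exact hCD.2 z (by simp [hzC, hzD]) y (by simp [hyD, hyC]) (Or.inr ⟨hzy, hz, hy⟩)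
    have hCcard : C.card < A.card := Finset.card_lt_card
      (hCA.ssubset_of_ne fun h' => hyC (h' ▸ hyA))
    have hDl : Linked (G ⊔ cliqueOn (A ∩ B)) D (C ∩ D) :=
      ih _ D _ (lt_of_le_of_lt (Finset.card_le_card hDA) hAcard) Finset.inter_subset_right
        (by omega) hMD
    have hDB : Linked G (D ∪ B) (C ∩ D) := hDl.replace hB
      (Finset.inter_subset_inter_right hDA) Finset.inter_subset_right
    have h1 : C ∩ (D ∪ B) = C ∩ D := by
      ext v
      have h2 := @hYD v
      have h3 := @hCA v
      simp only [Finset.mem_inter, Finset.mem_union] at *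
      tauto
    refine ihA C.card hCcard C rfl (D ∪ B) ⟨?_, fun a ha b hb hab => ?_⟩ hXC (by rw [h1]; exact hlt')
      ⟨y, by simp [hyD, hyC]⟩ (by rw [h1]; exact hDB)
    · rw [← Finset.union_assoc, hCD.1, hAB.1]
    · simp only [Finset.mem_sdiff, Finset.mem_union, not_or] at ha hb
      by_cases hbD : b ∈ D
      · exact hCD.2 a (by simp [ha.1, ha.2]) b (by simp [hbD, hb.2]) (Or.inl hab)
      · have hbB := hb.1.resolve_left hbD
        have hbA : b ∉ A := fun h' => hbD (hYD (Finset.mem_inter.2 ⟨h', hbB⟩))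
        exact hAB.2 a (by simp [hCA ha.1, ha.2.2]) b (by simp [hbB, hbA]) hab

end Linkage
end ParityLinkage
end

section
open scoped Classical
namespace ParityLinkage

/-! ### Linking through a hub. -/

section Hub
variable {V : Type*} {G G' : SimpleGraph V} {k : ℕ}

theorem conn_res {S W : Finset V} {a b : V} (h : Conn (res G W) S a b) : Conn G (S ∩ W) a b := by
  refine h.closed (fun v => Conn G (S ∩ W) a v) Conn.rfl fun u v hu huv huS hvS => ?_
  exact hu.trans (Conn.of_adj huv.1 (by simp [huS, huv.2.1]) (by simp [hvS, huv.2.2]))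

/-- Menger's theorem gives disjoint connectors from all of `X` to `Y` outside `L \ Y`. Their ends
transport a pairing of vertices of `X` to one of vertices of `Y`, which is realised in `L`;
connectors and linkage meet only in those ends. -/
theorem linked_of_connectors [Fintype V] {U X L Y : Finset V} (hY : Y ⊆ L) (hLU : L ⊆ U)
    (hXU : X ⊆ U) (hXL : Disjoint X (L \ Y))
    (hZ : ∀ Z, Separates (res G (U \ L ∪ Y)) X Y Z → X.card ≤ Z.card)
    (hL : ∀ T ⊆ Y, T.card ≤ X.card → Linked G L T) : Linked G U X := by
  obtain ⟨T, e, hT, hTd⟩ := menger_from hZ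
  set W := U \ L ∪ Y with hW
  have hWU : W ⊆ U := Finset.union_subset Finset.sdiff_subset (hY.trans hLU)
  have hWL : ∀ v ∈ W, v ∈ L → v ∈ Y := fun v hv hvL => by
    rcases Finset.mem_union.1 hv with h | h
    exacts [absurd hvL (Finset.mem_sdiff.1 h).2, h]
  have hXLY : ∀ x ∈ X, x ∈ L → x ∈ Y := fun x hx hxL => by
    by_contra h
    exact Finset.disjoint_left.1 hXL hx (Finset.mem_sdiff.2 ⟨hxL, h⟩)
  have hXW : ∀ x ∈ X, x ∈ W := fun x hx => by
    by_cases h : x ∈ L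
    · exact Finset.mem_union_right _ (hXLY x hx h)
    · exact Finset.mem_union_left _ (Finset.mem_sdiff.2 ⟨hXU hx, h⟩)
  have heT : ∀ a ∈ X, e a ∈ T a := fun a ha =>
    (Finset.mem_inter.1 ((hT a ha).2.2.1.symm ▸ Finset.mem_singleton_self (e a))).1
  have hsep : ∀ a ∈ X, ∀ b ∈ X, ∀ v ∈ T a, v ∈ T b → a = b := fun a ha b hb v hv hv' => by
    by_contra hne
    exact Finset.disjoint_left.1 (hTd a ha b hb hne) hv hv'
  have heinj : ∀ a ∈ X, ∀ b ∈ X, e a = e b → a = b := fun a ha b hb h =>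
    hsep a ha b hb _ (heT a ha) (h ▸ heT b hb)
  have hTL : ∀ a ∈ X, ∀ v ∈ T a, v ∈ W → v ∈ L → v = e a := fun a ha v hv hvW hvL => by
    have : v ∈ T a ∩ Y := Finset.mem_inter.2 ⟨hv, hWL v hvW hvL⟩
    rw [(hT a ha).2.2.1] at this
    exact Finset.mem_singleton.1 this
  have hTX : ∀ a ∈ X, ∀ v ∈ T a, v ∈ X → v = a := fun a ha v hv hvX => by
    have : v ∈ T a ∩ X := Finset.mem_inter.2 ⟨hv, hvX⟩
    rw [(hT a ha).2.2.2.1] at this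
    exact Finset.mem_singleton.1 this
  have hlink : Linked G L (X.image e) := hL _
    (Finset.image_subset_iff.2 fun a ha => (hT a ha).2.1) Finset.card_image_le
  intro ι s t hst hs ht
  have hmem : ∀ z : ι ⊕ ι, Sum.elim s t z ∈ X := by rintro (i | i); exacts [hs i, ht i]
  obtain ⟨R, hR, hRd⟩ := hlink ι (e ∘ s) (e ∘ t) (by
    rw [← Sum.comp_elim]
    exact fun z z' h => hst (heinj _ (hmem z) _ (hmem z') h))
    (fun i => Finset.mem_image_of_mem e (hs i)) (fun i => Finset.mem_image_of_mem e (ht i))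
  have hRX : ∀ i, ∀ a ∈ X, e a ∈ R i → a = s i ∨ a = t i := fun i a ha h => by
    rcases (hR i).2.2.2.1 _ h (Finset.mem_image_of_mem e ha) with h' | h'
    exacts [Or.inl (heinj _ ha _ (hs i) h'), Or.inr (heinj _ ha _ (ht i) h')]
  have hne : ∀ i j, i ≠ j → s i ≠ s j ∧ s i ≠ t j ∧ t i ≠ s j ∧ t i ≠ t j := fun i j hij =>
    ⟨fun h => hij (Sum.inl.inj (@hst (.inl i) (.inl j) h)),
     fun h => Sum.inl_ne_inr (@hst (.inl i) (.inr j) h),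
     fun h => Sum.inr_ne_inl (@hst (.inr i) (.inl j) h),
     fun h => hij (Sum.inr.inj (@hst (.inr i) (.inr j) h))⟩
  have hRT : ∀ i, ∀ a ∈ X, ∀ v ∈ R i, v ∈ T a ∩ W → a = s i ∨ a = t i := fun i a ha v hv hva => by
    rw [Finset.mem_inter] at hva
    exact hRX i a ha (hTL a ha v hva.1 hva.2 ((hR i).1 hv) ▸ hv)
  have heW : ∀ a ∈ X, e a ∈ T a ∩ W := fun a ha =>
    Finset.mem_inter.2 ⟨heT a ha, Finset.mem_union_right _ (hT a ha).2.1⟩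
  -- The connector sets may contain vertices outside `W` that their walks do not visit; intersecting
  -- with `W` removes these.
  refine ⟨fun i => R i ∪ (T (s i) ∩ W ∪ T (t i) ∩ W), fun i => ⟨?_, ?_, ?_, ?_, ?_⟩,
    fun i j hij => ?_⟩
  · exact Finset.union_subset ((hR i).1.trans hLU) (Finset.union_subset
      (Finset.inter_subset_right.trans hWU) (Finset.inter_subset_right.trans hWU))
  · simp [(hT _ (hs i)).1, hXW _ (hs i)]
  · simp [(hT _ (ht i)).1, hXW _ (ht i)]
  · intro x hx hxX
    simp only [Finset.mem_union] at hx
    rcases hx with hx | hx | hx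
    · have hxe : x = e x := hTL x hxX x (hT x hxX).1 (hXW x hxX) ((hR i).1 hx)
      exact hRX i x hxX (hxe ▸ hx)
    · exact Or.inl (hTX _ (hs i) x (Finset.mem_inter.1 hx).1 hxX)
    · exact Or.inr (hTX _ (ht i) x (Finset.mem_inter.1 hx).1 hxX)
  · have h1 := conn_res (hT _ (hs i)).2.2.2.2
    have h2 := conn_res (hT _ (ht i)).2.2.2.2
    have h3 := (hR i).2.2.2.2
    exact (h1.mono (by grind)).trans ((h3.mono (by grind)).trans (h2.symm.mono (by grind)))
  · beta_reduce
    rw [Finset.disjoint_left]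
    intro v hv hv'
    obtain ⟨n1, n2, n3, n4⟩ := hne i j hij
    simp only [Finset.mem_union] at hv hv'
    have hTT : ∀ a ∈ X, ∀ b ∈ X, v ∈ T a ∩ W → v ∈ T b ∩ W → a = b := fun a ha b hb h1 h2 =>
      hsep a ha b hb v (Finset.mem_inter.1 h1).1 (Finset.mem_inter.1 h2).1
    rcases hv with hv | hv | hv <;> rcases hv' with hv' | hv' | hv'
    · exact Finset.disjoint_left.1 (hRd hij) hv hv'
    · exact (hRT i _ (hs j) v hv hv').elim (fun h => n1 h.symm) fun h => n3 h.symm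
    · exact (hRT i _ (ht j) v hv hv').elim (fun h => n2 h.symm) fun h => n4 h.symm
    · exact (hRT j _ (hs i) v hv' hv).elim n1 n2
    · exact n1 (hTT _ (hs i) _ (hs j) hv hv')
    · exact n2 (hTT _ (hs i) _ (ht j) hv hv')
    · exact (hRT j _ (ht i) v hv' hv).elim n3 n4
    · exact n3 (hTT _ (ht i) _ (hs j) hv hv')
    · exact n4 (hTT _ (ht i) _ (ht j) hv hv')

/-- `A` is what `X` reaches in `G[U \ L ∪ Y]` outside `Z`, together with the part of `Z` there; `B`
is the complement of the reached part. No edge bypasses `Z` through `L \ Y`, because that set has no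
neighbours outside `L`. -/
theorem exists_sepn_of_separates [Fintype V] {U X L Y Z : Finset V} (hY : Y ⊆ L) (hLU : L ⊆ U)
    (hXU : X ⊆ U) (hXL : Disjoint X (L \ Y)) (hLe : ∀ a ∈ L \ Y, ∀ b ∈ U \ L, ¬ G.Adj a b)
    (hZ : Separates (res G (U \ L ∪ Y)) X Y Z) :
    ∃ A B, IsSepn G U A B ∧ X ⊆ A ∧ L ⊆ B ∧ Disjoint A (L \ Y) ∧ (A ∩ B).card ≤ Z.card := by
  set W := U \ L ∪ Y with hW
  have hWU : W ⊆ U := Finset.union_subset Finset.sdiff_subset (hY.trans hLU)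
  have hWL : ∀ v ∈ W, v ∈ L → v ∈ Y := fun v hv hvL => by
    rcases Finset.mem_union.1 hv with h | h
    exacts [absurd hvL (Finset.mem_sdiff.1 h).2, h]
  have hXW : ∀ x ∈ X, x ∈ W := fun x hx => by
    by_cases h : x ∈ L
    · by_cases h' : x ∈ Y
      · exact Finset.mem_union_right _ h'
      · exact absurd (Finset.mem_sdiff.2 ⟨h, h'⟩) (Finset.disjoint_left.1 hXL hx)
    · exact Finset.mem_union_left _ (Finset.mem_sdiff.2 ⟨hXU hx, h⟩)
  let C : Finset V := W.filter fun v => ∃ x ∈ X, x ∉ Z ∧ Conn (res G W) Zᶜ x v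
  have hC : ∀ v, v ∈ C ↔ v ∈ W ∧ ∃ x ∈ X, x ∉ Z ∧ Conn (res G W) Zᶜ x v := fun v => by simp [C]
  have hCZ : ∀ v ∈ C, v ∉ Z := fun v hv => by
    obtain ⟨-, x, -, hxZ, hc⟩ := (hC v).1 hv
    simpa using hc.mem (by simpa using hxZ)
  have hCY : ∀ v ∈ C, v ∉ Y := fun v hv hvY => by
    obtain ⟨-, x, hx, hxZ, hc⟩ := (hC v).1 hv
    exact hZ x hx v hvY hxZ (hCZ v hv) hc
  have hCW : C ⊆ W := Finset.filter_subset _ _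
  refine ⟨C ∪ Z ∩ W, U \ C, ⟨?_, ?_⟩, ?_, ?_, ?_, ?_⟩
  · ext v
    have h1 := @hCW v
    have h2 := @hWU v
    simp only [Finset.mem_union, Finset.mem_inter, Finset.mem_sdiff]
    tauto
  · intro a ha b hb hab
    simp only [Finset.mem_union, Finset.mem_inter, Finset.mem_sdiff, not_or, not_and, not_not] at ha hb
    have haC : a ∈ C := ha.1.elim id fun h => ha.2 (hWU h.2)
    have haW := hCW haC
    have haL : a ∉ L := fun h => hCY a haC (hWL a haW h)
    by_cases hbW : b ∈ W
    · obtain ⟨-, x, hx, hxZ, hc⟩ := (hC a).1 haC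
      refine hb.2.1 ((hC b).2 ⟨hbW, x, hx, hxZ, hc.trans (Conn.of_adj ⟨hab, haW, hbW⟩ ?_ ?_)⟩)
      · simpa using hCZ a haC
      · simpa using fun h => hb.2.2 h hbW
    · have hbL : b ∈ L \ Y := by
        simp only [hW, Finset.mem_union, Finset.mem_sdiff, not_or, not_and, not_not] at hbW ⊢
        exact ⟨hbW.1 hb.1.1, hbW.2⟩
      exact hLe b hbL a (Finset.mem_sdiff.2 ⟨hWU haW, haL⟩) hab.symm
  · intro x hx
    by_cases h : x ∈ Z
    · exact Finset.mem_union_right _ (Finset.mem_inter.2 ⟨h, hXW x hx⟩)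
    · exact Finset.mem_union_left _ ((hC x).2 ⟨hXW x hx, x, hx, h, Conn.rfl⟩)
  · intro v hv
    exact Finset.mem_sdiff.2 ⟨hLU hv, fun h => hCY v h (hWL v (hCW h) hv)⟩
  · rw [Finset.disjoint_left]
    intro v hv hvL
    have hvW : v ∈ W := by
      rcases Finset.mem_union.1 hv with h | h
      exacts [hCW h, (Finset.mem_inter.1 h).2]
    exact (Finset.mem_sdiff.1 hvL).2 (hWL v hvW (Finset.mem_sdiff.1 hvL).1)
  · refine Finset.card_le_card fun v hv => ?_
    simp only [Finset.mem_union, Finset.mem_inter, Finset.mem_sdiff] at hv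
    tauto

/-- If `G[U]` contains a set `L` whose attachments `Y` are linked in `L`, then `X` is linked. -/
theorem Massed.linked_of_hub [Fintype V] {U X L Y : Finset V} (ih : LinkedBelow V k U.card)
    (hXU : X ⊆ U) (hXk : X.card ≤ 2 * k) (hM : Massed k G U X) (hY : Y ⊆ L) (hLU : L ⊆ U)
    (hXL : Disjoint X (L \ Y)) (hLe : ∀ a ∈ L \ Y, ∀ b ∈ U \ L, ¬ G.Adj a b)
    (hXY : X.card ≤ Y.card) (hL : ∀ T ⊆ Y, T.card ≤ X.card → Linked G L T) : Linked G U X := by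
  by_cases hZ : ∀ Z, Separates (res G (U \ L ∪ Y)) X Y Z → X.card ≤ Z.card
  · exact linked_of_connectors hY hLU hXU hXL hZ hL
  push Not at hZ
  obtain ⟨Z, hZ, hZX⟩ := hZ
  obtain ⟨A₀, B₀, h₀⟩ := exists_sepn_of_separates hY hLU hXU hXL hLe hZ
  -- Take a separation of smallest order with `L` behind it. By minimality no smaller set separates
  -- `A ∩ B` from `Y` inside `B`, so `A ∩ B` is linked in `B` through `L`; as the order is below
  -- |X|, this part is rigid and `linked_of_rigid` applies.
  have hex : ∃ n, ∃ A B, (A ∩ B).card = n ∧ IsSepn G U A B ∧ X ⊆ A ∧ L ⊆ B ∧ Disjoint A (L \ Y) :=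
    ⟨_, A₀, B₀, rfl, h₀.1, h₀.2.1, h₀.2.2.1, h₀.2.2.2.1⟩
  obtain ⟨A, B, hn, hAB, hXA, hLB, hAL⟩ := Nat.find_spec hex
  have hlt : (A ∩ B).card < X.card := by
    rw [hn]
    exact lt_of_le_of_lt (Nat.find_min' hex ⟨A₀, B₀, rfl, h₀.1, h₀.2.1, h₀.2.2.1, h₀.2.2.2.1⟩)
      (lt_of_le_of_lt h₀.2.2.2.2 hZX)
  have hBU : B ⊆ U := hAB.1 ▸ Finset.subset_union_right
  refine hM.linked_of_rigid ih hXk A B hAB hXA hlt ?_ ?_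
  · by_contra hne
    rw [Finset.not_nonempty_iff_eq_empty, Finset.sdiff_eq_empty_iff_subset] at hne
    have h1 := Finset.card_le_card hY
    have h2 := Finset.card_le_card (Finset.subset_inter (hLB.trans hne) hLB)
    omega
  · refine linked_of_connectors hY hLB Finset.inter_subset_right
      (Finset.disjoint_of_subset_left Finset.inter_subset_left hAL) (fun Z' hZ' => ?_)
      fun T hT hTc => hL T hT (by omega)
    by_contra hcon
    push Not at hcon
    obtain ⟨C, D, hCD, hAC, hLD, hCL, hcard⟩ := exists_sepn_of_separates hY hLB
      Finset.inter_subset_right (Finset.disjoint_of_subset_left Finset.inter_subset_left hAL)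
      (fun a ha b hb => hLe a ha b (Finset.mem_sdiff.2 ⟨hBU (Finset.mem_sdiff.1 hb).1,
        (Finset.mem_sdiff.1 hb).2⟩)) hZ'
    obtain ⟨h1, h2, h3⟩ := hAB.trans hCD hAC
    refine Nat.find_min hex (m := (C ∩ D).card) (by omega) ⟨A ∪ C, D, by rw [h2], h1,
      hXA.trans Finset.subset_union_left, hLD, Finset.disjoint_union_left.2 ⟨hAL, hCL⟩⟩

/-- A heavy right side forces the order to be exactly |X|, since `X` is massed. Then `B` is massed
with respect to `A ∩ B` and smaller than `U`, hence linked by induction, and `B` itself is a hub. -/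
theorem Massed.linked_of_heavy [Fintype V] {U X A B : Finset V} (ih : LinkedBelow V k U.card)
    (hXU : X ⊆ U) (hXk : X.card ≤ 2 * k) (hM : Massed k G U X) (hAB : IsSepn G U A B) (hXA : X ⊆ A)
    (hle : (A ∩ B).card ≤ X.card) (hne : (A \ B).Nonempty)
    (hm : 12 * k * (B \ A).card < mass G U (B \ A)) : Linked G U X := by
  have hBU : B ⊆ U := hAB.1 ▸ Finset.subset_union_right
  have hBcard : B.card < U.card := by
    refine Finset.card_lt_card (hBU.ssubset_of_ne ?_)
    rintro rfl
    obtain ⟨v, hv⟩ := hne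
    rw [Finset.mem_sdiff] at hv
    exact hv.2 (hAB.1 ▸ Finset.mem_union_left _ hv.1)
  have hcard : X.card ≤ (A ∩ B).card := by
    by_contra hcon
    have := hM.2 A B hAB hXA (by omega)
    omega
  have hB := ih G B (A ∩ B) hBcard Finset.inter_subset_right (by omega) (hM.sub hAB hXA hle hm)
  refine hM.linked_of_hub ih hXU hXk (Y := A ∩ B) (L := B) Finset.inter_subset_right hBU ?_ ?_ hcard
    fun T hT _ => hB.mono hT
  · rw [sdiff_inter_left']
    exact Finset.disjoint_of_subset_left hXA Finset.disjoint_sdiff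
  · intro a ha b hb hab
    rw [sdiff_inter_left'] at ha
    rw [Finset.mem_sdiff, ← hAB.1, Finset.mem_union] at hb
    exact hAB.2 b (Finset.mem_sdiff.2 ⟨hb.1.resolve_right hb.2, hb.2⟩) a ha hab.symm

end Hub
end ParityLinkage
end

section
open scoped Classical
namespace ParityLinkage

/-! ### Deleting and contracting edges in a minimal counterexample. -/

section Minor
variable {V : Type*} {G G' : SimpleGraph V} {k : ℕ}

/-- The neighbours of `v` in `U`. -/
noncomputable def nb (G : SimpleGraph V) (U : Finset V) (v : V) : Finset V := U.filter (G.Adj v)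

@[simp] theorem mem_nb {U : Finset V} {v w : V} : w ∈ nb G U v ↔ w ∈ U ∧ G.Adj v w := by simp [nb]

/-- `G[C]` is `k`-linked. -/
def KLinked (G : SimpleGraph V) (C : Finset V) (k : ℕ) : Prop :=
  ∀ s t : Fin k → V, Function.Injective (Sum.elim s t) → (∀ i, s i ∈ C) → (∀ i, t i ∈ C) →
    ∃ S : Fin k → Finset V, (∀ i, S i ⊆ C ∧ s i ∈ S i ∧ t i ∈ S i ∧ Conn G (S i) (s i) (t i)) ∧
      Pairwise fun i j => Disjoint (S i) (S j)

/-- Dummy pairs are added until the terminals fill a set of exactly 2k vertices containing `T`. Then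
every vertex of `T` is a terminal, so no connector passes through a vertex of `T` other than its own
ends. -/
theorem KLinked.linked {C T : Finset V} (h : KLinked G C k) (hC : 2 * k ≤ C.card) (hT : T ⊆ C)
    (hTk : T.card ≤ 2 * k) : Linked G C T := by
  intro ι s t hst hs ht
  have hmem : ∀ z : ι ⊕ ι, Sum.elim s t z ∈ T := by rintro (i | i); exacts [hs i, ht i]
  have hfin : Finite (ι ⊕ ι) := Finite.of_injective (fun z => (⟨Sum.elim s t z, hmem z⟩ : T))
    fun z z' h => hst (congrArg Subtype.val h)
  have : Finite ι := Finite.of_injective (Sum.inl : ι → ι ⊕ ι) Sum.inl_injective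
  have : Fintype ι := Fintype.ofFinite ι
  obtain ⟨T', hTT', hT'C, hT'⟩ := Finset.exists_subsuperset_card_eq hT hTk hC
  let E : Finset V := Finset.univ.image (Sum.elim s t)
  have hE : E.card = 2 * Fintype.card ι := by
    rw [Finset.card_image_of_injective _ hst, Finset.card_univ, Fintype.card_sum, two_mul]
  have hET : E ⊆ T' := fun v hv => by
    obtain ⟨z, -, rfl⟩ := Finset.mem_image.1 hv
    exact hTT' (hmem z)
  have hEk := Finset.card_le_card hET
  obtain ⟨r, hr⟩ : ∃ r, k = Fintype.card ι + r := ⟨k - Fintype.card ι, by omega⟩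
  have hF : (T' \ E).card = Fintype.card (Fin r ⊕ Fin r) := by
    rw [Finset.card_sdiff_of_subset hET, Fintype.card_sum, Fintype.card_fin]; omega
  let f : Fin r ⊕ Fin r ≃ (T' \ E : Finset V) :=
    Fintype.equivOfCardEq (by rw [Fintype.card_coe]; exact hF.symm)
  let e : Fin k ≃ ι ⊕ Fin r := Fintype.equivOfCardEq (by simp [hr])
  let s' : ι ⊕ Fin r → V := Sum.elim s fun j => f (.inl j)
  let t' : ι ⊕ Fin r → V := Sum.elim t fun j => f (.inr j)
  have hf : ∀ z, (f z : V) ∈ T' ∧ (f z : V) ∉ E := fun z => Finset.mem_sdiff.1 (f z).2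
  have hsE : ∀ i, s i ∈ E := fun i => Finset.mem_image.2 ⟨.inl i, by simp⟩
  have htE : ∀ i, t i ∈ E := fun i => Finset.mem_image.2 ⟨.inr i, by simp⟩
  have hfi : ∀ z z', (f z : V) = f z' → z = z' := fun z z' h => f.injective (Subtype.ext h)
  have hfE : ∀ z v, v ∈ E → (f z : V) ≠ v := fun z v hv h => (hf z).2 (h ▸ hv)
  have hss : ∀ i j, s i = s j → i = j := fun i j h => Sum.inl.inj (@hst (.inl i) (.inl j) h)
  have htt : ∀ i j, t i = t j → i = j := fun i j h => Sum.inr.inj (@hst (.inr i) (.inr j) h)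
  have hst' : ∀ i j, s i ≠ t j := fun i j h => Sum.inl_ne_inr (@hst (.inl i) (.inr j) h)
  obtain ⟨S, hS, hd⟩ := h (s' ∘ e) (t' ∘ e) (by
    have h0 : Function.Injective (Sum.elim s' t') := by
      rintro ((i | i) | (i | i)) ((j | j) | (j | j)) hij <;>
        simp only [Sum.elim_inl, Sum.elim_inr, s', t'] at hij
      · rw [hss _ _ hij]
      · exact absurd hij.symm (hfE _ _ (hsE i))
      · exact absurd hij (hst' _ _)
      · exact absurd hij.symm (hfE _ _ (hsE i))
      · exact absurd hij (hfE _ _ (hsE j))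
      · rw [Sum.inl.inj (hfi _ _ hij)]
      · exact absurd hij (hfE _ _ (htE j))
      · cases hfi _ _ hij
      · exact absurd hij.symm (hst' _ _)
      · exact absurd hij.symm (hfE _ _ (htE i))
      · rw [htt _ _ hij]
      · exact absurd hij.symm (hfE _ _ (htE i))
      · exact absurd hij (hfE _ _ (hsE j))
      · cases hfi _ _ hij
      · exact absurd hij (hfE _ _ (htE j))
      · rw [Sum.inr.inj (hfi _ _ hij)]
    rintro (i | i) (j | j) hij
    · exact congrArg Sum.inl (e.injective (Sum.inl.inj (@h0 (.inl (e i)) (.inl (e j)) hij)))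
    · exact absurd (@h0 (.inl (e i)) (.inr (e j)) hij) Sum.inl_ne_inr
    · exact absurd (@h0 (.inr (e i)) (.inl (e j)) hij) Sum.inr_ne_inl
    · exact congrArg Sum.inr (e.injective (Sum.inr.inj (@h0 (.inr (e i)) (.inr (e j)) hij))))
    (fun i => by
      show s' (e i) ∈ C
      rcases e i with j | j
      exacts [hT (hs j), hT'C (hf _).1])
    (fun i => by
      show t' (e i) ∈ C
      rcases e i with j | j
      exacts [hT (ht j), hT'C (hf _).1])
  have hS' : ∀ z, S (e.symm z) ⊆ C ∧ s' z ∈ S (e.symm z) ∧ t' z ∈ S (e.symm z) ∧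
      Conn G (S (e.symm z)) (s' z) (t' z) := fun z => by simpa using hS (e.symm z)
  have hd' : ∀ z z' v, v ∈ S (e.symm z) → v ∈ S (e.symm z') → z = z' := fun z z' v h1 h2 => by
    by_contra hne
    exact Finset.disjoint_left.1 (hd fun h => hne (e.symm.injective h)) h1 h2
  refine ⟨fun i => S (e.symm (.inl i)), fun i => ⟨(hS' (.inl i)).1, (hS' (.inl i)).2.1,
    (hS' (.inl i)).2.2.1, fun x hx hxT => ?_, (hS' (.inl i)).2.2.2⟩, fun i j hij => hd fun h =>
      hij (Sum.inl.inj (e.symm.injective h))⟩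
  by_cases hxE : x ∈ E
  · obtain ⟨z, -, hz⟩ := Finset.mem_image.1 hxE
    rcases z with j | j
    · have := hd' (.inl i) (.inl j) x hx (hz ▸ (hS' (.inl j)).2.1)
      rw [Sum.inl.inj this]; exact Or.inl hz.symm
    · have := hd' (.inl i) (.inl j) x hx (hz ▸ (hS' (.inl j)).2.2.1)
      rw [Sum.inl.inj this]; exact Or.inr hz.symm
  · exfalso
    obtain ⟨z, hz⟩ := f.surjective ⟨x, Finset.mem_sdiff.2 ⟨hTT' hxT, hxE⟩⟩
    have hz' : (f z : V) = x := congrArg Subtype.val hz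
    rcases z with j | j
    · cases hd' (.inl i) (.inr j) x hx (hz' ▸ (hS' (.inr j)).2.1)
    · cases hd' (.inl i) (.inr j) x hx (hz' ▸ (hS' (.inr j)).2.2.1)

theorem mass_eq_sum (U S : Finset V) :
    mass G U S = ∑ a ∈ U, (U.filter fun b => G.Adj a b ∧ (a ∈ S ∨ b ∈ S)).card := by
  simp only [mass, Finset.card_filter, Finset.sum_product]

/-- Deleting an edge outside `X`. -/
theorem Massed.mass_le_of_edge [Fintype V] {U X : Finset V} (ih : LinkedBelow V k U.card)
    (ih' : ∀ G' : SimpleGraph V, mass G' U (U \ X) < mass G U (U \ X) → Massed k G' U X →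
      Linked G' U X) (hXU : X ⊆ U) (hXk : X.card ≤ 2 * k) (hM : Massed k G U X)
    (hnot : ¬ Linked G U X) {u v : V} (huv : G.Adj u v) (hu : u ∈ U \ X) (hv : v ∈ U \ X) :
    mass G U (U \ X) ≤ 12 * k * (U \ X).card + 2 := by
  by_contra hcon
  push Not at hcon
  set G' := G.deleteEdges {s(u, v)} with hG'
  have hle : G' ≤ G := SimpleGraph.deleteEdges_le _
  have hadj : ∀ a b, G'.Adj a b ↔ G.Adj a b ∧ ¬ ((a = u ∧ b = v) ∨ (a = v ∧ b = u)) := fun a b => by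
    rw [hG', SimpleGraph.deleteEdges_adj]; simp
  have hmono : ∀ S, mass G' U S ≤ mass G U S := fun S =>
    mass_le fun a b hab ha hb hS => ⟨hle hab, ha, hb, hS⟩
  have h1 : mass G U (U \ X) ≤ mass G' U (U \ X) + 2 := by
    refine le_trans (Finset.card_le_card (t := _ ∪ {(u, v), (v, u)}) fun p hp => ?_)
      ((Finset.card_union_le _ _).trans (Nat.add_le_add_left Finset.card_le_two _))
    simp only [Finset.mem_union, Finset.mem_filter, Finset.mem_insert, Finset.mem_singleton,
      Prod.ext_iff, hadj] at hp ⊢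
    by_cases h : (p.1 = u ∧ p.2 = v) ∨ (p.1 = v ∧ p.2 = u)
    · exact Or.inr h
    · exact Or.inl ⟨hp.1, ⟨hp.2.1, h⟩, hp.2.2⟩
  have h2 : mass G' U (U \ X) < mass G U (U \ X) := by
    refine Finset.card_lt_card ((Finset.ssubset_iff_of_subset fun p hp => ?_).2 ⟨(u, v), ?_, ?_⟩)
    · simp only [Finset.mem_filter] at hp ⊢
      exact ⟨hp.1, hle hp.2.1, hp.2.2⟩
    · simp only [Finset.mem_filter, Finset.mem_product]
      exact ⟨⟨(Finset.mem_sdiff.1 hu).1, (Finset.mem_sdiff.1 hv).1⟩, huv, Or.inl hu⟩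
    · simp [hadj]
  by_cases hM2 : ∀ A B, IsSepn G' U A B → X ⊆ A → (A ∩ B).card < X.card →
      mass G' U (B \ A) ≤ 12 * k * (B \ A).card
  · exact hnot ((ih' G' h2 ⟨by omega, hM2⟩).mono_graph hle)
  push Not at hM2
  obtain ⟨A, B, hAB, hXA, hlt, hm⟩ := hM2
  have hm' : 12 * k * (B \ A).card < mass G U (B \ A) := lt_of_lt_of_le hm (hmono _)
  by_cases hs : IsSepn G U A B
  · exact absurd (hM.2 A B hs hXA hlt) (by omega)
  have : ∃ a ∈ A \ B, ∃ b ∈ B \ A, G.Adj a b := by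
    by_contra hno
    push Not at hno
    exact hs ⟨hAB.1, hno⟩
  obtain ⟨a, ha, b, hb, hab⟩ := this
  have hab' : (a = u ∧ b = v) ∨ (a = v ∧ b = u) := by
    by_contra hno
    exact hAB.2 a ha b hb ((hadj a b).2 ⟨hab, hno⟩)
  have haX : a ∉ X := by
    rcases hab' with h | h
    · exact h.1 ▸ (Finset.mem_sdiff.1 hu).2
    · exact h.1 ▸ (Finset.mem_sdiff.1 hv).2
  have haU : a ∈ U := hAB.1 ▸ Finset.mem_union_left _ (Finset.mem_sdiff.1 ha).1
  have hdiff : insert a B \ A = B \ A := Finset.insert_sdiff_of_mem _ (Finset.mem_sdiff.1 ha).1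
  obtain ⟨x, hx, hxB⟩ : ∃ x ∈ X, x ∉ B := by
    by_contra hno
    push Not at hno
    exact absurd (Finset.card_le_card (Finset.subset_inter hXA hno)) (by omega)
  -- The deleted edge crosses the separation. Adding its end `a` to `B` gives a separation of `G` of
  -- order at most |X|, still heavy, and `x` keeps its left interior nonempty.
  refine hnot (hM.linked_of_heavy ih hXU hXk (A := A) (B := insert a B) ⟨?_, fun c hc d hd hcd => ?_⟩
    hXA ?_ ⟨x, ?_⟩ (by rw [hdiff]; exact hm'))
  · rw [Finset.union_insert, hAB.1, Finset.insert_eq_of_mem haU]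
  · rw [hdiff] at hd
    simp only [Finset.mem_sdiff, Finset.mem_insert, not_or] at hc hd ha hb
    refine hAB.2 c (by simp [hc.1, hc.2.2]) d (by simp [hd]) ((hadj c d).2 ⟨hcd, ?_⟩)
    rintro (⟨rfl, rfl⟩ | ⟨rfl, rfl⟩) <;> rcases hab' with ⟨rfl, rfl⟩ | ⟨rfl, rfl⟩ <;> tauto
  · rw [Finset.inter_insert_of_mem (Finset.mem_sdiff.1 ha).1]
    exact (Finset.card_insert_le _ _).trans hlt
  · simp only [Finset.mem_sdiff, Finset.mem_insert, not_or]
    exact ⟨hXA hx, fun h => haX (h ▸ hx), hxB⟩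

/-- The graph obtained by contracting the edge `uv` to the vertex `u`. -/
def contract (G : SimpleGraph V) (u v : V) : SimpleGraph V where
  Adj a b := a ≠ b ∧ a ≠ v ∧ b ≠ v ∧ (G.Adj a b ∨ (a = u ∧ G.Adj v b) ∨ (b = u ∧ G.Adj v a))
  symm := ⟨fun _ _ h => ⟨h.1.symm, h.2.2.1, h.2.1, h.2.2.2.imp (fun h => h.symm) Or.symm⟩⟩
  loopless := ⟨fun _ h => h.1 rfl⟩

theorem contract_adj {u v a b : V} : (contract G u v).Adj a b ↔
    a ≠ b ∧ a ≠ v ∧ b ≠ v ∧ (G.Adj a b ∨ (a = u ∧ G.Adj v b) ∨ (b = u ∧ G.Adj v a)) := Iff.rfl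

/-- At most one connector contains `u`. Adding `v` to it turns each edge created by the contraction
into a path through `v`. -/
theorem Linked.of_contract {B X : Finset V} {u v : V} (huv : G.Adj u v) (hvB : v ∉ B) (hvX : v ∉ X)
    (h : Linked (contract G u v) B X) : Linked G (insert v B) X := by
  intro ι s t hst hs ht
  obtain ⟨S, hS, hd⟩ := h ι s t hst hs ht
  refine ⟨fun i => if u ∈ S i then insert v (S i) else S i, fun i => ?_, fun i j hij => ?_⟩
  · have hsub : S i ⊆ if u ∈ S i then insert v (S i) else S i := by
      split_ifs
      exacts [Finset.subset_insert _ _, subset_rfl]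
    refine ⟨?_, hsub (hS i).2.1, hsub (hS i).2.2.1, fun x hx hxX => ?_, ?_⟩
    · beta_reduce
      split_ifs
      · exact Finset.insert_subset_insert _ (hS i).1
      · exact (hS i).1.trans (Finset.subset_insert _ _)
    · refine (hS i).2.2.2.1 x ?_ hxX
      beta_reduce at hx
      split_ifs at hx
      · exact (Finset.mem_insert.1 hx).resolve_left fun h => hvX (h ▸ hxX)
      · exact hx
    · refine (hS i).2.2.2.2.closed (fun w => Conn G _ (s i) w) Conn.rfl fun a b ha hab haS hbS => ?_
      refine ha.trans ?_
      rcases hab.2.2.2 with h1 | ⟨rfl, h1⟩ | ⟨rfl, h1⟩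
      · exact Conn.of_adj h1 (hsub haS) (hsub hbS)
      · simp only [haS, if_true]
        exact (Conn.of_adj huv (by simp [haS]) (by simp)).trans
          (Conn.of_adj h1 (by simp) (by simp [hbS]))
      · simp only [hbS, if_true]
        exact (Conn.of_adj h1.symm (by simp [haS]) (by simp)).trans
          (Conn.of_adj huv.symm (by simp) (by simp [hbS]))
  · have hdij := hd hij
    have hvi : ∀ i, v ∉ S i := fun i h => hvB ((hS i).1 h)
    beta_reduce
    split_ifs with h1 h2 h2
    · exact absurd h2 (Finset.disjoint_left.1 hdij h1)
    · exact Finset.disjoint_insert_left.2 ⟨hvi j, hdij⟩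
    · exact Finset.disjoint_insert_right.2 ⟨hvi i, hdij⟩
    · exact hdij

/-- Contracting an edge `uv` with `v ∉ X`. -/
theorem Massed.mass_contract_le [Fintype V] {U X : Finset V} (ih : LinkedBelow V k U.card)
    (hXU : X ⊆ U) (hXk : X.card ≤ 2 * k) (hM : Massed k G U X)
    (hnot : ¬ Linked G U X) {u v : V} (huv : G.Adj u v) (hu : u ∈ U) (hv : v ∈ U \ X) :
    mass (contract G u v) (U.erase v) (U.erase v \ X) ≤ 12 * k * (U.erase v \ X).card := by
  by_contra hcon
  push Not at hcon
  have hvU := (Finset.mem_sdiff.1 hv).1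
  have hvX := (Finset.mem_sdiff.1 hv).2
  have hXU' : X ⊆ U.erase v := fun x hx => Finset.mem_erase.2 ⟨fun h => hvX (h ▸ hx), hXU hx⟩
  have hcardU : (U.erase v).card < U.card := Finset.card_erase_lt_of_mem hvU
  by_cases hM2 : ∀ A B, IsSepn (contract G u v) (U.erase v) A B → X ⊆ A → (A ∩ B).card < X.card →
      mass (contract G u v) (U.erase v) (B \ A) ≤ 12 * k * (B \ A).card
  · have := (ih _ _ X hcardU hXU' hXk ⟨hcon, hM2⟩).of_contract huv (by simp) hvX
    rw [Finset.insert_erase hvU] at this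
    exact hnot this
  obtain ⟨A, B, hAB, hXA, hlt, hm, hMB⟩ := exists_massed_part hM2
  have hAU : A ⊆ U.erase v := hAB.1 ▸ Finset.subset_union_left
  have hBU : B ⊆ U.erase v := hAB.1 ▸ Finset.subset_union_right
  have hvA : v ∉ A := fun h => by simpa using hAU h
  have hvB : v ∉ B := fun h => by simpa using hBU h
  have hBA : ∀ b ∈ B, b ≠ v := fun b hb h => hvB (h ▸ hb)
  have huU : u ∈ A ∪ B := by
    rw [hAB.1]; exact Finset.mem_erase.2 ⟨huv.ne, hu⟩
  have hsame : ∀ a ∈ A \ B, ∀ b ∈ B \ A, ¬ G.Adj a b := fun a ha b hb hab =>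
    hAB.2 a ha b hb ⟨hab.ne, fun h => hvA (h ▸ (Finset.mem_sdiff.1 ha).1),
      fun h => hvB (h ▸ (Finset.mem_sdiff.1 hb).1), Or.inl hab⟩
  -- The violating separation is lifted to `G` by placing `v` wherever `u` lies. If `u` is in both
  -- parts, the order grows to at most |X| and the right side is heavy. If `u` is only in `B`, that
  -- part is linked after the contraction, hence before it, and is rigid. If `u` is only in `A`,
  -- order and mass are preserved and the pair would not be massed.
  by_cases huB : u ∈ B
  · by_cases huA : u ∈ A
    · have hdiff : insert v B \ insert v A = B \ A := by
        ext w
        have := hBA w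
        simp only [Finset.mem_sdiff, Finset.mem_insert]
        tauto
      obtain ⟨x, hx, hxB⟩ : ∃ x ∈ X, x ∉ B := by
        by_contra hno
        push Not at hno
        exact absurd (Finset.card_le_card (Finset.subset_inter hXA hno)) (by omega)
      refine hnot (hM.linked_of_heavy ih hXU hXk (A := insert v A) (B := insert v B)
        ⟨?_, fun a ha b hb hab => ?_⟩ (hXA.trans (Finset.subset_insert _ _)) ?_ ⟨x, ?_⟩ ?_)
      · rw [← Finset.insert_union_distrib, hAB.1, Finset.insert_erase hvU]
      · rw [hdiff] at hb
        simp only [Finset.mem_sdiff, Finset.mem_insert, not_or] at ha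
        exact hsame a (by simp [ha.1.resolve_left ha.2.1, ha.2.2]) b hb hab
      · rw [← Finset.insert_inter_distrib]
        exact (Finset.card_insert_le _ _).trans hlt
      · simp only [Finset.mem_sdiff, Finset.mem_insert, not_or]
        exact ⟨Or.inr (hXA hx), fun h => hvX (h ▸ hx), hxB⟩
      · rw [hdiff]
        refine lt_of_lt_of_le hm ?_
        rw [hAB.mass_eq]
        have hBv : ∀ b ∈ B, b ∈ U := fun b hb => Finset.mem_of_mem_erase (hBU hb)
        -- An edge at `u` that exists only in the contraction comes from an edge at `v` and is sent
        -- there; this is injective because `v` is not in `B`.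
        refine Finset.card_le_card_of_injOn
          (fun p => if G.Adj p.1 p.2 then p else if p.1 = u then (v, p.2) else (p.1, v)) ?_ ?_
        · intro p hp
          simp only [Finset.coe_filter, Finset.mem_product, Set.mem_ofPred_eq, contract_adj,
            Finset.mem_sdiff] at hp ⊢
          obtain ⟨⟨hp1, hp2⟩, ⟨-, -, -, hadj⟩, hS⟩ := hp
          split_ifs with h1 h2
          · exact ⟨⟨hBv _ hp1, hBv _ hp2⟩, h1, hS⟩
          · have h3 : G.Adj v p.2 := by
              rcases hadj with h | h | h
              · exact absurd h h1
              · exact h.2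
              · exact absurd (h2.trans h.1.symm) (by rintro h'; exact absurd hS (by rw [h', h.1]; tauto))
            exact ⟨⟨hvU, hBv _ hp2⟩, h3, Or.inr (hS.resolve_left (by rw [h2]; tauto))⟩
          · have h3 : p.2 = u ∧ G.Adj v p.1 := by
              rcases hadj with h | h | h
              · exact absurd h h1
              · exact absurd h.1 h2
              · exact h
            exact ⟨⟨hBv _ hp1, hvU⟩, h3.2.symm, Or.inl (hS.resolve_right (by rw [h3.1]; tauto))⟩
        · intro p hp q hq hpq
          simp only [Finset.coe_filter, Finset.mem_product, Set.mem_ofPred_eq, contract_adj,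
            Finset.mem_sdiff] at hp hq
          obtain ⟨⟨hp1, hp2⟩, ⟨-, -, -, hadj⟩, hS⟩ := hp
          obtain ⟨⟨hq1, hq2⟩, ⟨-, -, -, hadj'⟩, hS'⟩ := hq
          have e1 := hBA _ hp1
          have e2 := hBA _ hp2
          have e3 := hBA _ hq1
          have e4 := hBA _ hq2
          obtain ⟨p1, p2⟩ := p
          obtain ⟨q1, q2⟩ := q
          simp only at *
          split_ifs at hpq <;> simp only [Prod.mk.injEq] at hpq ⊢ <;> grind
    · have hdiff : A ∩ insert v B = A ∩ B := Finset.inter_insert_of_notMem hvA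
      have hlin := ih _ B (A ∩ B) (lt_of_le_of_lt (Finset.card_le_card hBU) hcardU)
        Finset.inter_subset_right (by omega) hMB
      refine hnot (hM.linked_of_rigid ih hXk A (insert v B) ⟨?_, fun a ha b hb hab => ?_⟩ hXA
        (by rw [hdiff]; exact hlt) ⟨v, by simp [hvA]⟩ ?_)
      · rw [Finset.union_insert, hAB.1, Finset.insert_erase hvU]
      · simp only [Finset.mem_sdiff, Finset.mem_insert, not_or] at ha hb
        rcases hb.1 with rfl | hbB
        · exact hAB.2 a (by simp [ha]) u (by simp [huA, huB]) ⟨fun h => huA (h ▸ ha.1), ha.2.1,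
            huv.ne, Or.inr (Or.inr ⟨rfl, hab.symm⟩)⟩
        · exact hsame a (by simp [ha]) b (by simp [hbB, hb.2]) hab
      · rw [hdiff]
        exact hlin.of_contract huv hvB fun h => hvA (Finset.mem_inter.1 h).1
  · have huA : u ∈ A := (Finset.mem_union.1 huU).resolve_right huB
    have h1 : insert v A ∩ B = A ∩ B := Finset.insert_inter_of_notMem hvB
    have h2 : B \ insert v A = B \ A := by
      ext w; have := hBA w; simp only [Finset.mem_sdiff, Finset.mem_insert]; tauto
    have h3 := hM.2 (insert v A) B ⟨?_, fun a ha b hb hab => ?_⟩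
      (hXA.trans (Finset.subset_insert _ _)) (by rw [h1]; exact hlt)
    · rw [h2] at h3
      refine absurd (lt_of_lt_of_le hm (le_trans ?_ h3)) (lt_irrefl _)
      rw [hAB.mass_eq]
      refine mass_le fun a b hab ha hb hS => ⟨?_, Finset.mem_of_mem_erase (hBU ha),
        Finset.mem_of_mem_erase (hBU hb), hS⟩
      rcases hab.2.2.2 with h | ⟨rfl, -⟩ | ⟨rfl, -⟩
      exacts [h, absurd ha huB, absurd hb huB]
    · rw [Finset.insert_union, hAB.1, Finset.insert_erase hvU]
    · simp only [Finset.mem_sdiff, Finset.mem_insert, not_or] at ha hb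
      rcases ha.1 with rfl | haA
      · exact hAB.2 u (by simp [huA, huB]) b (by simp [hb]) ⟨fun h => huB (h ▸ hb.1), huv.ne,
          hb.2.1, Or.inr (Or.inl ⟨rfl, hab⟩)⟩
      · exact hsame a (by simp [haA, ha.2]) b (by simp [hb]) hab

end Minor
end ParityLinkage
end

section
open scoped Classical
namespace ParityLinkage

/-! ### Massed pairs are linked, given the dense case. -/

section ThomasWollan
variable {V : Type*} {G G' : SimpleGraph V} {k : ℕ}

/-- Contracting an edge loses at most twice as much mass as there are lost neighbours. -/
theorem mass_le_contract {U X : Finset V} {u v : V} (huv : G.Adj u v) (hu : u ∈ U) (hv : v ∈ U \ X) :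
    mass G U (U \ X) ≤ mass (contract G u v) (U.erase v) (U.erase v \ X) +
      2 * ({u} ∪ nb G U u ∩ nb G U v ∪
        X.filter fun w => u ∈ X ∧ w ≠ u ∧ ¬ G.Adj u w ∧ G.Adj v w).card := by
  -- The neighbours of `v` whose edge is lost: `u` itself, the common neighbours, where two edges
  -- merge, and, when `u ∈ X`, neighbours in `X`, because an edge inside `X` carries no mass.
  set Lost := {u} ∪ nb G U u ∩ nb G U v ∪
        X.filter fun w => u ∈ X ∧ w ≠ u ∧ ¬ G.Adj u w ∧ G.Adj v w with hL
  have hvU := (Finset.mem_sdiff.1 hv).1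
  have hvX := (Finset.mem_sdiff.1 hv).2
  set M := (U ×ˢ U).filter fun p => G.Adj p.1 p.2 ∧ (p.1 ∈ U \ X ∨ p.2 ∈ U \ X) with hM
  set M' := M.filter fun p => ¬ ((p.1 = v ∧ p.2 ∈ Lost) ∨ (p.2 = v ∧ p.1 ∈ Lost)) with hM'
  have h1 : M.card ≤ M'.card + 2 * Lost.card := by
    rw [← Finset.card_filter_add_card_filter_not (s := M)
      (fun p => ¬ ((p.1 = v ∧ p.2 ∈ Lost) ∨ (p.2 = v ∧ p.1 ∈ Lost)))]
    refine Nat.add_le_add_left ?_ _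
    calc _ ≤ (Lost.image (fun l => (v, l)) ∪ Lost.image (fun l => (l, v))).card := by
          refine Finset.card_le_card fun p hp => ?_
          have := (Finset.mem_filter.1 hp).2
          rw [not_not] at this
          rcases this with ⟨h, h'⟩ | ⟨h, h'⟩
          · exact Finset.mem_union_left _ (Finset.mem_image.2 ⟨_, h', by rw [← h]⟩)
          · exact Finset.mem_union_right _ (Finset.mem_image.2 ⟨_, h', by rw [← h]⟩)
      _ ≤ _ := by
          refine (Finset.card_union_le _ _).trans ?_
          rw [two_mul]
          exact Nat.add_le_add Finset.card_image_le Finset.card_image_le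
  have hnb : ∀ w, G.Adj v w → w ∈ U → w ∉ Lost → w ≠ u ∧ ¬ G.Adj u w ∧ (u ∉ X ∨ w ∉ X) := by
    intro w hw hwU hl
    simp only [hL, Finset.mem_union, Finset.mem_inter, mem_nb, Finset.mem_singleton,
      Finset.mem_filter] at hl
    tauto
  have hmem : ∀ a b, (a, b) ∈ M' → G.Adj a b ∧ a ∈ U ∧ b ∈ U ∧ (a ∉ X ∨ b ∉ X) ∧
      (a = v → b ∉ Lost) ∧ (b = v → a ∉ Lost) := by
    intro a b h
    simp only [hM', hM, Finset.mem_filter, Finset.mem_product, Finset.mem_sdiff] at h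
    tauto
  have h2 : M'.card ≤ mass (contract G u v) (U.erase v) (U.erase v \ X) := by
    refine Finset.card_le_card_of_injOn
      (fun p => (if p.1 = v then u else p.1, if p.2 = v then u else p.2)) ?_ ?_
    · rintro ⟨a, b⟩ hab
      obtain ⟨hadj, ha, hb, hX, hla, hlb⟩ := hmem a b hab
      have hne := hadj.ne
      have huvn := huv.ne
      simp only [Finset.coe_filter, Set.mem_ofPred_eq, Finset.mem_product, contract_adj,
        Finset.mem_sdiff, Finset.mem_erase]
      by_cases hav : a = v
      · subst hav
        obtain ⟨g1, g2, g3⟩ := hnb b hadj hb (hla rfl)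
        simp only [if_true, if_neg hne.symm]
        refine ⟨⟨⟨huvn, hu⟩, hne.symm, hb⟩, ⟨g1.symm, huvn, hne.symm, by tauto⟩,
          g3.imp (fun h => ⟨⟨huvn, hu⟩, h⟩) fun h => ⟨⟨hne.symm, hb⟩, h⟩⟩
      · by_cases hbv : b = v
        · subst hbv
          obtain ⟨g1, g2, g3⟩ := hnb a hadj.symm ha (hlb rfl)
          simp only [if_true, if_neg hav]
          refine ⟨⟨⟨hne, ha⟩, huvn, hu⟩, ⟨g1, hne, huvn, by have := hadj.symm; tauto⟩,
            g3.symm.imp (fun h => ⟨⟨hne, ha⟩, h⟩) fun h => ⟨⟨huvn, hu⟩, h⟩⟩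
        · simp only [if_neg hav, if_neg hbv]
          exact ⟨⟨⟨hav, ha⟩, hbv, hb⟩, ⟨hne, hav, hbv, Or.inl hadj⟩,
            hX.imp (fun h => ⟨⟨hav, ha⟩, h⟩) fun h => ⟨⟨hbv, hb⟩, h⟩⟩
    · rintro ⟨a, b⟩ hab ⟨c, d⟩ hcd h
      obtain ⟨hadj, ha, hb, hX, hla, hlb⟩ := hmem a b hab
      obtain ⟨hadj', hc, hd, hX', hlc, hld⟩ := hmem c d hcd
      rw [Prod.mk.injEq] at h ⊢
      obtain ⟨h, h'⟩ := h
      have A1 : a = v → b ≠ u ∧ ¬ G.Adj u b := fun e =>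
        have := hnb b (e ▸ hadj) hb (hla e); ⟨this.1, this.2.1⟩
      have A2 : b = v → a ≠ u ∧ ¬ G.Adj u a := fun e =>
        have := hnb a (e ▸ hadj.symm) ha (hlb e); ⟨this.1, this.2.1⟩
      have A3 : c = v → d ≠ u ∧ ¬ G.Adj u d := fun e =>
        have := hnb d (e ▸ hadj') hd (hlc e); ⟨this.1, this.2.1⟩
      have A4 : d = v → c ≠ u ∧ ¬ G.Adj u c := fun e =>
        have := hnb c (e ▸ hadj'.symm) hc (hld e); ⟨this.1, this.2.1⟩
      have B1 := hadj.symm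
      have B2 := hadj'.symm
      clear hmem hnb h1 hla hlb hlc hld hX hX' hab hcd
      dsimp only at h h'
      split_ifs at h h' <;> grind
  exact h1.trans (Nat.add_le_add_right h2 _)

theorem mass_eq_degree_sum {U X : Finset V} (hXU : X ⊆ U) : mass G U (U \ X) =
    ∑ v ∈ U \ X, (nb G U v).card + ∑ x ∈ X, (nb G (U \ X) x).card := by
  rw [mass_eq_sum, ← Finset.sum_sdiff hXU]
  refine congrArg₂ (· + ·) (Finset.sum_congr rfl fun v hv => congrArg _ ?_)
    (Finset.sum_congr rfl fun v hv => congrArg _ ?_)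
  · ext w; simp [hv]
  · ext w
    simp only [Finset.mem_filter, Finset.mem_sdiff, mem_nb]
    tauto

theorem mass_congr {U S : Finset V} (h : ∀ a b, a ∈ S ∨ b ∈ S → (G.Adj a b ↔ G'.Adj a b)) :
    mass G U S = mass G' U S :=
  le_antisymm (mass_le fun a b hab ha hb hS => ⟨(h a b hS).1 hab, ha, hb, hS⟩)
    (mass_le fun a b hab ha hb hS => ⟨(h a b hS).2 hab, ha, hb, hS⟩)

/-- `C` is a `k`-linked set inside any small graph of large minimum degree. -/
def DenseLinked (V : Type*) (k : ℕ) : Prop :=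
  ∀ (G : SimpleGraph V) (D : Finset V), D.Nonempty → D.card ≤ 12 * k →
    (∀ v ∈ D, 6 * k ≤ (nb G D v).card) → ∃ C ⊆ D, 2 * k ≤ C.card ∧ KLinked G C k

/-- In a counterexample no edge meeting the outside of `X` can be contracted, so its ends have about
6k common neighbours; and no edge outside `X` can be deleted, so the mass barely exceeds its bound
and some vertex outside `X` has degree below 12k. Its closed neighbourhood is small and has minimum
degree at least 6k, so it contains a k-linked hub. Near-completeness of `X` limits the loss from
edges that move into `X`. -/
theorem Massed.linked_of_almost_complete [Fintype V] (hdense : DenseLinked V k)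
    {U X : Finset V} (ih : LinkedBelow V k U.card)
    (ih' : ∀ G' : SimpleGraph V, mass G' U (U \ X) < mass G U (U \ X) → Massed k G' U X →
      Linked G' U X) (hXU : X ⊆ U) (hXk : X.card ≤ 2 * k) (hXne : X.Nonempty) (hM : Massed k G U X)
    (hX : ∀ u ∈ X, ∀ a, (a ∈ X ∧ a ≠ u ∧ ¬ G.Adj u a) → ∀ b, (b ∈ X ∧ b ≠ u ∧ ¬ G.Adj u b) → a = b) : Linked G U X := by
  by_contra hnot
  -- Contracting lowers the mass by more than 12k, so more than 6k neighbours are lost. One of these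
  -- is `u`, and at most one is a non-neighbour of `u` in `X`, which occurs only for `u ∈ X`.
  have hcommon : ∀ u ∈ U, ∀ v ∈ U \ X, G.Adj u v →
      6 * k ≤ (nb G U u ∩ nb G U v).card + (if u ∈ X then 1 else 0) := by
    intro u hu v hv huv
    have h1 := mass_le_contract huv hu hv
    have h2 := hM.mass_contract_le ih hXU hXk hnot huv hu hv
    have h3 := hM.1
    have hc : (U.erase v \ X).card + 1 = (U \ X).card := by
      rw [Finset.erase_sdiff_comm, Finset.card_erase_add_one hv]
    rw [← hc] at h3
    have h4 : ({u} ∪ nb G U u ∩ nb G U v ∪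
        X.filter fun w => u ∈ X ∧ w ≠ u ∧ ¬ G.Adj u w ∧ G.Adj v w).card ≤
        1 + (nb G U u ∩ nb G U v).card + (if u ∈ X then 1 else 0) := by
      refine (Finset.card_union_le _ _).trans (Nat.add_le_add ?_ ?_)
      · exact (Finset.card_union_le _ _).trans (by simp)
      · split_ifs with huX
        · refine Finset.card_le_one.2 fun a ha b hb => ?_
          rw [Finset.mem_filter] at ha hb
          exact hX u huX a ⟨ha.1, ha.2.2.1, ha.2.2.2.1⟩ b ⟨hb.1, hb.2.2.1, hb.2.2.2.1⟩
        · rw [Finset.filter_false_of_mem fun w _ h => huX h.1]; simp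
    have h5 : 12 * k * ((U.erase v \ X).card + 1) = 12 * k * (U.erase v \ X).card + 12 * k := by ring
    omega
  obtain ⟨x, hx⟩ := hXne
  -- Otherwise `X` and `U - x` would form a separation of order below |X| whose right side carries
  -- the whole mass.
  obtain ⟨v, hv, hxv⟩ : ∃ v ∈ U \ X, G.Adj x v := by
    by_contra hno
    push Not at hno
    have hBA : U.erase x \ X = U \ X := by
      ext w; simp only [Finset.mem_sdiff, Finset.mem_erase]
      constructor
      · tauto
      · rintro ⟨h1, h2⟩; exact ⟨⟨fun h => h2 (h ▸ hx), h1⟩, h2⟩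
    have := hM.2 X (U.erase x) ⟨?_, fun a ha b hb hab => ?_⟩ subset_rfl ?_
    · rw [hBA] at this
      exact absurd hM.1 (by omega)
    · ext w
      simp only [Finset.mem_union, Finset.mem_erase]
      constructor
      · rintro (h | h)
        exacts [hXU h, h.2]
      · intro h
        by_cases hw : w = x
        · exact Or.inl (hw ▸ hx)
        · exact Or.inr ⟨hw, h⟩
    · rw [hBA] at hb
      simp only [Finset.mem_sdiff, Finset.mem_erase, not_and_or, not_not] at ha
      rcases ha.2 with h | h
      · exact hno b hb (h ▸ hab)
      · exact h (hXU ha.1)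
    · refine Finset.card_lt_card ⟨Finset.inter_subset_left, fun h => ?_⟩
      simpa using Finset.mem_inter.1 (h hx)
  have hvU := (Finset.mem_sdiff.1 hv).1
  have hvX := (Finset.mem_sdiff.1 hv).2
  have hxc := hcommon x (hXU hx) v hv hxv
  rw [if_pos hx] at hxc
  set W := (nb G U x ∩ nb G U v) \ X with hW
  -- Of the at least 6k - 1 common neighbours, at most |X| - 1 lie in `X`, as `x` is not among them.
  have hWc : 2 * k ≤ W.card + 0 ∧ 3 ≤ W.card := by
    have h1 : ((nb G U x ∩ nb G U v) ∩ X).card ≤ X.card - 1 := by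
      rw [← Finset.card_erase_of_mem hx]
      refine Finset.card_le_card fun w hw => ?_
      simp only [Finset.mem_inter, mem_nb] at hw
      exact Finset.mem_erase.2 ⟨hw.1.1.2.ne', hw.2⟩
    have h2 := Finset.card_inter_add_card_sdiff (nb G U x ∩ nb G U v) X
    have h3 := Finset.card_pos.2 ⟨x, hx⟩
    rw [← hW] at h2
    omega
  obtain ⟨w, hw⟩ := Finset.card_pos.1 (by omega : 0 < W.card)
  have hmass : mass G U (U \ X) ≤ 12 * k * (U \ X).card + 2 := by
    simp only [hW, Finset.mem_sdiff, Finset.mem_inter, mem_nb] at hw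
    exact hM.mass_le_of_edge ih ih' hXU hXk hnot hw.1.2.2 hv (by simp [hw])
  -- If all degrees outside `X` were at least 12k, the three or more edges from `x` to the outside
  -- would push the mass above `12k|U \ X| + 2`.
  obtain ⟨z, hz, hzdeg⟩ : ∃ z ∈ U \ X, (nb G U z).card < 12 * k := by
    by_contra hno
    push Not at hno
    have h1 := mass_eq_degree_sum (G := G) hXU
    have h2 := Finset.card_nsmul_le_sum _ _ _ hno
    have h3 : (nb G (U \ X) x).card ≤ ∑ y ∈ X, (nb G (U \ X) y).card :=
      Finset.single_le_sum (f := fun y => (nb G (U \ X) y).card) (fun _ _ => Nat.zero_le _) hx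
    have h4 : W.card ≤ (nb G (U \ X) x).card := by
      refine Finset.card_le_card fun w hw => ?_
      simp only [hW, Finset.mem_sdiff, Finset.mem_inter, mem_nb] at hw ⊢
      tauto
    rw [smul_eq_mul] at h2
    have h5 : (U \ X).card * (12 * k) = 12 * k * (U \ X).card := by ring
    omega
  have hzU := (Finset.mem_sdiff.1 hz).1
  have hzX := (Finset.mem_sdiff.1 hz).2
  -- If `z` were isolated, `X + z` and `U - z` would form a separation of order at most |X| with a
  -- heavy right side.
  obtain ⟨y, hy, hzy⟩ : ∃ y ∈ U, G.Adj z y := by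
    by_contra hno
    push Not at hno
    have hBA : U.erase z \ insert z X = (U \ X).erase z := by
      ext w; simp only [Finset.mem_sdiff, Finset.mem_erase, Finset.mem_insert]; tauto
    refine hnot (hM.linked_of_heavy ih hXU hXk (A := insert z X) (B := U.erase z)
      ⟨?_, fun a ha b hb hab => ?_⟩ (Finset.subset_insert _ _) ?_ ⟨z, by simp⟩ ?_)
    · ext w
      have := @hXU w
      simp only [Finset.mem_union, Finset.mem_insert, Finset.mem_erase]
      by_cases h : w = z
      · simp [h, hzU]
      · tauto
    · simp only [Finset.mem_sdiff, Finset.mem_insert, Finset.mem_erase] at ha hb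
      have : a = z := by
        by_contra hne
        exact ha.2 ⟨hne, hXU (ha.1.resolve_left hne)⟩
      exact hno b hb.1.2 (this ▸ hab)
    · refine Finset.card_le_card fun w hw => ?_
      simp only [Finset.mem_inter, Finset.mem_insert, Finset.mem_erase] at hw
      tauto
    · rw [hBA]
      have h1 : mass G U (U \ X) ≤ mass G U ((U \ X).erase z) := mass_le fun a b hab ha hb hS => by
        refine ⟨hab, ha, hb, hS.imp (fun h => ?_) fun h => ?_⟩
        · exact Finset.mem_erase.2 ⟨fun h' => hno b hb (h' ▸ hab), h⟩
        · exact Finset.mem_erase.2 ⟨fun h' => hno a ha (h' ▸ hab.symm), h⟩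
      refine lt_of_le_of_lt ?_ (lt_of_lt_of_le hM.1 h1)
      exact Nat.mul_le_mul_left _ (Finset.card_le_card (Finset.erase_subset _ _))
  set D := insert z (nb G U z) with hD
  have hDU : D ⊆ U := Finset.insert_subset hzU (Finset.filter_subset _ _)
  have hDz : ∀ w ∈ nb G U z, 6 * k ≤ (nb G D w).card := by
    intro w hw
    obtain ⟨hwU, hzw⟩ := mem_nb.1 hw
    have h1 := hcommon w hwU z hz hzw.symm
    have h2 : (nb G U w ∩ nb G U z).card + 1 ≤ (nb G D w).card := by
      rw [← Finset.card_insert_of_notMem (a := z) (s := nb G U w ∩ nb G U z) (by simp)]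
      refine Finset.card_le_card fun q hq => ?_
      simp only [Finset.mem_insert, Finset.mem_inter, mem_nb, hD] at hq ⊢
      rcases hq with rfl | hq
      · exact ⟨Or.inl rfl, hzw.symm⟩
      · tauto
    split_ifs at h1 <;> omega
  obtain ⟨C, hCD, hCk, hC⟩ := hdense G D ⟨z, by simp [hD]⟩
    ((Finset.card_insert_le _ _).trans hzdeg) (fun w hw => by
      rcases Finset.mem_insert.1 hw with rfl | hw
      · have h1 := hcommon y hy w hz hzy.symm
        have h2 : (nb G U y ∩ nb G U w).card + 1 ≤ (nb G D w).card := by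
          rw [← Finset.card_insert_of_notMem (a := y) (s := nb G U y ∩ nb G U w) (by simp)]
          refine Finset.card_le_card fun q hq => ?_
          simp only [Finset.mem_insert, Finset.mem_inter, mem_nb, hD] at hq ⊢
          rcases hq with rfl | hq
          · exact ⟨Or.inr ⟨hy, hzy⟩, hzy⟩
          · tauto
        split_ifs at h1 <;> omega
      · exact hDz w hw)
  refine hnot (hM.linked_of_hub ih hXU hXk (L := C) (Y := C) subset_rfl (hCD.trans hDU) (by simp)
    (by simp) (hXk.trans hCk) fun T hT hTc => hC.linked hCk hT (hTc.trans hXk))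

/-- The graph joining any two vertices of `X` other than a given pair. -/
def fillGraph {ι : Type*} (X : Finset V) (s t : ι → V) : SimpleGraph V where
  Adj a b := a ≠ b ∧ a ∈ X ∧ b ∈ X ∧ ∀ i, ¬ (a = s i ∧ b = t i) ∧ ¬ (a = t i ∧ b = s i)
  symm := ⟨fun _ _ h => ⟨h.1.symm, h.2.2.1, h.2.1, fun i => ⟨fun h' => (h.2.2.2 i).2 ⟨h'.2, h'.1⟩,
    fun h' => (h.2.2.2 i).1 ⟨h'.2, h'.1⟩⟩⟩⟩
  loopless := ⟨fun _ h => h.1 rfl⟩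

/-- Induction on |U| and then on the mass. For a given pairing, all edges inside `X` except those
between partners are added at no cost in mass, and afterwards every vertex of `X` misses at most one
other. The connectors obtained meet `X` only in their own two ends, so they use none of the added
edges. -/
theorem Massed.linked [Fintype V] (hdense : DenseLinked V k) :
    ∀ (n : ℕ) (G : SimpleGraph V) (U X : Finset V), U.card = n → X ⊆ U → X.card ≤ 2 * k →
      Massed k G U X → Linked G U X := by
  intro n
  induction n using Nat.strong_induction_on with
  | _ n ih =>
  have ihB : LinkedBelow V k n := fun G U X hlt => ih _ hlt G U X rfl
  intro G U X hU hXU hXk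
  subst hU
  induction hm : mass G U (U \ X) using Nat.strong_induction_on generalizing G with
  | _ m ih' =>
  subst hm
  intro hM ι s t hst hs ht
  have hadj : ∀ a b, a ∈ U \ X ∨ b ∈ U \ X → (G.Adj a b ↔ (G ⊔ fillGraph X s t).Adj a b) := by
    intro a b hab
    simp only [Finset.mem_sdiff] at hab
    rw [SimpleGraph.sup_adj]
    exact ⟨Or.inl, fun h => h.resolve_right fun h' => by have := h'.2.1; have := h'.2.2.1; tauto⟩
  have hmass := mass_congr (U := U) hadj
  have hM' : Massed k (G ⊔ fillGraph X s t) U X := by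
    refine ⟨hmass ▸ hM.1, fun A B hAB hXA hlt => ?_⟩
    rw [← mass_congr (G := G)]
    · exact hM.2 A B ⟨hAB.1, fun a ha b hb hab => hAB.2 a ha b hb (Or.inl hab)⟩ hXA hlt
    · intro a b hab
      have hBU : B ⊆ U := hAB.1 ▸ Finset.subset_union_right
      have : B \ A ⊆ U \ X := Finset.sdiff_subset_sdiff hBU hXA
      exact hadj a b (hab.imp (fun h => this h) fun h => this h)
  by_cases hXe : X.Nonempty
  swap
  · have hem : IsEmpty ι := ⟨fun i => hXe ⟨_, hs i⟩⟩
    exact ⟨fun _ => ∅, fun i => hem.elim i, fun i => hem.elim i⟩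
  have hL := hM'.linked_of_almost_complete hdense ihB
    (fun G' hlt hG' => ih' _ (hmass ▸ hlt) G' rfl hG') hXU hXk hXe (by
      intro u hu a ha b hb
      have key : ∀ w, (w ∈ X ∧ w ≠ u ∧ ¬ (G ⊔ fillGraph X s t).Adj u w) →
          ∃ i, (u = s i ∧ w = t i) ∨ (u = t i ∧ w = s i) := by
        intro w hw
        simp only [SimpleGraph.sup_adj, not_or] at hw
        by_contra hno
        push Not at hno
        exact hw.2.2.2 ⟨hw.2.1.symm, hu, hw.1, fun i => ⟨fun h => (hno i).1 h.1 h.2,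
          fun h => (hno i).2 h.1 h.2⟩⟩
      have hss : ∀ i j, s i = s j → i = j := fun i j h => Sum.inl.inj (@hst (.inl i) (.inl j) h)
      have htt : ∀ i j, t i = t j → i = j := fun i j h => Sum.inr.inj (@hst (.inr i) (.inr j) h)
      have hst' : ∀ i j, s i ≠ t j := fun i j h => Sum.inl_ne_inr (@hst (.inl i) (.inr j) h)
      obtain ⟨i, hi⟩ := key a ha
      obtain ⟨j, hj⟩ := key b hb
      rcases hi with ⟨h1, h2⟩ | ⟨h1, h2⟩ <;> rcases hj with ⟨h3, h4⟩ | ⟨h3, h4⟩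
      · rw [h2, h4, hss i j (h1.symm.trans h3)]
      · exact absurd (h1.symm.trans h3) (hst' _ _)
      · exact absurd (h3.symm.trans h1) (hst' _ _)
      · rw [h2, h4, htt i j (h1.symm.trans h3)])
  obtain ⟨S, hS, hd⟩ := hL ι s t hst hs ht
  refine ⟨S, fun i => ⟨(hS i).1, (hS i).2.1, (hS i).2.2.1, (hS i).2.2.2.1, ?_⟩, hd⟩
  refine (hS i).2.2.2.2.closed (fun w => Conn G (S i) (s i) w) Conn.rfl fun a b ha hab haS hbS => ?_
  rcases hab with hab | hab
  · exact ha.trans (Conn.of_adj hab haS hbS)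
  · obtain ⟨hne, haX, hbX, hno⟩ := hab
    rcases (hS i).2.2.2.1 a haS haX with rfl | rfl <;> rcases (hS i).2.2.2.1 b hbS hbX with rfl | rfl
    · exact absurd rfl hne
    · exact absurd ⟨rfl, rfl⟩ (hno i).1
    · exact absurd ⟨rfl, rfl⟩ (hno i).2
    · exact absurd rfl hne

end ThomasWollan

end ParityLinkage
end

section
open scoped Classical
namespace ParityLinkage

/-! ### Small graphs of large minimum degree are linked. -/

section Dense
variable {V : Type*} {G : SimpleGraph V} {k : ℕ}

theorem exists_injective_of_card_le {ι : Type*} [Fintype ι] (T : ι → Finset V)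
    (h : ∀ i, Fintype.card ι ≤ (T i).card) : ∃ f : ι → V, Function.Injective f ∧ ∀ i, f i ∈ T i := by
  refine (Finset.all_card_le_biUnion_card_iff_exists_injective T).1 fun A => ?_
  rcases A.eq_empty_or_nonempty with rfl | ⟨a, ha⟩
  · simp
  · exact (Finset.card_le_univ A).trans ((h a).trans
      (Finset.card_le_card (Finset.subset_biUnion_of_mem T ha)))

/-- A partial system of distinct representatives and a witness for its maximality. -/
theorem exists_partial_transversal {ι : Type*} [Fintype ι] (T : ι → Finset V) :
    ∃ (R : Finset ι) (f : ι → Option V), (∀ i v, f i = some v → v ∈ T i) ∧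
      (∀ i j v, f i = some v → f j = some v → i = j) ∧ (∀ i, f i = none → i ∈ R) ∧
      (∀ v ∈ R.biUnion T, ∃ i, f i = some v) ∧
      R.card = (R.biUnion T).card + (Finset.univ.filter fun i => f i = none).card := by
  -- `R` has the largest deficiency `r`. With `r` dummy values offered to every index Hall's
  -- condition holds, and by counting, the indices in `R` use all values in their lists and all
  -- dummies; so exactly `r` indices, all in `R`, remain without a value.
  obtain ⟨R, -, hR⟩ := Finset.exists_max_image (Finset.univ : Finset (Finset ι))
    (fun A => (A.card : ℤ) - (A.biUnion T).card) ⟨∅, Finset.mem_univ _⟩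
  have hR' : ∀ A : Finset ι, A.card + (R.biUnion T).card ≤ R.card + (A.biUnion T).card := fun A => by
    have := hR A (Finset.mem_univ _); omega
  obtain ⟨r, hr⟩ : ∃ r, R.card = (R.biUnion T).card + r := by
    have := hR' ∅
    exact ⟨R.card - (R.biUnion T).card, by simp at this; omega⟩
  let T' : ι → Finset (V ⊕ Fin r) := fun i => (T i).disjSum Finset.univ
  obtain ⟨f, hf, hfT⟩ := (Finset.all_card_le_biUnion_card_iff_exists_injective T').1 fun A => by
    rcases A.eq_empty_or_nonempty with rfl | ⟨a, ha⟩
    · simp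
    · have h1 : (A.biUnion T).disjSum (Finset.univ : Finset (Fin r)) ⊆ A.biUnion T' := by
        intro z hz
        rcases Finset.mem_disjSum.1 hz with ⟨v, hv, rfl⟩ | ⟨v, hv, rfl⟩
        · obtain ⟨b, hb, hbv⟩ := Finset.mem_biUnion.1 hv
          exact Finset.mem_biUnion.2 ⟨b, hb, Finset.inl_mem_disjSum.2 hbv⟩
        · exact Finset.mem_biUnion.2 ⟨a, ha, Finset.inr_mem_disjSum.2 hv⟩
      have h2 := Finset.card_le_card h1
      rw [Finset.card_disjSum, Finset.card_univ, Fintype.card_fin] at h2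
      have := hR' A
      omega
  have himg : R.image f = (R.biUnion T).disjSum Finset.univ := by
    refine Finset.eq_of_subset_of_card_le (fun z hz => ?_) ?_
    · obtain ⟨i, hi, rfl⟩ := Finset.mem_image.1 hz
      have := hfT i
      rcases h : f i with v | v
      · rw [h] at this
        exact Finset.inl_mem_disjSum.2 (Finset.mem_biUnion.2 ⟨i, hi, Finset.inl_mem_disjSum.1 this⟩)
      · simp
    · rw [Finset.card_image_of_injective _ hf, Finset.card_disjSum, Finset.card_univ,
        Fintype.card_fin, hr]
  have hnone : ∀ i, (f i).getLeft? = none ↔ ∃ c, f i = Sum.inr c := fun i => by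
    rcases f i with v | v <;> simp
  have hR : ∀ i c, f i = Sum.inr c → i ∈ R := fun i c hc => by
    have : Sum.inr c ∈ R.image f := by rw [himg]; simp
    obtain ⟨j, hj, hjc⟩ := Finset.mem_image.1 this
    exact hf (hjc.trans hc.symm) ▸ hj
  refine ⟨R, fun i => (f i).getLeft?, fun i v hv => ?_, fun i j v hi hj => ?_, fun i hi => ?_,
    fun v hv => ?_, ?_⟩
  · have := hfT i
    rw [Sum.getLeft?_eq_some_iff.1 hv] at this
    exact Finset.inl_mem_disjSum.1 this
  · exact hf ((Sum.getLeft?_eq_some_iff.1 hi).trans (Sum.getLeft?_eq_some_iff.1 hj).symm)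
  · obtain ⟨c, hc⟩ := (hnone i).1 hi
    exact hR i c hc
  · have : Sum.inl v ∈ R.image f := by rw [himg]; exact Finset.inl_mem_disjSum.2 hv
    obtain ⟨j, hj, hjc⟩ := Finset.mem_image.1 this
    exact ⟨j, by simp [hjc]⟩
  · rw [hr]
    congr 1
    have : (Finset.univ.filter fun i => (f i).getLeft? = none).image f =
        (Finset.univ : Finset (Fin r)).image Sum.inr := by
      ext z
      simp only [Finset.mem_image, Finset.mem_filter, Finset.mem_univ, true_and, hnone]
      constructor
      · rintro ⟨i, ⟨c, hc⟩, rfl⟩; exact ⟨c, hc.symm⟩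
      · rintro ⟨c, rfl⟩
        have : Sum.inr c ∈ R.image f := by rw [himg]; simp
        obtain ⟨j, hj, hjc⟩ := Finset.mem_image.1 this
        exact ⟨j, ⟨c, hjc⟩, hjc⟩
    have h2 := congrArg Finset.card this
    rw [Finset.card_image_of_injective _ hf, Finset.card_image_of_injective _ Sum.inr_injective] at h2
    simpa using h2.symm

/-- Inclusion and exclusion; neither neighbourhood contains `a` or `b`, which yields the 2. -/
theorem card_nb_add_card_nb_le {F : Finset V} {a b : V} (ha : a ∈ F) (hb : b ∈ F) (hne : a ≠ b)
    (hab : ¬ G.Adj a b) :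
    (nb G F a).card + (nb G F b).card + 2 ≤ F.card + (nb G F a ∩ nb G F b).card := by
  rw [← Finset.card_union_add_card_inter, ← Finset.card_pair hne]
  have : (nb G F a ∪ nb G F b).card + ({a, b} : Finset V).card ≤ F.card := by
    rw [← Finset.card_union_of_disjoint]
    · refine Finset.card_le_card fun w hw => ?_
      simp only [Finset.mem_union, mem_nb, Finset.mem_insert, Finset.mem_singleton] at hw
      rcases hw with (h | h) | rfl | rfl
      exacts [h.1, h.1, ha, hb]
    · rw [Finset.disjoint_left]
      intro w hw hw'
      simp only [Finset.mem_union, mem_nb, Finset.mem_insert, Finset.mem_singleton] at hw hw'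
      rcases hw' with rfl | rfl
      · exact hw.elim (fun h => h.2.ne rfl) fun h => hab h.2.symm
      · exact hw.elim (fun h => hab h.2) fun h => h.2.ne rfl
  omega

/-- A small graph of large minimum degree is `k`-linked. -/
theorem kLinked_of_dense {C : Finset V} {δ : ℕ} (hδ : ∀ v ∈ C, δ ≤ (nb G C v).card)
    (h3 : 3 * k ≤ δ) (h5 : 5 * k + 2 * C.card ≤ 4 * δ) : KLinked G C k := by
  intro s t hst hs ht
  have hss : ∀ i j, s i = s j → i = j := fun i j h => Sum.inl.inj (@hst (.inl i) (.inl j) h)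
  have htt : ∀ i j, t i = t j → i = j := fun i j h => Sum.inr.inj (@hst (.inr i) (.inr j) h)
  have hst' : ∀ i j, s i ≠ t j := fun i j h => Sum.inl_ne_inr (@hst (.inl i) (.inr j) h)
  set E : Finset V := Finset.univ.image (Sum.elim s t) with hE
  have hEc : E.card = 2 * k := by
    rw [hE, Finset.card_image_of_injective _ hst]; simp; omega
  have hsE : ∀ i, s i ∈ E := fun i => Finset.mem_image.2 ⟨.inl i, by simp⟩
  have htE : ∀ i, t i ∈ E := fun i => Finset.mem_image.2 ⟨.inr i, by simp⟩
  have hEC : E ⊆ C := fun v hv => by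
    obtain ⟨z | z, -, rfl⟩ := Finset.mem_image.1 hv
    exacts [hs z, ht z]
  -- Adjacent pairs need nothing. As many others as possible are joined through private common
  -- neighbours `M`; each pair in the remainder `L` is joined by a path with two or three inner
  -- vertices among the free vertices `F`.
  let N := {i // ¬ G.Adj (s i) (t i)}
  let T : N → Finset V := fun i => (nb G C (s i) ∩ nb G C (t i)) \ E
  obtain ⟨R, f, hfT, hfi, hfR, hRf, hRc⟩ := exists_partial_transversal T
  set L := Finset.univ.filter fun i => f i = none with hL
  set M : Finset V := Finset.univ.filterMap f (fun i j v hi hj => hfi i j v hi hj) with hM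
  have hMf : ∀ v, v ∈ M ↔ ∃ i, f i = some v := fun v => by simp [hM]
  have hMT : ∀ v ∈ M, v ∈ C ∧ v ∉ E := fun v hv => by
    obtain ⟨i, hi⟩ := (hMf v).1 hv
    have := hfT i v hi
    simp only [T, Finset.mem_sdiff, Finset.mem_inter, mem_nb] at this
    exact ⟨this.1.1.1, this.2⟩
  have hMc : M.card + L.card ≤ k := by
    have h1 : M.card + L.card ≤ Fintype.card N := by
      rw [← Finset.card_univ, ← Finset.card_filter_add_card_filter_not (s := Finset.univ)
        (fun i => f i = none), add_comm]
      refine Nat.add_le_add_left ?_ _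
      have hch : ∀ v : M, ∃ i, f i = some v.1 := fun v => (hMf v).1 v.2
      choose g hg using hch
      rw [← Finset.card_attach]
      refine Finset.card_le_card_of_injOn g (fun v _ => by simp [hg]) fun v _ w _ h => ?_
      have := (hg v).symm.trans ((congrArg f h).trans (hg w))
      exact Subtype.ext (Option.some.inj this)
    refine h1.trans ((Fintype.card_subtype_le _).trans (by simp))
  set W := E ∪ M with hW
  have hWc : W.card ≤ 3 * k - L.card ∧ L.card ≤ k := by
    have := Finset.card_union_le E M
    rw [← hW] at this
    omega
  have hWC : W ⊆ C := Finset.union_subset hEC fun v hv => (hMT v hv).1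
  set F := C \ W with hF
  have hFc : F.card + W.card = C.card := Finset.card_sdiff_add_card_eq_card hWC
  have hFm : ∀ x, x ∈ F ↔ x ∈ C ∧ x ∉ E ∧ x ∉ M := fun x => by
    simp only [hF, hW, Finset.mem_sdiff, Finset.mem_union]; tauto
  have hsplit : ∀ x, (nb G C x).card = (nb G F x).card + (nb G W x).card := fun x => by
    rw [← Finset.card_union_of_disjoint]
    · congr 1
      ext w
      have := @hWC w
      simp only [hF, mem_nb, Finset.mem_union, Finset.mem_sdiff]
      tauto
    · rw [Finset.disjoint_left]
      intro w hw hw'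
      exact (Finset.mem_sdiff.1 (mem_nb.1 hw).1).2 (mem_nb.1 hw').1
  -- Every common neighbour of a pair in `R` is already used, so a free vertex misses an end of each
  -- such pair. Hence free vertices have many free neighbours.
  have hmiss : ∀ x ∈ F, (nb G W x).card + R.card ≤ W.card := by
    intro x hx
    have hx' := (hFm x).1 hx
    have hch : ∀ i : N, i ∈ R → ∃ e, (e = s i ∨ e = t i) ∧ ¬ G.Adj x e := by
      intro i hi
      by_contra hno
      push Not at hno
      refine hx'.2.2 ((hMf x).2 (hRf x (Finset.mem_biUnion.2 ⟨i, hi, ?_⟩)))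
      simp only [T, Finset.mem_sdiff, Finset.mem_inter, mem_nb]
      exact ⟨⟨⟨hx'.1, (hno _ (Or.inl rfl)).symm⟩, hx'.1, (hno _ (Or.inr rfl)).symm⟩, hx'.2.1⟩
    have : Nonempty V := ⟨x⟩
    choose! e he hxe using hch
    have h1 : R.card ≤ (W \ nb G W x).card := by
      refine Finset.card_le_card_of_injOn e (fun i hi => ?_) fun i hi j hj hij => ?_
      · simp only [Finset.coe_sdiff, Set.mem_sdiff, Finset.mem_coe, mem_nb, not_and]
        refine ⟨Finset.mem_union_left _ ?_, fun _ => hxe i hi⟩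
        rcases he i hi with h | h <;> rw [h]
        exacts [hsE _, htE _]
      · apply Subtype.ext
        rcases he i hi with h | h <;> rcases he j hj with h' | h' <;> rw [h, h'] at hij
        · exact hss _ _ hij
        · exact absurd hij (hst' _ _)
        · exact absurd hij.symm (hst' _ _)
        · exact htt _ _ hij
    have h2 := Finset.card_sdiff_add_card_eq_card (Finset.filter_subset (G.Adj x) W)
    change (W \ nb G W x).card + (nb G W x).card = _ at h2
    omega
  have hnbF : ∀ x ∈ F, (nb G F x).card + 1 ≤ F.card := by
    intro x hx
    rw [← Finset.card_erase_add_one hx]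
    refine Nat.add_le_add_right (Finset.card_le_card fun w hw => ?_) _
    exact Finset.mem_erase.2 ⟨(mem_nb.1 hw).2.ne', (mem_nb.1 hw).1⟩
  have hRle : k = 0 ∨ R.card + δ + 1 ≤ C.card := by
    rcases Nat.eq_zero_or_pos k with h0 | hk
    · exact Or.inl h0
    obtain ⟨v, hv⟩ : C.Nonempty := ⟨_, hs ⟨0, hk⟩⟩
    have h1 : δ + 1 ≤ C.card := by
      refine (Nat.add_le_add_right (hδ v hv) 1).trans ?_
      rw [← Finset.card_erase_add_one hv]
      refine Nat.add_le_add_right (Finset.card_le_card fun w hw => ?_) _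
      exact Finset.mem_erase.2 ⟨(mem_nb.1 hw).2.ne', (mem_nb.1 hw).1⟩
    obtain ⟨x, hx⟩ := Finset.card_pos.1 (by omega : 0 < F.card)
    have := hmiss x hx
    have := hnbF x hx
    have := hsplit x
    have := hδ x ((hFm x).1 hx).1
    omega
  have hTc : ∀ i : N, 2 * δ + 4 ≤ C.card + (T i).card + 2 * k := by
    intro i
    have h1 := card_nb_add_card_nb_le (hs i) (ht i) (hst' _ _) i.2
    have h2 := hδ _ (hs i)
    have h3 := hδ _ (ht i)
    have h4 : (nb G C (s i) ∩ nb G C (t i)).card ≤ (T i).card + (2 * k - 2) := by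
      have h5 : ((nb G C (s i) ∩ nb G C (t i)) ∩ E).card ≤ 2 * k - 2 := by
        have h6 : (E \ {s i.1, t i.1}).card = 2 * k - 2 := by
          rw [Finset.card_sdiff_of_subset, hEc, Finset.card_pair (hst' _ _)]
          intro v hv
          rcases Finset.mem_insert.1 hv with rfl | hv
          · exact hsE _
          · rw [Finset.mem_singleton.1 hv]; exact htE _
        rw [← h6]
        refine Finset.card_le_card fun w hw => ?_
        simp only [Finset.mem_inter, mem_nb] at hw
        simp only [Finset.mem_sdiff, Finset.mem_insert, Finset.mem_singleton, not_or]
        exact ⟨hw.2, hw.1.1.2.ne', hw.1.2.2.ne'⟩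
      have := Finset.card_inter_add_card_sdiff (nb G C (s i) ∩ nb G C (t i)) E
      change _ + (T i).card = _ at this
      omega
    have : 0 < k := i.1.pos
    omega
  -- Together with `hTc` this bounds |L|: the union of the lists over `R` has |R| - |L| elements,
  -- while a single list has at least 2δ + 4 - |C| - 2k.
  have hLR : ∀ i ∈ L, (T i).card ≤ (R.biUnion T).card := fun i hi =>
    Finset.card_le_card (Finset.subset_biUnion_of_mem T (hfR i (Finset.mem_filter.1 hi).2))
  have hfreeE : ∀ i : N, ∀ e, (e = s i ∨ e = t i) → i ∈ L → 2 * L.card ≤ (nb G F e).card := by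
    intro i e he hi
    have h1 := hTc i
    have h2 := hLR i hi
    have heC : e ∈ C := by rcases he with rfl | rfl; exacts [hs _, ht _]
    have h3 := hδ e heC
    have h4 := hsplit e
    have h5 : (nb G W e).card + 2 ≤ W.card := by
      rw [← Finset.card_pair (hst' i.1 i.1), ← Finset.card_union_of_disjoint]
      · refine Finset.card_le_card fun w hw => ?_
        simp only [Finset.mem_union, mem_nb, Finset.mem_insert, Finset.mem_singleton] at hw
        rcases hw with h | rfl | rfl
        exacts [h.1, Finset.mem_union_left _ (hsE _), Finset.mem_union_left _ (htE _)]
      · rw [Finset.disjoint_left]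
        intro w hw hw'
        have := (mem_nb.1 hw).2
        simp only [Finset.mem_insert, Finset.mem_singleton] at hw'
        rcases he with rfl | rfl <;> rcases hw' with rfl | rfl
        exacts [this.ne rfl, i.2 this, i.2 this.symm, this.ne rfl]
    have : 0 < k := i.1.pos
    omega
  obtain ⟨xy, hxyi, hxy⟩ := exists_injective_of_card_le (ι := L ⊕ L)
    (fun z => nb G F (z.elim (fun i => s i.1) (fun i => t i.1))) (by
      rintro (z | z)
      · exact le_trans (by simp; omega) (hfreeE z.1 _ (Or.inl rfl) z.2)
      · exact le_trans (by simp; omega) (hfreeE z.1 _ (Or.inr rfl) z.2))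
  set Q : Finset V := Finset.univ.image xy with hQ
  have hQc : Q.card = 2 * L.card := by
    rw [hQ, Finset.card_image_of_injective _ hxyi]; simp; omega
  obtain ⟨zz, hzzi, hzz⟩ := exists_injective_of_card_le
    (ι := {i : L // ¬ G.Adj (xy (.inl i)) (xy (.inr i))})
    (fun i => (nb G F (xy (.inl i.1)) ∩ nb G F (xy (.inr i.1))) \ Q) (by
      intro i
      refine (Fintype.card_subtype_le _).trans ?_
      rw [Fintype.card_coe]
      have hx := (mem_nb.1 (hxy (.inl i.1))).1
      have hy := (mem_nb.1 (hxy (.inr i.1))).1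
      have h1 := card_nb_add_card_nb_le hx hy (fun h => Sum.inl_ne_inr (hxyi h)) i.2
      have h2 := hmiss _ hx
      have h3 := hmiss _ hy
      have h4 := hsplit (xy (.inl i.1))
      have h5 := hsplit (xy (.inr i.1))
      have h6 := hδ _ ((hFm _).1 hx).1
      have h7 := hδ _ ((hFm _).1 hy).1
      have h8 := Finset.le_card_sdiff Q (nb G F (xy (.inl i.1)) ∩ nb G F (xy (.inr i.1)))
      have h9 := hTc i.1.1
      have h10 := hLR i.1.1 i.1.2
      omega)
  have hQF : ∀ v ∈ Q, v ∈ F := fun v hv => by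
    obtain ⟨z, -, rfl⟩ := Finset.mem_image.1 hv
    exact (mem_nb.1 (hxy z)).1
  -- The inner vertices for pair `i`: its private common neighbour, or else the free neighbours of
  -- its two ends and, if these are not adjacent, a common free neighbour of them.
  let ext (i : Fin k) : Set V := {v | ∃ h : ¬ G.Adj (s i) (t i), f ⟨i, h⟩ = some v ∨
    ∃ hL : (⟨i, h⟩ : N) ∈ L, v = xy (.inl ⟨⟨i, h⟩, hL⟩) ∨ v = xy (.inr ⟨⟨i, h⟩, hL⟩) ∨
      ∃ h' : ¬ G.Adj (xy (.inl ⟨⟨i, h⟩, hL⟩)) (xy (.inr ⟨⟨i, h⟩, hL⟩)), v = zz ⟨⟨⟨i, h⟩, hL⟩, h'⟩}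
  have hzzF : ∀ j, zz j ∈ F ∧ zz j ∉ Q := fun j => by
    have := hzz j
    simp only [Finset.mem_sdiff, Finset.mem_inter, mem_nb] at this
    exact ⟨this.1.1.1, this.2⟩
  have hxyQ : ∀ j, xy j ∈ Q := fun j => Finset.mem_image_of_mem _ (Finset.mem_univ _)
  have hextC : ∀ i, ∀ v ∈ ext i, v ∈ C ∧ v ∉ E := by
    rintro i v ⟨h, h1 | ⟨hL, rfl | rfl | ⟨h', rfl⟩⟩⟩
    · exact hMT v ((hMf v).2 ⟨_, h1⟩)
    · have := (hFm _).1 (hQF _ (hxyQ (.inl ⟨⟨i, h⟩, hL⟩))); exact ⟨this.1, this.2.1⟩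
    · have := (hFm _).1 (hQF _ (hxyQ (.inr ⟨⟨i, h⟩, hL⟩))); exact ⟨this.1, this.2.1⟩
    · have := (hFm _).1 (hzzF ⟨⟨⟨i, h⟩, hL⟩, h'⟩).1; exact ⟨this.1, this.2.1⟩
  have hextd : ∀ i j v, v ∈ ext i → v ∈ ext j → i = j := by
    have hMF : ∀ i v, f i = some v → v ∉ F := fun i v hi hv => ((hFm v).1 hv).2.2 ((hMf v).2 ⟨i, hi⟩)
    rintro i j v ⟨h, h1 | ⟨hL, h1 | h1 | ⟨h', h1⟩⟩⟩ ⟨g, g1 | ⟨gL, g1 | g1 | ⟨g', g1⟩⟩⟩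
    · exact congrArg Subtype.val (hfi _ _ v h1 g1)
    · exact absurd (g1 ▸ hQF _ (hxyQ _)) (hMF _ v h1)
    · exact absurd (g1 ▸ hQF _ (hxyQ _)) (hMF _ v h1)
    · exact absurd (g1 ▸ (hzzF _).1) (hMF _ v h1)
    · exact absurd (h1 ▸ hQF _ (hxyQ _)) (hMF _ v g1)
    · have := Sum.inl.inj (hxyi (h1.symm.trans g1))
      exact congrArg (fun z : L => z.1.1) this
    · exact absurd (hxyi (h1.symm.trans g1)) Sum.inl_ne_inr
    · exact absurd (h1.symm.trans g1 ▸ hxyQ _) (hzzF _).2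
    · exact absurd (h1 ▸ hQF _ (hxyQ _)) (hMF _ v g1)
    · exact absurd (hxyi (h1.symm.trans g1)) Sum.inr_ne_inl
    · have := Sum.inr.inj (hxyi (h1.symm.trans g1))
      exact congrArg (fun z : L => z.1.1) this
    · exact absurd (h1.symm.trans g1 ▸ hxyQ _) (hzzF _).2
    · exact absurd (h1 ▸ (hzzF _).1) (hMF _ v g1)
    · exact absurd (g1.symm.trans h1 ▸ hxyQ _) (hzzF _).2
    · exact absurd (g1.symm.trans h1 ▸ hxyQ _) (hzzF _).2
    · have := hzzi (h1.symm.trans g1)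
      exact congrArg (fun z => z.1.1.1) this
  let S (i : Fin k) : Finset V := C.filter fun v => v = s i ∨ v = t i ∨ v ∈ ext i
  have hSm : ∀ i v, v ∈ S i ↔ v ∈ C ∧ (v = s i ∨ v = t i ∨ v ∈ ext i) := fun i v => by simp [S]
  have hsS : ∀ i, s i ∈ S i := fun i => (hSm _ _).2 ⟨hs i, Or.inl rfl⟩
  have htS : ∀ i, t i ∈ S i := fun i => (hSm _ _).2 ⟨ht i, Or.inr (Or.inl rfl)⟩
  have hextS : ∀ i v, v ∈ ext i → v ∈ S i := fun i v hv =>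
    (hSm _ _).2 ⟨(hextC i v hv).1, Or.inr (Or.inr hv)⟩
  refine ⟨S, fun i => ⟨Finset.filter_subset _ _, hsS i, htS i, ?_⟩, fun i j hij => ?_⟩
  · by_cases h : G.Adj (s i) (t i)
    · exact Conn.of_adj h (hsS i) (htS i)
    rcases hfi' : f ⟨i, h⟩ with _ | v
    · have hL' : (⟨i, h⟩ : N) ∈ L := Finset.mem_filter.2 ⟨Finset.mem_univ _, hfi'⟩
      have hx := hextS i _ ⟨h, Or.inr ⟨hL', Or.inl rfl⟩⟩
      have hy := hextS i _ ⟨h, Or.inr ⟨hL', Or.inr (Or.inl rfl)⟩⟩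
      refine (Conn.of_adj (mem_nb.1 (hxy (.inl ⟨_, hL'⟩))).2 (hsS i) hx).trans (Conn.trans ?_
        (Conn.of_adj (mem_nb.1 (hxy (.inr ⟨_, hL'⟩))).2 (htS i) hy).symm)
      by_cases h' : G.Adj (xy (.inl ⟨⟨i, h⟩, hL'⟩)) (xy (.inr ⟨⟨i, h⟩, hL'⟩))
      · exact Conn.of_adj h' hx hy
      · have hz := hextS i _ ⟨h, Or.inr ⟨hL', Or.inr (Or.inr ⟨h', rfl⟩)⟩⟩
        have hzz' := hzz ⟨⟨⟨i, h⟩, hL'⟩, h'⟩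
        simp only [Finset.mem_sdiff, Finset.mem_inter, mem_nb] at hzz'
        exact (Conn.of_adj hzz'.1.1.2 hx hz).trans (Conn.of_adj hzz'.1.2.2 hy hz).symm
    · have hv := hextS i v ⟨h, Or.inl hfi'⟩
      have hvT := hfT _ _ hfi'
      simp only [T, Finset.mem_sdiff, Finset.mem_inter, mem_nb] at hvT
      exact (Conn.of_adj hvT.1.1.2 (hsS i) hv).trans (Conn.of_adj hvT.1.2.2 (htS i) hv).symm
  · refine Finset.disjoint_left.2 fun v hv hv' => ?_
    rcases ((hSm _ _).1 hv).2 with rfl | rfl | h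
    · rcases ((hSm _ _).1 hv').2 with h' | h' | h'
      exacts [hij (hss _ _ h'), hst' _ _ h', (hextC _ _ h').2 (hsE _)]
    · rcases ((hSm _ _).1 hv').2 with h' | h' | h'
      exacts [hst' _ _ h'.symm, hij (htt _ _ h'), (hextC _ _ h').2 (htE _)]
    · rcases ((hSm _ _).1 hv').2 with rfl | rfl | h'
      exacts [(hextC _ _ h).2 (hsE _), (hextC _ _ h).2 (htE _), hij (hextd _ _ _ h h')]

end Dense

end ParityLinkage
end

section
open scoped Classical
namespace ParityLinkage

/-! ### Vertices at distance at least three. -/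

section Far
variable {V : Type*} {G : SimpleGraph V} {F : Finset V} {a b c : V}

/-- `a` and `b` have distance at least three in `G[F]`. -/
def Far (G : SimpleGraph V) (F : Finset V) (a b : V) : Prop :=
  a ≠ b ∧ ¬ G.Adj a b ∧ ∀ c ∈ F, G.Adj a c → ¬ G.Adj b c

theorem Far.disjoint (h : Far G F a b) :
    Disjoint (insert a (nb G F a)) (insert b (nb G F b)) := by
  refine Finset.disjoint_left.2 fun w hw hw' => ?_
  simp only [Finset.mem_insert, mem_nb] at hw hw'
  rcases hw with rfl | hw <;> rcases hw' with rfl | hw'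
  exacts [h.1 rfl, h.2.1 hw'.2.symm, h.2.1 hw.2, h.2.2 w hw.1 hw.2 hw'.2]

theorem card_insert_nb : (insert a (nb G F a)).card = (nb G F a).card + 1 :=
  Finset.card_insert_of_notMem (by simp)

theorem insert_nb_subset (ha : a ∈ F) : insert a (nb G F a) ⊆ F :=
  Finset.insert_subset ha (Finset.filter_subset _ _)

theorem Far.card_le (ha : a ∈ F) (hb : b ∈ F) (h : Far G F a b) :
    (nb G F a).card + (nb G F b).card + 2 ≤ F.card := by
  have h1 := Finset.card_le_card (Finset.union_subset (insert_nb_subset (G := G) ha)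
    (insert_nb_subset (G := G) hb))
  rw [Finset.card_union_of_disjoint h.disjoint, card_insert_nb, card_insert_nb] at h1
  omega

theorem Far.card_le₃ (ha : a ∈ F) (hb : b ∈ F) (hc : c ∈ F) (h : Far G F a b) (h' : Far G F a c)
    (h'' : Far G F b c) : (nb G F a).card + (nb G F b).card + (nb G F c).card + 3 ≤ F.card := by
  have h1 := Finset.card_le_card (Finset.union_subset (Finset.union_subset
    (insert_nb_subset (G := G) ha) (insert_nb_subset (G := G) hb)) (insert_nb_subset (G := G) hc))
  rw [Finset.card_union_of_disjoint (Finset.disjoint_union_left.2 ⟨h'.disjoint, h''.disjoint⟩),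
    Finset.card_union_of_disjoint h.disjoint, card_insert_nb, card_insert_nb, card_insert_nb] at h1
  omega

theorem exists_conn_of_not_far (ha : a ∈ F) (hb : b ∈ F) (h : ¬ Far G F a b) :
    ∃ T ⊆ F, a ∈ T ∧ b ∈ T ∧ T.card ≤ 3 ∧ Conn G T a b := by
  by_cases hab : a = b
  · subst hab
    exact ⟨{a}, by simpa using ha, by simp, by simp, by simp, Conn.rfl⟩
  by_cases hadj : G.Adj a b
  · exact ⟨{a, b}, Finset.insert_subset ha (by simpa using hb), by simp, by simp,
      (Finset.card_le_two).trans (by omega), Conn.of_adj hadj (by simp) (by simp)⟩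
  obtain ⟨c, hc, h1, h2⟩ : ∃ c ∈ F, G.Adj a c ∧ G.Adj b c := by
    by_contra hno
    push Not at hno
    exact h ⟨hab, hadj, hno⟩
  exact ⟨{a, b, c}, by simp [Finset.insert_subset_iff, ha, hb, hc], by simp, by simp,
    Finset.card_le_three, (Conn.of_adj h1 (by simp) (by simp)).trans
      (Conn.of_adj h2 (by simp) (by simp)).symm⟩

theorem Far.symm (h : Far G F a b) : Far G F b a :=
  ⟨h.1.symm, fun h' => h.2.1 h'.symm, fun c hc h1 h2 => h.2.2 c hc h2 h1⟩

end Far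

/-! ### Optimal states: economical partial linkages in a dense graph. -/

section State
variable {V : Type*} {G : SimpleGraph V} {k : ℕ} {D : Finset V} {s t : Fin k → V}
  {S : Fin k → Finset V}

/-- Disjoint sets of small total size containing the given pairs. -/
def IsState (D : Finset V) (s t : Fin k → V) (S : Fin k → Finset V) : Prop :=
  (∀ i, S i ⊆ D ∧ s i ∈ S i ∧ t i ∈ S i) ∧ (∀ i j, i ≠ j → Disjoint (S i) (S j)) ∧
    ∑ i, (S i).card ≤ 6 * k

/-- The cost of a state: connected pairs count first, then the total size. -/
noncomputable def cost (G : SimpleGraph V) (s t : Fin k → V) (S : Fin k → Finset V) : ℕ :=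
  ∑ i, ((S i).card + if Conn G (S i) (s i) (t i) then 0 else 6 * k + 1)

/-- A state of minimum cost. -/
def IsOptimal (G : SimpleGraph V) (D : Finset V) (s t : Fin k → V) (S : Fin k → Finset V) : Prop :=
  IsState D s t S ∧ ∀ S', IsState D s t S' → cost G s t S ≤ cost G s t S'

/-- The vertices not used by a state. -/
noncomputable def rest (D : Finset V) (S : Fin k → Finset V) : Finset V := D \ Finset.univ.biUnion S

theorem mem_rest {x : V} : x ∈ rest D S ↔ x ∈ D ∧ ∀ i, x ∉ S i := by simp [rest]

theorem sum_update (g : Fin k → Finset V → ℕ) (j : Fin k) (T : Finset V) :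
    ∑ i, g i (Function.update S j T i) + g j (S j) = ∑ i, g i (S i) + g j T := by
  rw [← Finset.add_sum_erase _ _ (Finset.mem_univ j), ← Finset.add_sum_erase _ (fun i => g i (S i))
    (Finset.mem_univ j), Function.update_self]
  have : ∑ i ∈ Finset.univ.erase j, g i (Function.update S j T i) =
      ∑ i ∈ Finset.univ.erase j, g i (S i) :=
    Finset.sum_congr rfl fun i hi => by rw [Function.update_of_ne (Finset.ne_of_mem_erase hi)]
  omega

theorem exists_isOptimal (hst : Function.Injective (Sum.elim s t)) (hs : ∀ i, s i ∈ D)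
    (ht : ∀ i, t i ∈ D) : ∃ S, IsOptimal G D s t S := by
  have hss : ∀ i j, s i = s j → i = j := fun i j h => Sum.inl.inj (@hst (.inl i) (.inl j) h)
  have htt : ∀ i j, t i = t j → i = j := fun i j h => Sum.inr.inj (@hst (.inr i) (.inr j) h)
  have hst' : ∀ i j, s i ≠ t j := fun i j h => Sum.inl_ne_inr (@hst (.inl i) (.inr j) h)
  have hex : ∃ n, ∃ S, IsState D s t S ∧ cost G s t S = n := by
    refine ⟨_, fun i => {s i, t i}, ⟨fun i => ⟨?_, by simp, by simp⟩, fun i j hij => ?_, ?_⟩, rfl⟩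
    · simp [Finset.insert_subset_iff, hs, ht]
    · refine Finset.disjoint_left.2 fun w hw hw' => ?_
      simp only [Finset.mem_insert, Finset.mem_singleton] at hw hw'
      rcases hw with rfl | rfl <;> rcases hw' with h | h
      exacts [hij (hss _ _ h), hst' _ _ h, hst' _ _ h.symm, hij (htt _ _ h)]
    · refine (Finset.sum_le_card_nsmul _ _ 2 fun i _ => Finset.card_le_two).trans ?_
      simp; omega
  obtain ⟨S, hS, hc⟩ := Nat.find_spec hex
  exact ⟨S, hS, fun S' hS' => hc ▸ Nat.find_min' hex ⟨S', hS', rfl⟩⟩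

theorem IsState.update (h : IsState D s t S) {j : Fin k} {T : Finset V} (hsT : s j ∈ T) (htT : t j ∈ T)
    (hT : T ⊆ S j ∪ rest D S) (hc : ∑ i, (S i).card + T.card ≤ 6 * k + (S j).card) :
    IsState D s t (Function.update S j T) := by
  have hdis : ∀ i, i ≠ j → Disjoint T (S i) := fun i hij => by
    refine Finset.disjoint_left.2 fun w hw hw' => ?_
    rcases Finset.mem_union.1 (hT hw) with h' | h'
    · exact Finset.disjoint_left.1 (h.2.1 i j hij) hw' h'
    · exact (mem_rest.1 h').2 i hw'
  refine ⟨fun i => ?_, fun i i' hii' => ?_, ?_⟩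
  · by_cases hij : i = j
    · subst hij
      rw [Function.update_self]
      refine ⟨fun w hw => ?_, hsT, htT⟩
      rcases Finset.mem_union.1 (hT hw) with h' | h'
      exacts [(h.1 i).1 h', (mem_rest.1 h').1]
    · rw [Function.update_of_ne hij]; exact h.1 i
  · by_cases hij : i = j
    · subst hij
      rw [Function.update_self, Function.update_of_ne hii'.symm]
      exact hdis _ hii'.symm
    · rw [Function.update_of_ne hij]
      by_cases hij' : i' = j
      · subst hij'
        rw [Function.update_self]
        exact (hdis _ hij).symm
      · rw [Function.update_of_ne hij']; exact h.2.1 i i' hii'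
  · have := sum_update (S := S) (fun _ => Finset.card) j T
    omega

theorem cost_update (j : Fin k) (T : Finset V) : cost G s t (Function.update S j T) +
    ((S j).card + if Conn G (S j) (s j) (t j) then 0 else 6 * k + 1) =
    cost G s t S + (T.card + if Conn G T (s j) (t j) then 0 else 6 * k + 1) :=
  sum_update (fun i A => A.card + if Conn G A (s i) (t i) then 0 else 6 * k + 1) j T

namespace IsOptimal

/-- Otherwise replacing `S j` by `T` lowers the total size without disconnecting a pair. -/
theorem card_le (h : IsOptimal G D s t S) {j : Fin k} {T : Finset V}
    (hsT : s j ∈ T) (htT : t j ∈ T) (hT : T ⊆ S j ∪ rest D S) (hTc : Conn G T (s j) (t j)) :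
    (S j).card ≤ T.card := by
  by_contra hlt
  have h1 := h.2 _ (h.1.update hsT htT hT (by have := h.1.2.2; omega))
  have h2 := cost_update (G := G) (s := s) (t := t) (S := S) j T
  rw [if_pos hTc] at h2
  omega

/-- The penalty 6k + 1 exceeds every admissible total size, so connecting one more pair always
lowers the cost. Hence any set that would connect pair `j` must violate the size bound 6k. -/
theorem sum_lt (h : IsOptimal G D s t S) {j : Fin k} (hj : ¬ Conn G (S j) (s j) (t j)) {T : Finset V}
    (hsT : s j ∈ T) (htT : t j ∈ T) (hT : T ⊆ S j ∪ rest D S) (hTc : Conn G T (s j) (t j)) :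
    6 * k + (S j).card < ∑ i, (S i).card + T.card := by
  by_contra hlt
  have h1 := h.2 _ (h.1.update hsT htT hT (by omega))
  have h2 := cost_update (G := G) (s := s) (t := t) (S := S) j T
  rw [if_pos hTc, if_neg hj] at h2
  have h3 : (S j).card ≤ ∑ i, (S i).card :=
    Finset.single_le_sum (f := fun i => (S i).card) (fun _ _ => Nat.zero_le _) (Finset.mem_univ j)
  omega

theorem card_eq_two (h : IsOptimal G D s t S) {j : Fin k} (hj : ¬ Conn G (S j) (s j) (t j)) :
    (S j).card = 2 := by
  have hne : s j ≠ t j := fun h' => hj (h' ▸ Conn.rfl)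
  have hsub : ({s j, t j} : Finset V) ⊆ S j := by
    simp [Finset.insert_subset_iff, (h.1.1 j).2.1, (h.1.1 j).2.2]
  have h0 := Finset.card_le_card hsub
  rw [Finset.card_pair hne] at h0
  have h1 := h.2 _ (h.1.update (j := j) (T := {s j, t j}) (by simp) (by simp)
    (hsub.trans Finset.subset_union_left) (by rw [Finset.card_pair hne]; have := h.1.2.2; omega))
  have h2 := cost_update (G := G) (s := s) (t := t) (S := S) j {s j, t j}
  rw [if_neg hj, if_neg (fun h' => hj (h'.mono hsub)), Finset.card_pair hne] at h2
  omega

/-- An exchange at equal size cannot raise the cost, so it stays optimal; this is used to trade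
which vertices remain unused. -/
theorem swap (h : IsOptimal G D s t S) {j : Fin k} {T : Finset V}
    (hsT : s j ∈ T) (htT : t j ∈ T) (hT : T ⊆ S j ∪ rest D S) (hTc : Conn G T (s j) (t j))
    (hc : T.card = (S j).card) : IsOptimal G D s t (Function.update S j T) := by
  refine ⟨h.1.update hsT htT hT (by have := h.1.2.2; omega), fun S' hS' => le_trans ?_ (h.2 S' hS')⟩
  have h2 := cost_update (G := G) (s := s) (t := t) (S := S) j T
  rw [if_pos hTc] at h2
  omega

/-- In an optimal state a connected set is the vertex set of a path. -/
theorem exists_path (h : IsOptimal G D s t S) {j : Fin k} (hj : Conn G (S j) (s j) (t j)) :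
    ∃ (L : ℕ) (u : ℕ → V), (∀ v, v ∈ S j ↔ ∃ a ≤ L, u a = v) ∧
      (∀ a ≤ L, ∀ b ≤ L, u a = u b → a = b) ∧ u 0 = s j ∧ u L = t j ∧
      (∀ a < L, G.Adj (u a) (u (a + 1))) := by
  obtain ⟨p, hp, hpS⟩ := hj.exists_walk (h.1.1 j).2.1
  have hsub : p.support.toFinset ⊆ S j := fun x hx => hpS x (List.mem_toFinset.1 hx)
  have hle := h.card_le (T := p.support.toFinset) (by simp) (by simp)
    (hsub.trans Finset.subset_union_left) (Conn.of_walk p fun x hx => by simpa using hx)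
  have heq := Finset.eq_of_subset_of_card_le hsub hle
  refine ⟨p.length, p.getVert, fun v => ?_, fun a ha b hb hab => hp.getVert_injOn ha hb hab, by simp,
    by simp, fun a ha => p.adj_getVert_succ ha⟩
  rw [← heq, List.mem_toFinset, SimpleGraph.Walk.mem_support_iff_exists_getVert]
  constructor
  · rintro ⟨n, h1, h2⟩; exact ⟨n, h2, h1⟩
  · rintro ⟨n, h1, h2⟩; exact ⟨n, h2, h1⟩

end IsOptimal

theorem conn_of_seq {T : Finset V} {u : ℕ → V} {a b : ℕ} (hab : a ≤ b)
    (hT : ∀ c, a ≤ c → c ≤ b → u c ∈ T) (hadj : ∀ c, a ≤ c → c < b → G.Adj (u c) (u (c + 1))) :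
    Conn G T (u a) (u b) := by
  induction b, hab using Nat.le_induction with
  | base => rfl
  | succ b hab ih =>
    exact (ih (fun c h1 h2 => hT c h1 (by omega)) fun c h1 h2 => hadj c h1 (by omega)).trans
      (Conn.of_adj (hadj b hab (by omega)) (hT _ hab (by omega)) (hT _ (by omega) le_rfl))

theorem card_seq {A : Finset V} {u : ℕ → V} {L : ℕ} (hA : ∀ v, v ∈ A ↔ ∃ a ≤ L, u a = v)
    (hu : ∀ a ≤ L, ∀ b ≤ L, u a = u b → a = b) : A.card = L + 1 := by
  have : A = (Finset.range (L + 1)).image u := by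
    ext v; rw [hA]; simp
  rw [this, Finset.card_image_of_injOn, Finset.card_range]
  intro a ha b hb hab
  simp only [Finset.coe_range, Set.mem_Iio] at ha hb
  exact hu a (by omega) b (by omega) hab

namespace IsOptimal

/-- Otherwise the detour through `x` would be a shorter connection, against `card_le`. -/
theorem window (h : IsOptimal G D s t S) {j : Fin k} {L : ℕ} {u : ℕ → V}
    (hu : ∀ v, v ∈ S j ↔ ∃ a ≤ L, u a = v) (hui : ∀ a ≤ L, ∀ b ≤ L, u a = u b → a = b)
    (hu0 : u 0 = s j) (huL : u L = t j) (hadj : ∀ a < L, G.Adj (u a) (u (a + 1))) {x : V}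
    (hx : x ∈ rest D S) {a b : ℕ} (hb : b ≤ L) (hxa : G.Adj x (u a))
    (hxb : G.Adj x (u b)) : b ≤ a + 2 := by
  by_contra hlt
  set T : Finset V := insert x ((Finset.range (a + 1)).image u ∪ (Finset.Icc b L).image u) with hT
  have hTa : ∀ c ≤ a, u c ∈ T := fun c hc => by
    rw [hT]
    refine Finset.mem_insert_of_mem (Finset.mem_union_left _ (Finset.mem_image_of_mem _ ?_))
    simp; omega
  have hTb : ∀ c, b ≤ c → c ≤ L → u c ∈ T := fun c hc hc' => by
    rw [hT]
    refine Finset.mem_insert_of_mem (Finset.mem_union_right _ (Finset.mem_image_of_mem _ ?_))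
    simp; omega
  have hTx : x ∈ T := Finset.mem_insert_self _ _
  have h1 := h.card_le (j := j) (T := T) (hu0 ▸ hTa 0 (by omega)) (huL ▸ hTb L hb le_rfl) (by
    intro v hv
    rcases Finset.mem_insert.1 hv with rfl | hv
    · exact Finset.mem_union_right _ hx
    refine Finset.mem_union_left _ ((hu v).2 ?_)
    rcases Finset.mem_union.1 hv with hv | hv <;> obtain ⟨c, hc, rfl⟩ := Finset.mem_image.1 hv
    · exact ⟨c, by simp at hc; omega, rfl⟩
    · exact ⟨c, by simp at hc; omega, rfl⟩) (by
    rw [← hu0, ← huL]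
    refine (conn_of_seq (Nat.zero_le a) (fun c _ hc => hTa c hc) fun c _ hc =>
      hadj c (by omega)).trans ?_
    refine (Conn.of_adj hxa hTx (hTa a le_rfl)).symm.trans ?_
    refine (Conn.of_adj hxb hTx (hTb b le_rfl hb)).trans ?_
    exact conn_of_seq hb hTb fun c _ hc => hadj c hc)
  rw [card_seq hu hui] at h1
  have h2 : T.card ≤ ((a + 1) + (L + 1 - b)) + 1 := by
    refine (Finset.card_insert_le _ _).trans (Nat.add_le_add_right ?_ _)
    refine (Finset.card_union_le _ _).trans (Nat.add_le_add ?_ ?_)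
    · exact Finset.card_image_le.trans (by simp)
    · exact Finset.card_image_le.trans (by simp)
  omega

/-- By `window` the neighbours of `x` on the path lie within three consecutive vertices. -/
theorem sees (h : IsOptimal G D s t S) {j : Fin k} {L : ℕ} {u : ℕ → V}
    (hu : ∀ v, v ∈ S j ↔ ∃ a ≤ L, u a = v) (hui : ∀ a ≤ L, ∀ b ≤ L, u a = u b → a = b)
    (hu0 : u 0 = s j) (huL : u L = t j) (hadj : ∀ a < L, G.Adj (u a) (u (a + 1))) {x : V}
    (hx : x ∈ rest D S) : (nb G (S j) x).card ≤ 3 ∧ (3 ≤ (nb G (S j) x).card →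
      ∃ a, a + 2 ≤ L ∧ G.Adj x (u a) ∧ G.Adj x (u (a + 1)) ∧ G.Adj x (u (a + 2))) := by
  by_cases hex : ∃ a, a ≤ L ∧ G.Adj x (u a)
  swap
  · have : nb G (S j) x = ∅ := Finset.eq_empty_of_forall_notMem fun v hv => by
      obtain ⟨hv, hxv⟩ := mem_nb.1 hv
      obtain ⟨a, ha, rfl⟩ := (hu v).1 hv
      exact hex ⟨a, ha, hxv⟩
    simp [this]
  obtain ⟨haL, hxa⟩ := Nat.find_spec hex
  have hmin : ∀ b ≤ L, G.Adj x (u b) → Nat.find hex ≤ b := fun b hb hxb => Nat.find_min' hex ⟨hb, hxb⟩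
  generalize Nat.find hex = a at haL hxa hmin
  have hsub : nb G (S j) x ⊆ (Finset.Icc a (a + 2)).image u := fun v hv => by
    obtain ⟨hv, hxv⟩ := mem_nb.1 hv
    obtain ⟨b, hb, rfl⟩ := (hu v).1 hv
    have h1 := hmin b hb hxv
    exact Finset.mem_image_of_mem _
      (Finset.mem_Icc.2 ⟨h1, h.window hu hui hu0 huL hadj hx hb hxa hxv⟩)
  have hc : ((Finset.Icc a (a + 2)).image u).card ≤ 3 := Finset.card_image_le.trans (by simp; omega)
  refine ⟨(Finset.card_le_card hsub).trans hc, fun h3 => ?_⟩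
  have heq := Finset.eq_of_subset_of_card_le hsub (hc.trans h3)
  have hmem : ∀ c, a ≤ c → c ≤ a + 2 → u c ∈ nb G (S j) x := fun c h1 h2 =>
    heq ▸ Finset.mem_image_of_mem _ (Finset.mem_Icc.2 ⟨h1, h2⟩)
  refine ⟨a, ?_, hxa, (mem_nb.1 (hmem _ (by omega) (by omega))).2,
    (mem_nb.1 (hmem _ (by omega) (by omega))).2⟩
  by_contra hlt
  have h4 : nb G (S j) x ⊆ (Finset.Icc a L).image u := fun v hv => by
    obtain ⟨hv, hxv⟩ := mem_nb.1 hv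
    obtain ⟨b, hb, rfl⟩ := (hu v).1 hv
    exact Finset.mem_image_of_mem _ (Finset.mem_Icc.2 ⟨hmin b hb hxv, hb⟩)
  have h5 := (Finset.card_le_card h4).trans Finset.card_image_le
  rw [Nat.card_Icc] at h5
  omega

theorem nb_card_le (h : IsOptimal G D s t S) (j : Fin k) {x : V} (hx : x ∈ rest D S) :
    (nb G (S j) x).card ≤ 3 := by
  by_cases hj : Conn G (S j) (s j) (t j)
  · obtain ⟨L, u, h1, h2, h3, h4, h5⟩ := h.exists_path hj
    exact (h.sees h1 h2 h3 h4 h5 hx).1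
  · exact (Finset.card_le_card (Finset.filter_subset _ _)).trans (by rw [h.card_eq_two hj]; omega)

theorem two_le_card (h : IsOptimal G D s t S) (hst : ∀ i, s i ≠ t i) (j : Fin k) :
    2 ≤ (S j).card := by
  rw [← Finset.card_pair (hst j)]
  exact Finset.card_le_card (by simp [Finset.insert_subset_iff, (h.1.1 j).2.1, (h.1.1 j).2.2])

/-- A vertex seeing three vertices of a short connected set can replace one that is seen by all
such vertices. -/
theorem exists_center (h : IsOptimal G D s t S) {j : Fin k} (hj : (S j).card ≤ 4) {x : V}
    (hx : x ∈ rest D S) (hx3 : 3 ≤ (nb G (S j) x).card) :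
    ∃ m ∈ S j, (∀ z ∈ rest D S, 3 ≤ (nb G (S j) z).card → G.Adj z m) ∧
      IsOptimal G D s t (Function.update S j (insert x ((S j).erase m))) := by
  have hjc : Conn G (S j) (s j) (t j) := by
    by_contra hno
    have := Finset.card_le_card (Finset.filter_subset (G.Adj x) (S j))
    rw [h.card_eq_two hno] at this
    exact absurd hx3 (by unfold nb; omega)
  obtain ⟨L, u, h1, h2, h3, h4, h5⟩ := h.exists_path hjc
  have hL := card_seq h1 h2
  obtain ⟨a, haL, hxa, hxa1, hxa2⟩ := (h.sees h1 h2 h3 h4 h5 hx).2 hx3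
  have huS : ∀ c ≤ L, u c ∈ S j := fun c hc => (h1 _).2 ⟨c, hc, rfl⟩
  have hT : ∀ c ≤ L, c ≠ a + 1 → u c ∈ insert x ((S j).erase (u (a + 1))) := fun c hc hne =>
    Finset.mem_insert_of_mem (Finset.mem_erase.2 ⟨fun h' => hne (h2 _ hc _ (by omega) h'), huS c hc⟩)
  refine ⟨u (a + 1), huS _ (by omega), fun z hz hz3 => ?_, h.swap ?_ ?_ ?_ ?_ ?_⟩
  · obtain ⟨b, hbL, hzb, hzb1, hzb2⟩ := (h.sees h1 h2 h3 h4 h5 hz).2 hz3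
    -- On a path with at most four vertices every run of three consecutive vertices contains all the
    -- middle ones.
    have : a + 1 = b ∨ a + 1 = b + 1 ∨ a + 1 = b + 2 := by omega
    rcases this with h | h | h <;> rw [h] <;> assumption
  · rw [← h3]; exact hT 0 (by omega) (by omega)
  · rw [← h4]; exact hT L le_rfl (by omega)
  · refine Finset.insert_subset (Finset.mem_union_right _ hx) ?_
    exact (Finset.erase_subset _ _).trans Finset.subset_union_left
  · rw [← h3, ← h4]
    refine (conn_of_seq (Nat.zero_le a) (fun c _ hc => hT c (by omega) (by omega)) fun c _ hc =>
      h5 c (by omega)).trans ?_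
    refine (Conn.of_adj hxa (by simp) (hT a (by omega) (by omega))).symm.trans ?_
    refine (Conn.of_adj hxa2 (by simp) (hT (a + 2) (by omega) (by omega))).trans ?_
    exact conn_of_seq haL (fun c hc hc' => hT c hc' (by omega)) fun c _ hc => h5 c hc
  · rw [Finset.card_insert_of_notMem, Finset.card_erase_add_one (huS _ (by omega))]
    exact fun h' => (mem_rest.1 hx).2 j (Finset.mem_of_mem_erase h')

end IsOptimal

end State

end ParityLinkage
end

section
open scoped Classical
namespace ParityLinkage

/-! ### A non-linking optimal state exposes a very dense part. -/

section State
variable {V : Type*} {G : SimpleGraph V} {k : ℕ} {D : Finset V} {s t : Fin k → V}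
  {S : Fin k → Finset V}

theorem IsState.card_nb (h : IsState D s t S) (x : V) :
    (nb G D x).card = (nb G (rest D S) x).card + ∑ i, (nb G (S i) x).card := by
  have h1 : nb G D x = nb G (rest D S) x ∪ Finset.univ.biUnion fun i => nb G (S i) x := by
    ext w
    simp only [mem_nb, Finset.mem_union, mem_rest, Finset.mem_biUnion, Finset.mem_univ, true_and]
    constructor
    · rintro ⟨hw, hxw⟩
      by_cases hex : ∃ i, w ∈ S i
      · obtain ⟨i, hi⟩ := hex
        exact Or.inr ⟨i, hi, hxw⟩
      · exact Or.inl ⟨⟨hw, fun i hi => hex ⟨i, hi⟩⟩, hxw⟩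
    · rintro (⟨⟨hw, -⟩, hxw⟩ | ⟨i, hi, hxw⟩)
      exacts [⟨hw, hxw⟩, ⟨(h.1 i).1 hi, hxw⟩]
  rw [h1, Finset.card_union_of_disjoint, Finset.card_biUnion]
  · intro i _ j _ hij
    exact (h.2.1 i j hij).mono (Finset.filter_subset _ _) (Finset.filter_subset _ _)
  · refine Finset.disjoint_left.2 fun w hw hw' => ?_
    obtain ⟨i, -, hi⟩ := Finset.mem_biUnion.1 hw'
    exact (mem_rest.1 (mem_nb.1 hw).1).2 i (mem_nb.1 hi).1

theorem IsState.card_eq (h : IsState D s t S) : D.card = (rest D S).card + ∑ i, (S i).card := by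
  have hsub : Finset.univ.biUnion S ⊆ D := Finset.biUnion_subset.2 fun i _ => (h.1 i).1
  rw [← Finset.card_biUnion fun i _ j _ hij => h.2.1 i j hij]
  exact (Finset.card_sdiff_add_card_eq_card hsub).symm

theorem sum_add_le_of_le {f g : Fin k → ℕ} (j : Fin k) {c : ℕ} (h : ∀ i, i ≠ j → f i ≤ g i)
    (hj : f j + c ≤ g j) : ∑ i, f i + c ≤ ∑ i, g i := by
  rw [← Finset.add_sum_erase _ _ (Finset.mem_univ j), ← Finset.add_sum_erase _ g (Finset.mem_univ j)]
  have := Finset.sum_le_sum (s := Finset.univ.erase j) (f := f) (g := g) fun i hi =>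
    h i (Finset.ne_of_mem_erase hi)
  omega

namespace IsOptimal

/-- Three vertices outside the state are not pairwise far apart. -/
theorem not_far₃ (h : IsOptimal G D s t S) (hD : D.card ≤ 12 * k)
    (hdeg : ∀ v ∈ D, 6 * k ≤ (nb G D v).card) (hst : ∀ i, s i ≠ t i) {j : Fin k}
    (hj : ¬ Conn G (S j) (s j) (t j)) {Y : Finset V} (hY : Y ⊆ rest D S) (hYc : Y.card ≤ 2)
    {a b c : V} (ha : a ∈ rest D S \ Y) (hb : b ∈ rest D S \ Y) (hc : c ∈ rest D S \ Y)
    (h1 : Far G (rest D S \ Y) a b) (h2 : Far G (rest D S \ Y) a c)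
    (h3 : Far G (rest D S \ Y) b c) : False := by
  have key := Far.card_le₃ ha hb hc h1 h2 h3
  have hF := Finset.card_sdiff_add_card_eq_card hY
  have hDc := h.1.card_eq
  have hnb : ∀ x ∈ rest D S \ Y, x ∈ rest D S ∧
      6 * k ≤ (nb G (rest D S \ Y) x).card + Y.card + ∑ i, (nb G (S i) x).card := fun x hx => by
    have hx' := (Finset.mem_sdiff.1 hx).1
    have e1 := hdeg x (mem_rest.1 hx').1
    rw [h.1.card_nb] at e1
    have e2 : (nb G (rest D S) x).card ≤ (nb G (rest D S \ Y) x).card + Y.card := by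
      refine le_trans (Finset.card_le_card fun w hw => ?_) (Finset.card_union_le _ _)
      simp only [mem_nb, Finset.mem_union, Finset.mem_sdiff] at hw ⊢
      tauto
    exact ⟨hx', by omega⟩
  obtain ⟨ha, ha'⟩ := hnb a ha
  obtain ⟨hb, hb'⟩ := hnb b hb
  obtain ⟨hc, hc'⟩ := hnb c hc
  have hle : ∀ i x, (nb G (S i) x).card ≤ (S i).card := fun i x =>
    Finset.card_le_card (Finset.filter_subset _ _)
  -- Three outside vertices together see at most 3 min(3, |S i|) ≤ 6 + |S i| times a vertex of `S
  -- i`, and two less than this bound for `j`, where |S j| = 2. With disjoint closed neighbourhoods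
  -- the count then exceeds |D| ≤ 12k, and the excess tolerates the loss of two vertices in `Y`.
  have hsum := sum_add_le_of_le (f := fun i => (nb G (S i) a).card + (nb G (S i) b).card +
    (nb G (S i) c).card) (g := fun i => 6 + (S i).card) j (c := 2) (fun i _ => by
      have e1 := h.nb_card_le i ha
      have e2 := h.nb_card_le i hb
      have e3 := h.nb_card_le i hc
      have e4 := hle i a
      have e5 := hle i b
      have e6 := hle i c
      have e7 := h.two_le_card hst i
      omega) (by
      have e4 := hle j a
      have e5 := hle j b
      have e6 := hle j c
      have e7 := h.card_eq_two hj
      omega)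
  simp only [Finset.sum_add_distrib, Finset.sum_const, Finset.card_univ, Fintype.card_fin,
    smul_eq_mul] at hsum
  omega

/-- Two disjoint closed neighbourhoods outside the state need room, which forces the state to be
small. The number `e` measures how far below three the neighbour counts in `S j` stay. -/
theorem not_far₂ (h : IsOptimal G D s t S) (hD : D.card ≤ 12 * k)
    (hdeg : ∀ v ∈ D, 6 * k ≤ (nb G D v).card) {j : Fin k} {e : ℕ}
    (hj : ∀ x ∈ rest D S, (nb G (S j) x).card + e ≤ 3)
    {a b : V} (ha : a ∈ rest D S) (hb : b ∈ rest D S)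
    (h1 : Far G (rest D S) a b) : ∑ i, (S i).card + 2 + 2 * e ≤ 6 * k := by
  have key := h1.card_le ha hb
  have hDc := h.1.card_eq
  have ha' := hdeg a (mem_rest.1 ha).1
  have hb' := hdeg b (mem_rest.1 hb).1
  rw [h.1.card_nb] at ha' hb'
  have hsum := sum_add_le_of_le (f := fun i => (nb G (S i) a).card + (nb G (S i) b).card)
    (g := fun i => 6) j (c := 2 * e) (fun i _ => by
      have e1 := h.nb_card_le i ha
      have e2 := h.nb_card_le i hb
      omega) (by
      have e4 := hj a ha
      have e5 := hj b hb
      omega)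
  simp only [Finset.sum_add_distrib, Finset.sum_const, Finset.card_univ, Fintype.card_fin,
    smul_eq_mul] at hsum
  omega

/-- The state has at most 6k vertices, one of which is `v`, so it cannot contain 6k neighbours of
`v`. -/
theorem exists_nb_rest (h : IsOptimal G D s t S) (hdeg : ∀ v ∈ D, 6 * k ≤ (nb G D v).card) {v : V}
    {i : Fin k} (hv : v ∈ S i) : ∃ x ∈ rest D S, G.Adj v x := by
  by_contra hno
  push Not at hno
  have h1 := hdeg v ((h.1.1 i).1 hv)
  have h2 : (nb G (rest D S) v).card = 0 := by
    rw [Finset.card_eq_zero]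
    exact Finset.eq_empty_of_forall_notMem fun w hw => hno w (mem_nb.1 hw).1 (mem_nb.1 hw).2
  rw [h.1.card_nb, h2] at h1
  have h3 := sum_add_le_of_le (f := fun i => (nb G (S i) v).card) (g := fun i => (S i).card) i (c := 1)
    (fun i _ => Finset.card_le_card (Finset.filter_subset _ _)) (by
      rw [← Finset.card_erase_add_one hv]
      refine Nat.add_le_add_right (Finset.card_le_card fun w hw => ?_) _
      exact Finset.mem_erase.2 ⟨(mem_nb.1 hw).2.ne', (mem_nb.1 hw).1⟩)
  have := h.1.2.2
  omega

theorem join_conn {i : Fin k} {x y : V} {T : Finset V} (hsx : G.Adj (s i) x) (hty : G.Adj (t i) y)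
    (hx : x ∈ T) (hy : y ∈ T) (hT : Conn G T x y) : Conn G ({s i, t i} ∪ T) (s i) (t i) := by
  have hx' : x ∈ ({s i, t i} ∪ T : Finset V) := Finset.mem_union_right _ hx
  have hy' : y ∈ ({s i, t i} ∪ T : Finset V) := Finset.mem_union_right _ hy
  exact (Conn.of_adj hsx (by simp) hx').trans ((hT.mono Finset.subset_union_right).trans
    (Conn.of_adj hty (by simp) hy').symm)

theorem join_subset (h : IsOptimal G D s t S) (i : Fin k) {T : Finset V} (hT : T ⊆ rest D S) :
    {s i, t i} ∪ T ⊆ S i ∪ rest D S :=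
  Finset.union_subset_union (by simp [Finset.insert_subset_iff, (h.1.1 i).2.1, (h.1.1 i).2.2]) hT

theorem join_card (i : Fin k) {T : Finset V} {n : ℕ} (hT : T.card ≤ n) :
    (({s i, t i} : Finset V) ∪ T).card ≤ 2 + n :=
  (Finset.card_union_le _ _).trans (Nat.add_le_add Finset.card_le_two hT)

/-- The vertices outside an optimal state do not induce a connected graph. -/
theorem not_connected (h : IsOptimal G D s t S) (hD : D.card ≤ 12 * k)
    (hdeg : ∀ v ∈ D, 6 * k ≤ (nb G D v).card) (hst : ∀ i, s i ≠ t i) {j : Fin k}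
    (hj : ¬ Conn G (S j) (s j) (t j)) {r : V} (hr : ∀ a ∈ rest D S, Conn G (rest D S) r a) :
    False := by
  have hj2 := h.card_eq_two hj
  -- For a large state `not_far₂` excludes far pairs outside, so every `S i` could be rerouted
  -- outside with at most five vertices; the total is then at most 5k - 3, too little. A smaller
  -- state leaves room to connect pair `j` through the outside.
  by_cases hW : 6 * k ≤ ∑ i, (S i).card + 2
  · have hfar : ∀ a ∈ rest D S, ∀ b ∈ rest D S, ¬ Far G (rest D S) a b := fun a ha b hb hab => by
      have := h.not_far₂ hD hdeg (j := j) (e := 1) (fun x _ => by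
        have := Finset.card_le_card (Finset.filter_subset (G.Adj x) (S j))
        unfold nb; omega) ha hb hab
      omega
    have h5 : ∀ i, (S i).card ≤ 5 := fun i => by
      obtain ⟨x, hx, hsx⟩ := h.exists_nb_rest hdeg (h.1.1 i).2.1
      obtain ⟨y, hy, hty⟩ := h.exists_nb_rest hdeg (h.1.1 i).2.2
      obtain ⟨T, hT, hxT, hyT, hTc, hTx⟩ := exists_conn_of_not_far hx hy (hfar x hx y hy)
      exact (h.card_le (j := i) (by simp) (by simp) (h.join_subset i hT)
        (join_conn hsx hty hxT hyT hTx)).trans (join_card i hTc)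
    have h6 := Finset.sum_le_card_nsmul Finset.univ (fun i => (S i).card) 5 fun i _ => h5 i
    simp only [Finset.card_univ, Fintype.card_fin, smul_eq_mul] at h6
    have h7 := sum_add_le_of_le (f := fun i => (S i).card) (g := fun _ => 5) j (c := 3)
      (fun i _ => h5 i) (by omega)
    simp only [Finset.sum_const, Finset.card_univ, Fintype.card_fin, smul_eq_mul] at h7
    have := j.pos
    omega
  · obtain ⟨x, hx, hsx⟩ := h.exists_nb_rest hdeg (h.1.1 j).2.1
    obtain ⟨y, hy, hty⟩ := h.exists_nb_rest hdeg (h.1.1 j).2.2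
    have hlong : ∀ x ∈ rest D S, ∀ y ∈ rest D S, G.Adj (s j) x → G.Adj (t j) y →
        ∀ T ⊆ rest D S, x ∈ T → y ∈ T → Conn G T x y → ∀ n, T.card ≤ n →
        6 * k < ∑ i, (S i).card + n := by
      intro x hx y hy hsx hty T hT hxT hyT hTx n hn
      have h1 := h.sum_lt hj (by simp) (by simp) (h.join_subset j hT) (join_conn hsx hty hxT hyT hTx)
      have h2 := join_card (s := s) (t := t) j hn
      omega
    have hfar : ∀ x ∈ rest D S, ∀ y ∈ rest D S, G.Adj (s j) x → G.Adj (t j) y →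
        Far G (rest D S) x y := by
      intro x hx y hy hsx hty
      by_contra hno
      obtain ⟨T, hT, hxT, hyT, hTc, hTx⟩ := exists_conn_of_not_far hx hy hno
      have := hlong x hx y hy hsx hty T hT hxT hyT hTx 3 hTc
      omega
    have hxy := hfar x hx y hy hsx hty
    have hSj : S j = {s j, t j} := by
      refine (Finset.eq_of_subset_of_card_le ?_ ?_).symm
      · simp [Finset.insert_subset_iff, (h.1.1 j).2.1, (h.1.1 j).2.2]
      · rw [Finset.card_pair (hst j), hj2]
    -- An outside vertex adjacent to both `s j` and `t j` would be far from itself, so each sees at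
    -- most one of them. With `e = 2` this leaves room for six more vertices.
    have hsmall := h.not_far₂ hD hdeg (j := j) (e := 2) (fun z hz => by
      suffices (nb G (S j) z).card ≤ 1 by omega
      refine Finset.card_le_one.2 fun a ha b hb => ?_
      rw [hSj] at ha hb
      simp only [mem_nb, Finset.mem_insert, Finset.mem_singleton] at ha hb
      rcases ha with ⟨rfl | rfl, ha⟩ <;> rcases hb with ⟨rfl | rfl, hb⟩
      · rfl
      · exact absurd rfl (hfar z hz z hz ha.symm hb.symm).1
      · exact absurd rfl (hfar z hz z hz hb.symm ha.symm).1
      · rfl) hx hy hxy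
    -- the first step leaving the ball of radius two around `x`
    have hcross : ∃ z ∈ rest D S, ∃ z' ∈ rest D S, G.Adj z z' ∧ ¬ Far G (rest D S) x z ∧
        Far G (rest D S) x z' := by
      by_contra hno
      push Not at hno
      have := ((hr x hx).symm.trans (hr y hy)).closed (fun z => ¬ Far G (rest D S) x z)
        (fun hf => hf.1 rfl) fun u v hu huv huS hvS => hno u huS v hvS huv hu
      exact this hxy
    obtain ⟨z, hz, z', hz', hzz', hxz, hxz'⟩ := hcross
    -- As `x`, `z'`, `y` are not pairwise far, `z'` is within distance two of `y`. The connection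
    -- from `x` to `y` through `z` and `z'` then has at most six vertices.
    have hz'y : ¬ Far G (rest D S) z' y := fun hf => by
      refine h.not_far₃ hD hdeg hst hj (Y := ∅) (by simp) (by simp) (a := x) (b := z') (c := y)
        ?_ ?_ ?_ ?_ ?_ ?_ <;> rw [Finset.sdiff_empty] <;> assumption
    obtain ⟨T, hT, hxT, hzT, hTc, hTx⟩ := exists_conn_of_not_far hx hz hxz
    obtain ⟨T', hT', hzT', hyT', hTc', hTy⟩ := exists_conn_of_not_far hz' hy hz'y
    have := hlong x hx y hy hsx hty (T ∪ T') (Finset.union_subset hT hT')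
      (Finset.mem_union_left _ hxT) (Finset.mem_union_right _ hyT')
      ((hTx.mono Finset.subset_union_left).trans ((Conn.of_adj hzz' (Finset.mem_union_left _ hzT)
        (Finset.mem_union_right _ hzT')).trans (hTy.mono Finset.subset_union_right))) 6
      ((Finset.card_union_le _ _).trans (by omega))
    omega

/-- Suppose `x ≠ z` on one side and `y` on the other all see three vertices of `S i`. Exchanging `x`
for the centre `m` releases `m`, which is adjacent to `z` and `y`. By `not_far₃` every remaining
vertex of either side is within distance two of `z` or `y`, so the unused vertices of the new
optimal state are connected, against `not_connected`. -/
theorem unique_seer (h : IsOptimal G D s t S) (hD : D.card ≤ 12 * k)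
    (hdeg : ∀ v ∈ D, 6 * k ≤ (nb G D v).card) (hst : ∀ i, s i ≠ t i) {j : Fin k}
    (hj : ¬ Conn G (S j) (s j) (t j)) {C₁ C₂ : Finset V} (hC : C₁ ∪ C₂ = rest D S)
    (hdis : Disjoint C₁ C₂) (hno : ∀ a ∈ C₁, ∀ b ∈ C₂, ¬ G.Adj a b) {i : Fin k}
    (hi : (S i).card ≤ 4) {x z y : V} (hx : x ∈ C₁) (hz : z ∈ C₁) (hy : y ∈ C₂)
    (hx3 : 3 ≤ (nb G (S i) x).card) (hz3 : 3 ≤ (nb G (S i) z).card)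
    (hy3 : 3 ≤ (nb G (S i) y).card) : x = z := by
  by_contra hxz
  have hC₁ : C₁ ⊆ rest D S := hC ▸ Finset.subset_union_left
  have hC₂ : C₂ ⊆ rest D S := hC ▸ Finset.subset_union_right
  obtain ⟨m, hmS, hm, hopt⟩ := h.exists_center hi (hC₁ hx) hx3
  set T := insert x ((S i).erase m) with hT
  have hij : i ≠ j := by
    rintro rfl
    have := Finset.card_le_card (Finset.filter_subset (G.Adj x) (S i))
    rw [h.card_eq_two hj] at this
    exact absurd hx3 (by unfold nb; omega)
  have hj' : ¬ Conn G (Function.update S i T j) (s j) (t j) := by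
    rwa [Function.update_of_ne hij.symm]
  have hrest : ∀ v, v ∈ rest D (Function.update S i T) ↔ v = m ∨ (v ∈ rest D S ∧ v ≠ x) := by
    intro v
    rw [mem_rest]
    constructor
    · rintro ⟨hv, hvS⟩
      by_cases hvm : v = m
      · exact Or.inl hvm
      right
      have h1 := hvS i
      rw [Function.update_self] at h1
      refine ⟨mem_rest.2 ⟨hv, fun i' hi' => ?_⟩, fun h' => h1 (h' ▸ by simp [hT])⟩
      by_cases hii : i' = i
      · subst hii
        exact h1 (Finset.mem_insert_of_mem (Finset.mem_erase.2 ⟨hvm, hi'⟩))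
      · have := hvS i'
        rw [Function.update_of_ne hii] at this
        exact this hi'
    · rintro (rfl | ⟨hv, hvx⟩)
      · refine ⟨(h.1.1 i).1 hmS, fun i' => ?_⟩
        by_cases hii : i' = i
        · subst hii
          rw [Function.update_self, hT]
          simp only [Finset.mem_insert, Finset.mem_erase, not_or, not_and_or, not_not, ne_eq, true_or,
            and_true]
          rintro rfl
          exact (mem_rest.1 (hC₁ hx)).2 _ hmS
        · rw [Function.update_of_ne hii]
          exact fun h' => Finset.disjoint_left.1 (h.1.2.1 i' i hii) h' hmS
      · refine ⟨(mem_rest.1 hv).1, fun i' => ?_⟩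
        by_cases hii : i' = i
        · subst hii
          rw [Function.update_self, hT]
          simp only [Finset.mem_insert, Finset.mem_erase, not_or, not_and_or]
          exact ⟨hvx, Or.inr ((mem_rest.1 hv).2 _)⟩
        · rw [Function.update_of_ne hii]
          exact (mem_rest.1 hv).2 i'
  have hxy : x ≠ y := fun h' => Finset.disjoint_left.1 hdis hx (h' ▸ hy)
  have hzm := hm z (hC₁ hz) hz3
  have hym := hm y (hC₂ hy) hy3
  have hmr : m ∈ rest D (Function.update S i T) := (hrest m).2 (Or.inl rfl)
  have hzr : z ∈ rest D (Function.update S i T) := (hrest z).2 (Or.inr ⟨hC₁ hz, fun h => hxz h.symm⟩)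
  have hyr : y ∈ rest D (Function.update S i T) := (hrest y).2 (Or.inr ⟨hC₂ hy, hxy.symm⟩)
  have hsub : rest D S \ {x} ⊆ rest D (Function.update S i T) := fun v hv => by
    simp only [Finset.mem_sdiff, Finset.mem_singleton] at hv
    exact (hrest v).2 (Or.inr hv)
  have hfar12 : ∀ a ∈ C₁, ∀ b ∈ C₂, Far G (rest D S \ {x}) a b := fun a ha b hb => by
    refine ⟨fun h' => Finset.disjoint_left.1 hdis ha (h' ▸ hb), hno a ha b hb, fun c hc h1 h2 => ?_⟩
    have := (Finset.mem_sdiff.1 hc).1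
    rw [← hC] at this
    rcases Finset.mem_union.1 this with h' | h'
    · exact hno c h' b hb h2.symm
    · exact hno a ha c h' h1
  have hnf : ∀ a b c, a ∈ rest D S → b ∈ rest D S → c ∈ rest D S → a ≠ x → b ≠ x → c ≠ x →
      Far G (rest D S \ {x}) a c → Far G (rest D S \ {x}) b c →
      Conn G (rest D (Function.update S i T)) a b := by
    intro a b c ha hb hc hax hbx hcx hac hbc
    have h1 : ¬ Far G (rest D S \ {x}) a b := fun h' =>
      h.not_far₃ hD hdeg hst hj (Y := {x}) (by simpa using hC₁ hx) (by simp) (a := a) (b := b) (c := c)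
        (by simp [ha, hax]) (by simp [hb, hbx]) (by simp [hc, hcx]) h' hac hbc
    obtain ⟨T', hT', -, -, -, hT'c⟩ := exists_conn_of_not_far (by simp [ha, hax]) (by simp [hb, hbx]) h1
    exact hT'c.mono (hT'.trans hsub)
  refine hopt.not_connected hD hdeg hst hj' (r := m) fun a ha => ?_
  rcases (hrest a).1 ha with rfl | ⟨ha', hax⟩
  · rfl
  · rw [← hC] at ha'
    rcases Finset.mem_union.1 ha' with ha' | ha'
    · exact (Conn.of_adj hzm hzr hmr).symm.trans (hnf z a y (hC₁ hz) (hC₁ ha') (hC₂ hy)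
        (fun h => hxz h.symm) hax hxy.symm (hfar12 z hz y hy) (hfar12 a ha' y hy))
    · exact (Conn.of_adj hym hyr hmr).symm.trans (hnf y a z (hC₂ hy) (hC₂ ha') (hC₁ hz)
        hxy.symm hax (fun h => hxz h.symm) (hfar12 z hz y hy).symm (hfar12 z hz a ha').symm)

/-- Removing the exceptional vertices from one side. -/
theorem exists_side (h : IsOptimal G D s t S) (hdeg : ∀ v ∈ D, 6 * k ≤ (nb G D v).card)
    (hk : 0 < k) {C : Finset V} (hC : C ⊆ rest D S) (hCne : C.Nonempty)
    (hcl : ∀ a ∈ C, ∀ b ∈ rest D S, G.Adj a b → b ∈ C) (Bad : Finset (Fin k))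
    (hBad : ∀ i ∈ Bad, ∀ x ∈ C, ∀ z ∈ C, 3 ≤ (nb G (S i) x).card → 3 ≤ (nb G (S i) z).card → x = z) :
    ∃ C' ⊆ C, ∃ (e : ℕ) (g : Fin k → ℕ), C'.Nonempty ∧ C'.card + e = C.card ∧ e ≤ Bad.card ∧
      (∀ z ∈ C', 6 * k ≤ (nb G C' z).card + ∑ i, g i + e) ∧ (∀ i, 2 ≤ g i ∧ g i ≤ 3) ∧
      (∀ i ∈ Bad, g i = 2) ∧ ∀ i, g i = 3 → ∃ z ∈ C, 3 ≤ (nb G (S i) z).card := by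
  set X := Bad.biUnion fun i => C.filter fun z => 3 ≤ (nb G (S i) z).card with hX
  have hXC : X ⊆ C := Finset.biUnion_subset.2 fun i _ => Finset.filter_subset _ _
  have hXc : X.card ≤ Bad.card := by
    refine Finset.card_biUnion_le.trans ((Finset.sum_le_card_nsmul _ _ 1 fun i hi => ?_).trans (by simp))
    refine Finset.card_le_one.2 fun a ha b hb => ?_
    rw [Finset.mem_filter] at ha hb
    exact hBad i hi a ha.1 b hb.1 ha.2 hb.2
  have hnbC : ∀ z ∈ C, (nb G (rest D S) z).card ≤ (nb G (C \ X) z).card + X.card := fun z hz => by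
    refine le_trans (Finset.card_le_card fun w hw => ?_) (Finset.card_union_le _ _)
    have := hcl z hz w (mem_nb.1 hw).1 (mem_nb.1 hw).2
    simp only [mem_nb, Finset.mem_union, Finset.mem_sdiff] at hw ⊢
    tauto
  have hdegC : ∀ z ∈ C, 6 * k ≤ (nb G (C \ X) z).card + X.card + ∑ i, (nb G (S i) z).card :=
    fun z hz => by
      have h1 := hdeg z (mem_rest.1 (hC hz)).1
      rw [h.1.card_nb] at h1
      have := hnbC z hz
      omega
  have hBk : Bad.card ≤ k := (Finset.card_le_univ _).trans (by simp)
  -- The bound on the neighbours in `S i` is three if some remaining vertex attains it and two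
  -- otherwise; it is two for bad indices, because their only triple neighbour was removed.
  refine ⟨C \ X, Finset.sdiff_subset, X.card,
    fun i => if ∃ z ∈ C \ X, 3 ≤ (nb G (S i) z).card then 3 else 2, ?_,
    Finset.card_sdiff_add_card_eq_card hXC, hXc, fun z hz => ?_, fun i => ?_, fun i hi => ?_,
    fun i hi => ?_⟩
  · obtain ⟨z, hz⟩ := hCne
    have h1 := hdegC z hz
    have h2 := Finset.sum_le_card_nsmul Finset.univ (fun i => (nb G (S i) z).card) 3
      fun i _ => h.nb_card_le i (hC hz)
    simp only [Finset.card_univ, Fintype.card_fin, smul_eq_mul] at h2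
    obtain ⟨w, hw⟩ := Finset.card_pos.1 (by omega : 0 < (nb G (C \ X) z).card)
    exact ⟨w, (mem_nb.1 hw).1⟩
  · have h1 := hdegC z (Finset.mem_sdiff.1 hz).1
    have h2 : ∑ i, (nb G (S i) z).card ≤
        ∑ i, if ∃ z ∈ C \ X, 3 ≤ (nb G (S i) z).card then 3 else 2 := by
      refine Finset.sum_le_sum fun i _ => ?_
      split_ifs with hex
      · exact h.nb_card_le i (hC (Finset.mem_sdiff.1 hz).1)
      · by_contra hlt
        exact hex ⟨z, hz, by omega⟩
    beta_reduce
    omega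
  · dsimp only; split_ifs <;> omega
  · dsimp only
    rw [if_neg]
    rintro ⟨z, hz, hz3⟩
    rw [Finset.mem_sdiff] at hz
    exact hz.2 (Finset.mem_biUnion.2 ⟨i, hi, Finset.mem_filter.2 ⟨hz.1, hz3⟩⟩)
  · dsimp only at hi
    split_ifs at hi with hex
    swap
    · omega
    obtain ⟨z, hz, hz3⟩ := hex
    exact ⟨z, (Finset.mem_sdiff.1 hz).1, hz3⟩

/-- If some pair of an optimal state is not connected, there is a dense part. -/
theorem exists_dense (h : IsOptimal G D s t S) (hD : D.card ≤ 12 * k)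
    (hdeg : ∀ v ∈ D, 6 * k ≤ (nb G D v).card) (hst : ∀ i, s i ≠ t i) {j : Fin k}
    (hj : ¬ Conn G (S j) (s j) (t j)) : ∃ C ⊆ D, ∃ δ, C.Nonempty ∧ (∀ v ∈ C, δ ≤ (nb G C v).card) ∧
      3 * k ≤ δ ∧ 5 * k + 2 * C.card ≤ 4 * δ := by
  obtain ⟨r, hr, -⟩ := h.exists_nb_rest hdeg (h.1.1 j).2.1
  set C₁ := (rest D S).filter fun a => Conn G (rest D S) r a with hC₁
  set C₂ := (rest D S).filter fun a => ¬ Conn G (rest D S) r a with hC₂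
  have hC : C₁ ∪ C₂ = rest D S := Finset.filter_union_filter_not_eq _ _
  have hdis : Disjoint C₁ C₂ := Finset.disjoint_filter_filter_not _ _ _
  have hno : ∀ a ∈ C₁, ∀ b ∈ C₂, ¬ G.Adj a b := fun a ha b hb hab => by
    rw [Finset.mem_filter] at ha hb
    exact hb.2 (ha.2.trans (Conn.of_adj hab ha.1 hb.1))
  have hne₁ : C₁.Nonempty := ⟨r, Finset.mem_filter.2 ⟨hr, Conn.rfl⟩⟩
  have hne₂ : C₂.Nonempty := by
    by_contra hemp
    refine h.not_connected hD hdeg hst hj (r := r) fun a ha => ?_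
    by_contra hra
    exact hemp ⟨a, Finset.mem_filter.2 ⟨ha, hra⟩⟩
  clear_value C₁ C₂
  have hsub₁ : C₁ ⊆ rest D S := hC ▸ Finset.subset_union_left
  have hsub₂ : C₂ ⊆ rest D S := hC ▸ Finset.subset_union_right
  -- The indices whose short set is seen three times from both sides. By `unique_seer` only one
  -- vertex on each side does so and can be discarded.
  set Bad : Finset (Fin k) := Finset.univ.filter fun i => (S i).card ≤ 4 ∧
    (∃ x ∈ C₁, 3 ≤ (nb G (S i) x).card) ∧ ∃ y ∈ C₂, 3 ≤ (nb G (S i) y).card with hBad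
  have hBm : ∀ i, i ∈ Bad ↔ (S i).card ≤ 4 ∧ (∃ x ∈ C₁, 3 ≤ (nb G (S i) x).card) ∧
    ∃ y ∈ C₂, 3 ≤ (nb G (S i) y).card := fun i => by simp [hBad]
  have hk : 0 < k := j.pos
  obtain ⟨A₁, hA₁, e₁, g₁, hA₁ne, hA₁c, he₁, hA₁d, hg₁, hg₁B, hg₁3⟩ :=
    h.exists_side hdeg hk hsub₁ hne₁ (fun a ha b hb hab => by
      rw [← hC] at hb
      exact (Finset.mem_union.1 hb).resolve_right fun hb => hno a ha b hb hab) Bad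
      (fun i hi x hx z hz hx3 hz3 => by
        obtain ⟨h1, -, y, hy, hy3⟩ := (hBm i).1 hi
        exact h.unique_seer hD hdeg hst hj hC hdis hno h1 hx hz hy hx3 hz3 hy3)
  obtain ⟨A₂, hA₂, e₂, g₂, hA₂ne, hA₂c, he₂, hA₂d, hg₂, hg₂B, hg₂3⟩ :=
    h.exists_side hdeg hk hsub₂ hne₂ (fun a ha b hb hab => by
      rw [← hC] at hb
      exact (Finset.mem_union.1 hb).resolve_left fun hb => hno b hb a ha hab.symm) Bad
      (fun i hi x hx z hz hx3 hz3 => by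
        obtain ⟨h1, ⟨y, hy, hy3⟩, -⟩ := (hBm i).1 hi
        exact h.unique_seer hD hdeg hst hj (Finset.union_comm C₁ C₂ ▸ hC) hdis.symm
          (fun a ha b hb hab => hno b hb a ha hab.symm) h1 hx hz hy hx3 hz3 hy3)
  have hB3 : ∀ (g : Fin k → ℕ) (C : Finset V), (∀ i, 2 ≤ g i ∧ g i ≤ 3) → (∀ i ∈ Bad, g i = 2) →
      ∑ i, g i + Bad.card ≤ 3 * k := fun g C h1 h2 => by
    have : ∑ i, (g i + if i ∈ Bad then 1 else 0) ≤ ∑ i : Fin k, 3 := Finset.sum_le_sum fun i _ => by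
      have := h1 i
      have := h2 i
      split_ifs with hi
      · have := this hi; omega
      · omega
    rw [Finset.sum_add_distrib] at this
    simp at this
    omega
  have hB₁ := hB3 g₁ C₁ hg₁ hg₁B
  have hB₂ := hB3 g₂ C₂ hg₂ hg₂B
  have hle : ∀ i x, (nb G (S i) x).card ≤ (S i).card := fun i x =>
    Finset.card_le_card (Finset.filter_subset _ _)
  -- Index by index, 2g₁ + 2g₂ ≤ |S i| + 7, with 2 to spare at bad indices. A value three needs |S
  -- i| ≥ 3, and two of them at the same index need |S i| ≥ 5, as bad indices have value two.
  have hmain : 2 * ∑ i, g₁ i + 2 * ∑ i, g₂ i + 2 * Bad.card ≤ ∑ i, (S i).card + 7 * k := by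
    have : ∑ i, (2 * g₁ i + 2 * g₂ i + if i ∈ Bad then 2 else 0) ≤ ∑ i, ((S i).card + 7) :=
      Finset.sum_le_sum fun i _ => by
        have h1 := hg₁ i
        have h2 := hg₂ i
        have h3 := h.two_le_card hst i
        have h4 : g₁ i = 3 → 3 ≤ (S i).card := fun hi => by
          obtain ⟨z, -, hz⟩ := hg₁3 i hi
          exact hz.trans (hle i z)
        have h5 : g₂ i = 3 → 3 ≤ (S i).card := fun hi => by
          obtain ⟨z, -, hz⟩ := hg₂3 i hi
          exact hz.trans (hle i z)
        split_ifs with hi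
        · have h6 := hg₁B i hi
          have h7 := hg₂B i hi
          obtain ⟨-, ⟨z, -, hz⟩, -⟩ := (hBm i).1 hi
          have := hz.trans (hle i z)
          omega
        · by_cases h4' : (S i).card ≤ 4
          · have : ¬ (g₁ i = 3 ∧ g₂ i = 3) := fun h' => hi ((hBm i).2 ⟨h4', hg₁3 i h'.1, hg₂3 i h'.2⟩)
            omega
          · omega
    simp only [Finset.sum_add_distrib, ← Finset.mul_sum] at this
    simp at this
    omega
  have hcard := h.1.card_eq
  rw [← hC, Finset.card_union_of_disjoint hdis] at hcard
  -- If both sides were too sparse, the sum of the two inequalities would contradict `hmain`,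
  -- because |C₁| + |C₂| + Σ|S i| ≤ 12k.
  by_cases hfirst : 5 * k + 2 * A₁.card ≤ 4 * (6 * k - (∑ i, g₁ i + e₁))
  · exact ⟨A₁, fun v hv => (mem_rest.1 (hsub₁ (hA₁ hv))).1, 6 * k - (∑ i, g₁ i + e₁), hA₁ne,
      fun v hv => by have := hA₁d v hv; omega, by omega, hfirst⟩
  · exact ⟨A₂, fun v hv => (mem_rest.1 (hsub₂ (hA₂ hv))).1, 6 * k - (∑ i, g₂ i + e₂), hA₂ne,
      fun v hv => by have := hA₂d v hv; omega, by omega, by omega⟩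

end IsOptimal

/-- A graph with at most `12k` vertices and minimum degree at least `6k` contains a `k`-linked
subgraph. -/
theorem denseLinked (V : Type*) (k : ℕ) : DenseLinked V k := by
  intro G D hDne hD hdeg
  have hsize : ∀ (C : Finset V) (δ : ℕ), C.Nonempty → (∀ v ∈ C, δ ≤ (nb G C v).card) → 3 * k ≤ δ →
      2 * k ≤ C.card := fun C δ ⟨v, hv⟩ h1 h2 => by
    have := h1 v hv
    have := Finset.card_le_card (Finset.filter_subset (G.Adj v) C)
    unfold nb at *
    omega
  by_cases hDk : KLinked G D k
  · exact ⟨D, subset_rfl, hsize D _ hDne hdeg (by omega), hDk⟩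
  unfold KLinked at hDk
  push Not at hDk
  obtain ⟨s, t, hst, hs, ht, hno⟩ := hDk
  obtain ⟨S, hS⟩ := exists_isOptimal (G := G) hst hs ht
  obtain ⟨j, hj⟩ : ∃ j, ¬ Conn G (S j) (s j) (t j) := by
    by_contra hall
    push Not at hall
    exact hno S (fun i => ⟨(hS.1.1 i).1, (hS.1.1 i).2.1, (hS.1.1 i).2.2, hall i⟩)
      fun i j hij => hS.1.2.1 i j hij
  obtain ⟨C, hCD, δ, hCne, h1, h2, h3⟩ := hS.exists_dense hD hdeg
    (fun i h => Sum.inl_ne_inr (@hst (.inl i) (.inr i) h)) hj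
  exact ⟨C, hCD, hsize C δ hCne h1 h2, kLinked_of_dense h1 h2 h3⟩

/-- A massed pair of order at most `2k` is linked. -/
theorem Massed.isLinked [Fintype V] {U X : Finset V} (hXU : X ⊆ U)
    (hXk : X.card ≤ 2 * k) (hM : Massed k G U X) : Linked G U X :=
  hM.linked (denseLinked V k) _ _ _ _ rfl hXU hXk

end State

end ParityLinkage
end

section
open scoped Classical
namespace ParityLinkage

/-! ### Maximum cuts and a linked subset of a bipartite graph. -/

section MaxCut
variable {V : Type*} {G H H' : SimpleGraph V} {K : ℕ}

/-- The edges of `G` joining vertices of different colours. -/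
def biGraph (G : SimpleGraph V) (c : V → Bool) : SimpleGraph V where
  Adj a b := G.Adj a b ∧ c a ≠ c b
  symm := ⟨fun _ _ h => ⟨h.1.symm, h.2.symm⟩⟩
  loopless := ⟨fun _ h => h.1.ne rfl⟩

theorem biGraph_le (c : V → Bool) : biGraph G c ≤ G := fun _ _ h => h.1

/-- The sum of the degrees in `H[U]`. -/
noncomputable def degreeSum (H : SimpleGraph V) (U : Finset V) : ℕ := ∑ v ∈ U, (nb H U v).card

theorem degreeSum_erase {U : Finset V} {v : V} (hv : v ∈ U) :
    degreeSum H U = degreeSum H (U.erase v) + 2 * (nb H U v).card := by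
  have h1 : ∀ w ∈ U.erase v, (nb H U w).card =
      (nb H (U.erase v) w).card + if H.Adj v w then 1 else 0 := by
    intro w hw
    have : nb H (U.erase v) w = (nb H U w).erase v := by
      ext z; simp only [mem_nb, Finset.mem_erase]; tauto
    rw [this]
    split_ifs with h
    · exact (Finset.card_erase_add_one (mem_nb.2 ⟨hv, h.symm⟩)).symm
    · rw [Finset.erase_eq_of_notMem fun h' => h (mem_nb.1 h').2.symm, add_zero]
  have h2 : ∑ w ∈ U.erase v, (if H.Adj v w then 1 else 0) = (nb H U v).card := by
    rw [← Finset.card_filter]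
    congr 1
    ext z
    simp only [mem_nb, Finset.mem_filter, Finset.mem_erase]
    exact ⟨fun h => ⟨h.1.2, h.2⟩, fun h => ⟨⟨h.2.ne', h.1⟩, h.2⟩⟩
  rw [degreeSum, ← Finset.add_sum_erase _ _ hv, Finset.sum_congr rfl h1, Finset.sum_add_distrib, h2,
    degreeSum]
  omega

theorem degreeSum_congr {U : Finset V} (h : ∀ a ∈ U, ∀ b ∈ U, (H.Adj a b ↔ H'.Adj a b)) :
    degreeSum H U = degreeSum H' U :=
  Finset.sum_congr rfl fun a ha => congrArg _ <| by
    ext b; simp only [mem_nb]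
    exact ⟨fun hb => ⟨hb.1, (h a ha b hb.1).1 hb.2⟩, fun hb => ⟨hb.1, (h a ha b hb.1).2 hb.2⟩⟩

/-- In a maximum cut at least half of the edges at any vertex are cut. -/
theorem exists_maxCut [Fintype V] (G : SimpleGraph V) : ∃ c : V → Bool, ∀ v,
    (nb G Finset.univ v).card ≤ 2 * (nb (biGraph G c) Finset.univ v).card := by
  obtain ⟨c, -, hc⟩ := Finset.exists_max_image (Finset.univ : Finset (V → Bool))
    (fun c => degreeSum (biGraph G c) Finset.univ) ⟨fun _ => true, Finset.mem_univ _⟩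
  refine ⟨c, fun v => ?_⟩
  set c' := Function.update c v (!c v) with hc'
  have h1 := hc c' (Finset.mem_univ _)
  rw [degreeSum_erase (Finset.mem_univ v), degreeSum_erase (H := biGraph G c) (Finset.mem_univ v),
    degreeSum_congr (H := biGraph G c') (H' := biGraph G c) (fun a ha b hb => by
      simp only [biGraph, hc', Function.update_of_ne (Finset.ne_of_mem_erase ha),
        Function.update_of_ne (Finset.ne_of_mem_erase hb)])] at h1
  have h2 : nb G Finset.univ v ⊆ nb (biGraph G c) Finset.univ v ∪ nb (biGraph G c') Finset.univ v := by
    intro w hw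
    have hvw := (mem_nb.1 hw).2
    simp only [Finset.mem_union, mem_nb, Finset.mem_univ, true_and, biGraph, hc',
      Function.update_self, Function.update_of_ne hvw.ne']
    by_cases h : c v = c w
    · exact Or.inr ⟨hvw, by rw [h]; simp⟩
    · exact Or.inl ⟨hvw, h⟩
  have h3 := (Finset.card_le_card h2).trans (Finset.card_union_le _ _)
  omega

theorem degreeSum_le {U A B : Finset V} (h : IsSepn H U A B) :
    degreeSum H U ≤ degreeSum H A + degreeSum H B := by
  have hAU : A ⊆ U := h.1 ▸ Finset.subset_union_left
  have hBU : B ⊆ U := h.1 ▸ Finset.subset_union_right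
  have e : ∀ A, degreeSum H A = ((A ×ˢ A).filter fun p => H.Adj p.1 p.2).card := fun A => by
    rw [Finset.card_filter, Finset.sum_product]
    simp only [degreeSum, nb, Finset.card_filter]
  rw [e, e, e]
  refine le_trans (Finset.card_le_card fun p hp => ?_) (Finset.card_union_le _ _)
  simp only [Finset.mem_union, Finset.mem_filter, Finset.mem_product] at hp ⊢
  obtain ⟨⟨h1, h2⟩, h3⟩ := hp
  rw [← h.1, Finset.mem_union] at h1 h2
  have e1 : p.1 ∈ A → p.1 ∉ B → p.2 ∈ B → p.2 ∈ A := fun a1 a2 b1 => by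
    by_contra b2
    exact h.2 p.1 (Finset.mem_sdiff.2 ⟨a1, a2⟩) p.2 (Finset.mem_sdiff.2 ⟨b1, b2⟩) h3
  have e2 : p.2 ∈ A → p.2 ∉ B → p.1 ∈ B → p.1 ∈ A := fun a1 a2 b1 => by
    by_contra b2
    exact h.2 p.2 (Finset.mem_sdiff.2 ⟨a1, a2⟩) p.1 (Finset.mem_sdiff.2 ⟨b1, b2⟩) h3.symm
  simp only [h3, and_true]
  clear h h3 e
  tauto

/-- A bipartite graph of large minimum degree has a large subgraph in which everything is linked. -/
theorem exists_linked_subset [Fintype V] [Nonempty V] (hK : 0 < K) {c : V → Bool}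
    (hc : ∀ a b, H.Adj a b → c a ≠ c b) (hdeg : ∀ v, 25 * K ≤ 2 * (nb H Finset.univ v).card) :
    ∃ U : Finset V, 12 * K ≤ U.card ∧ ∀ X ⊆ U, X.card ≤ 2 * K → Linked H U X := by
  have hV : 4 * K ≤ (Finset.univ : Finset V).card := by
    obtain ⟨v⟩ := ‹Nonempty V›
    have h1 := hdeg v
    have h2 := Finset.card_le_card (Finset.filter_subset (H.Adj v) Finset.univ)
    unfold nb at h1
    omega
  -- As in Mader's theorem, `U` is a smallest set for which twice the degree sum exceeds 25K(|U| -
  -- 2K). Thanks to the additive term this bound adds up across separations of order below 2K, so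
  -- the minimal set has none with two nonempty sides.
  have hex : ∃ n, ∃ U : Finset V, U.card = n ∧ 4 * K ≤ U.card ∧
      25 * K * U.card < 2 * degreeSum H U + 50 * K * K := by
    refine ⟨_, Finset.univ, rfl, hV, ?_⟩
    have h1 : (Finset.univ : Finset V).card • (25 * K) ≤ ∑ v, 2 * (nb H Finset.univ v).card :=
      Finset.card_nsmul_le_sum _ _ _ fun v _ => hdeg v
    rw [← Finset.mul_sum, smul_eq_mul, mul_comm] at h1
    have h2 : 0 < 50 * K * K := by positivity
    exact lt_of_le_of_lt h1 (Nat.lt_add_of_pos_right h2)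
  obtain ⟨U, hUn, hU4, hU⟩ := Nat.find_spec hex
  have hmin : ∀ A : Finset V, A ⊂ U → 4 * K ≤ A.card →
      2 * degreeSum H A + 50 * K * K ≤ 25 * K * A.card := fun A hA hA4 => by
    by_contra hlt
    have := Nat.find_min' hex ⟨A, rfl, hA4, by omega⟩
    have := Finset.card_lt_card hA
    omega
  clear hUn
  have hUlt : 4 * K < U.card := by
    refine lt_of_le_of_ne hU4 fun heq => ?_
    have h1 : degreeSum H U ≤ U.card * U.card := by
      rw [← smul_eq_mul]
      exact Finset.sum_le_card_nsmul _ _ _ fun v _ => Finset.card_le_card (Finset.filter_subset _ _)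
    rw [← heq] at h1 hU
    nlinarith
  have hUdeg : ∀ v ∈ U, 25 * K < 4 * (nb H U v).card := by
    intro v hv
    have h1 := degreeSum_erase (H := H) hv
    have h2 := Finset.card_erase_add_one hv
    have h3 := hmin _ (Finset.erase_ssubset hv) (by omega)
    have h4 : 25 * K * U.card = 25 * K * (U.erase v).card + 25 * K := by rw [← h2]; ring
    omega
  -- By bipartiteness the ends of an edge have disjoint neighbourhoods, each with more than 25K/4
  -- vertices.
  have hU12 : 12 * K ≤ U.card := by
    obtain ⟨v, hv⟩ := Finset.card_pos.1 (by omega : 0 < U.card)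
    have h1 := hUdeg v hv
    obtain ⟨w, hw⟩ := Finset.card_pos.1 (by omega : 0 < (nb H U v).card)
    obtain ⟨hwU, hvw⟩ := mem_nb.1 hw
    have h2 := hUdeg w hwU
    have h3 : (nb H U v ∪ nb H U w).card ≤ U.card :=
      Finset.card_le_card (Finset.union_subset (Finset.filter_subset _ _) (Finset.filter_subset _ _))
    rw [Finset.card_union_of_disjoint] at h3
    · omega
    · refine Finset.disjoint_left.2 fun z hz hz' => ?_
      have e1 := hc _ _ (mem_nb.1 hz).2
      have e2 := hc _ _ (mem_nb.1 hz').2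
      have e3 := hc _ _ hvw
      revert e1 e2 e3
      cases c v <;> cases c w <;> cases c z <;> simp
  have hconn : ∀ A B, IsSepn H U A B → (A ∩ B).card < 2 * K → (A \ B).Nonempty → (B \ A).Nonempty →
      False := by
    intro A B hAB hlt ⟨a, ha⟩ ⟨b, hb⟩
    rw [Finset.mem_sdiff] at ha hb
    have hAU : A ⊆ U := hAB.1 ▸ Finset.subset_union_left
    have hBU : B ⊆ U := hAB.1 ▸ Finset.subset_union_right
    have h1 : nb H U a ⊆ A := fun w hw => by
      obtain ⟨hw, haw⟩ := mem_nb.1 hw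
      by_contra hwA
      rw [← hAB.1] at hw
      exact hAB.2 a (by simp [ha]) w (by simp [hwA, (Finset.mem_union.1 hw).resolve_left hwA]) haw
    have h2 : nb H U b ⊆ B := fun w hw => by
      obtain ⟨hw, hbw⟩ := mem_nb.1 hw
      by_contra hwB
      rw [← hAB.1] at hw
      exact hAB.2 w (by simp [hwB, (Finset.mem_union.1 hw).resolve_right hwB]) b (by simp [hb]) hbw.symm
    have h3 := hUdeg a (hAU ha.1)
    have h4 := hUdeg b (hBU hb.1)
    have h5 := Finset.card_le_card h1
    have h6 := Finset.card_le_card h2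
    have h7 := hmin A (hAU.ssubset_of_ne fun h => hb.2 (h ▸ hBU hb.1)) (by omega)
    have h8 := hmin B (hBU.ssubset_of_ne fun h => ha.2 (h ▸ hAU ha.1)) (by omega)
    have h9 := degreeSum_le hAB
    have h10 := Finset.card_union_add_card_inter A B
    rw [hAB.1] at h10
    have h11 : A.card + B.card ≤ U.card + 2 * K := by omega
    have h12 := Nat.mul_le_mul_left (25 * K) h11
    have h13 : 25 * K * (A.card + B.card) = 25 * K * A.card + 25 * K * B.card := by ring
    have h14 : 25 * K * (U.card + 2 * K) = 25 * K * U.card + 50 * K * K := by ring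
    omega
  refine ⟨U, hU12, fun X hXU hX => ?_⟩
  -- Enlarged to exactly 2K vertices, so that the separations to be checked are those excluded by
  -- `hconn`.
  obtain ⟨X', hXX', hX'U, hX'c⟩ := Finset.exists_subsuperset_card_eq hXU hX (by omega)
  refine Linked.mono (Massed.isLinked hX'U hX'c.le ⟨?_, fun A B hAB hXA hlt => ?_⟩) hXX'
  -- Pairs inside `X'` account for at most 4K² of the degree sum; the bound |U| ≥ 12K absorbs this
  -- loss.
  · have h1 : degreeSum H U ≤ mass H U (U \ X') + X'.card * X'.card := by
      rw [← Finset.card_product]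
      have e : degreeSum H U = ((U ×ˢ U).filter fun p => H.Adj p.1 p.2).card := by
        rw [Finset.card_filter, Finset.sum_product]
        simp only [degreeSum, nb, Finset.card_filter]
      rw [e]
      refine le_trans (Finset.card_le_card fun p hp => ?_) (Finset.card_union_le _ _)
      simp only [Finset.mem_union, Finset.mem_filter, Finset.mem_product, Finset.mem_sdiff] at hp ⊢
      tauto
    have h2 := Finset.card_sdiff_add_card_eq_card hX'U
    rw [hX'c] at h1 h2
    have h3 : 12 * K * K ≤ U.card * K := Nat.mul_le_mul_right _ hU12
    have h4 : 12 * K * U.card = 12 * K * (U \ X').card + 24 * K * K := by rw [← h2]; ring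
    have h5 : 25 * K * U.card = 2 * (12 * K * U.card) + U.card * K := by ring
    have h6 : 2 * K * (2 * K) = 4 * (K * K) := by ring
    have h7 : 24 * K * K = 24 * (K * K) := by ring
    have h8 : 50 * K * K = 50 * (K * K) := by ring
    have h9 : 12 * K * K = 12 * (K * K) := by ring
    have h10 : 0 < K * K := by positivity
    omega
  · have : B \ A = ∅ := by
      by_contra hne
      refine hconn A B hAB (by omega) ?_ (Finset.nonempty_iff_ne_empty.2 hne)
      by_contra hemp
      rw [Finset.not_nonempty_iff_eq_empty, Finset.sdiff_eq_empty_iff_subset] at hemp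
      rw [Finset.inter_eq_left.2 hemp] at hlt
      exact absurd (Finset.card_le_card hXA) (by omega)
    simp [this, mass]

end MaxCut

end ParityLinkage
end

section
open scoped Classical
namespace ParityLinkage

/-! ### Berge's formula from Tutte's theorem. -/

section Berge
variable {W : Type*}

/-- The graph obtained from `F` by adding `d` vertices adjacent to all others. -/
def addUniversal (F : SimpleGraph W) (d : ℕ) : SimpleGraph (W ⊕ Fin d) where
  Adj x y := x ≠ y ∧ ∀ a b, x = .inl a → y = .inl b → F.Adj a b
  symm := ⟨fun _ _ h => ⟨h.1.symm, fun a b ha hb => (h.2 b a hb ha).symm⟩⟩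
  loopless := ⟨fun _ h => h.1 rfl⟩

/-- A Tutte violator gives many disjoint odd sets, each closed under adjacency outside the violator. -/
theorem exists_odd_closed_family [Finite W] {F : SimpleGraph W} {u : Set W}
    (h : F.IsTutteViolator u) : ∃ (n : ℕ) (C : Fin n → Set W), u.ncard < n ∧
      (∀ i, Odd (C i).ncard ∧ Disjoint (C i) u ∧ ∀ a ∈ C i, ∀ b ∉ u, F.Adj a b → b ∈ C i) ∧
      ∀ i j, i ≠ j → Disjoint (C i) (C j) := by
  let e := Finite.equivFin ((⊤ : F.Subgraph).deleteVerts u).coe.oddComponents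
  refine ⟨_, fun i => Subtype.val '' (e.symm i).1.supp, h, fun i => ⟨?_, ?_, ?_⟩, fun i j hij => ?_⟩
  · rw [Set.ncard_image_of_injective _ Subtype.val_injective]
    exact (e.symm i).2
  · rw [Set.disjoint_left]
    rintro _ ⟨x, -, rfl⟩
    exact x.2.2
  · rintro _ ⟨x, hx, rfl⟩ b hb hab
    refine ⟨⟨b, ⟨trivial, hb⟩⟩, ?_, rfl⟩
    rw [SimpleGraph.ConnectedComponent.mem_supp_iff] at hx ⊢
    rw [← hx, SimpleGraph.ConnectedComponent.eq]
    refine (SimpleGraph.Adj.reachable ?_).symm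
    rw [SimpleGraph.Subgraph.coe_adj, SimpleGraph.Subgraph.deleteVerts_adj]
    exact ⟨trivial, x.2.2, trivial, hb, hab⟩
  · rw [Set.disjoint_left]
    rintro _ ⟨x, hx, rfl⟩ ⟨y, hy, hxy⟩
    obtain rfl := Subtype.val_injective hxy
    rw [SimpleGraph.ConnectedComponent.mem_supp_iff] at hx hy
    exact hij (e.symm.injective (Subtype.ext (hx.symm.trans hy)))

/-- **Berge's formula**: a matching leaving at most `d` vertices uncovered, or a set whose deletion
leaves many odd parts. -/
theorem exists_matching_or_odd_family [Fintype W] (F : SimpleGraph W) {d : ℕ}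
    (hd : Even (Fintype.card W + d)) :
    (∃ μ : W → Option W, (∀ a b, μ a = some b → F.Adj a b ∧ μ b = some a) ∧
      (Finset.univ.filter fun a => μ a = none).card ≤ d) ∨
    ∃ (Z : Finset W) (n : ℕ) (C : Fin n → Finset W), Z.card + d < n ∧
      (∀ i, Odd (C i).card ∧ Disjoint (C i) Z ∧ ∀ a ∈ C i, ∀ b ∉ Z, F.Adj a b → b ∈ C i) ∧
      ∀ i j, i ≠ j → Disjoint (C i) (C j) := by
  -- In a perfect matching of the enlarged graph, the original vertices matched to one of the `d`
  -- new ones are the uncovered ones.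
  by_cases hM : ∃ M : (addUniversal F d).Subgraph, M.IsPerfectMatching
  · left
    obtain ⟨M, hM⟩ := hM
    have hM' := SimpleGraph.Subgraph.isPerfectMatching_iff.1 hM
    choose f hf hfu using hM'
    have hfi : ∀ x, f (f x) = x := fun x => (hfu (f x) x (hf x).symm).symm
    refine ⟨fun a => (f (.inl a)).getLeft?, fun a b hab => ?_, ?_⟩
    · have hab' := Sum.getLeft?_eq_some_iff.1 hab
      have h1 := (hf (.inl a)).adj_sub
      rw [hab'] at h1
      refine ⟨h1.2 a b rfl rfl, ?_⟩
      rw [Sum.getLeft?_eq_some_iff, ← hab', hfi]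
    · have h1 : ∀ a, (f (.inl a)).getLeft? = none → ∃ i : Fin d, f (.inl a) = .inr i := fun a ha => by
        rcases h : f (.inl a) with b | i
        · rw [h] at ha; simp at ha
        · exact ⟨i, rfl⟩
      have h2 : ((Finset.univ.filter fun a => (f (.inl a)).getLeft? = none).image
          fun a => f (.inl a)) ⊆ (Finset.univ : Finset (Fin d)).image Sum.inr := by
        intro x hx
        obtain ⟨a, ha, rfl⟩ := Finset.mem_image.1 hx
        obtain ⟨i, hi⟩ := h1 a (Finset.mem_filter.1 ha).2
        rw [hi]; simp
      have h3 := Finset.card_le_card h2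
      rw [Finset.card_image_of_injective, Finset.card_image_of_injective _ Sum.inr_injective] at h3
      · simpa using h3
      · intro a b hab
        have := congrArg f hab
        simp only [hfi] at this
        exact Sum.inl_injective this
  right
  rw [SimpleGraph.tutte] at hM
  push Not at hM
  obtain ⟨u, hu⟩ := hM
  obtain ⟨n, C, hn, hC, hCd⟩ := exists_odd_closed_family hu
  have hne : ∀ i, (C i).Nonempty := fun i =>
    Set.nonempty_of_ncard_ne_zero fun h0 => by have := (hC i).1; rw [h0] at this; simp at this
  -- A universal vertex outside the violator would connect all that is left. Then there is at most
  -- one odd part, the violator is empty, and the number of vertices is odd, contrary to `hd`.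
  by_cases huniv : ∀ i : Fin d, (.inr i : W ⊕ Fin d) ∈ u
  · refine ⟨Finset.univ.filter fun a => (.inl a : W ⊕ Fin d) ∈ u, n,
      fun i => Finset.univ.filter fun a => (.inl a : W ⊕ Fin d) ∈ C i, ?_,
      fun i => ⟨?_, ?_, fun a ha b hb hab => ?_⟩, fun i j hij => ?_⟩
    · refine lt_of_eq_of_lt ?_ hn
      have : u = ((Finset.univ.filter fun a => (.inl a : W ⊕ Fin d) ∈ u).disjSum Finset.univ :
          Finset (W ⊕ Fin d)) := by
        ext x
        rcases x with a | i <;> simp [huniv]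
      conv_rhs => rw [this]
      rw [Set.ncard_coe_finset, Finset.card_disjSum, Finset.card_univ, Fintype.card_fin]
    · have : C i = ((Finset.univ.filter fun a => (.inl a : W ⊕ Fin d) ∈ C i).map
          Function.Embedding.inl : Finset (W ⊕ Fin d)) := by
        ext x
        rcases x with a | j
        · simp
        · simp only [Finset.coe_map, Set.mem_image]
          constructor
          · exact fun hj => absurd (huniv j) (Set.disjoint_left.1 (hC i).2.1 hj)
          · rintro ⟨x, -, hx⟩
            simp at hx
      have h1 := (hC i).1
      rw [this, Set.ncard_coe_finset, Finset.card_map] at h1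
      exact h1
    · refine Finset.disjoint_left.2 fun a ha ha' => ?_
      rw [Finset.mem_filter] at ha ha'
      exact Set.disjoint_left.1 (hC i).2.1 ha.2 ha'.2
    · rw [Finset.mem_filter] at ha ⊢
      refine ⟨Finset.mem_univ _, (hC i).2.2 _ ha.2 _ (fun h => hb (by simpa using h))
        ⟨fun h => hab.ne (Sum.inl_injective h), fun a' b' ha' hb' => ?_⟩⟩
      rw [← Sum.inl_injective ha', ← Sum.inl_injective hb']
      exact hab
    · refine Finset.disjoint_left.2 fun a ha ha' => ?_
      rw [Finset.mem_filter] at ha ha'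
      exact Set.disjoint_left.1 (hCd i j hij) ha.2 ha'.2
  · exfalso
    push Not at huniv
    obtain ⟨w, hw⟩ := huniv
    have hall : ∀ i x, x ∉ u → x ∈ C i := by
      intro i
      have hwC : .inr w ∈ C i := by
        obtain ⟨x, hx⟩ := hne i
        by_cases hxw : x = .inr w
        · exact hxw ▸ hx
        · exact (hC i).2.2 x hx _ hw ⟨hxw, fun a b _ hb => by simp at hb⟩
      intro x hx
      by_cases hxw : x = .inr w
      · exact hxw ▸ hwC
      · exact (hC i).2.2 _ hwC x hx ⟨fun h => hxw h.symm, fun a b ha _ => by simp at ha⟩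
    have hn1 : n ≤ 1 := by
      by_contra hlt
      exact Set.disjoint_left.1 (hCd ⟨0, by omega⟩ ⟨1, by omega⟩ (by simp)) (hall _ _ hw) (hall _ _ hw)
    have hu0 : u = ∅ := (Set.ncard_eq_zero).1 (by omega)
    have hCu : C ⟨0, by omega⟩ = Set.univ := Set.eq_univ_of_forall fun x => hall _ x (by simp [hu0])
    have h1 := (hC ⟨0, by omega⟩).1
    rw [hCu, Set.ncard_univ, Nat.card_eq_fintype_card, Fintype.card_sum, Fintype.card_fin] at h1
    exact (Nat.not_even_iff_odd.2 h1) hd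

end Berge

end ParityLinkage
end

section
open scoped Classical
namespace ParityLinkage

/-! ### Breaking paths from matchings of the lifted graph. -/

section Breaking
variable {V : Type*} {G H : SimpleGraph V} {c : V → Bool} {S : Finset V}

/-- Whether the number of edges of a walk with ends of equal colour is odd, expressed through the
length and the colours of the ends. -/
def breaks (c : V → Bool) {G : SimpleGraph V} {a b : V} (p : G.Walk a b) : Bool :=
  p.length.bodd ^^ (c a ^^ c b)

@[simp] theorem breaks_nil {a : V} : breaks c (.nil : G.Walk a a) = false := by simp [breaks]

theorem breaks_cons {a b d : V} (h : G.Adj a b) (p : G.Walk b d) :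
    breaks c (.cons h p) = ((!(c a ^^ c b)) ^^ breaks c p) := by
  simp only [breaks, SimpleGraph.Walk.length_cons, Nat.bodd_succ]
  cases p.length.bodd <;> cases c a <;> cases c b <;> cases c d <;> rfl

theorem breaks_append {a b d : V} (p : G.Walk a b) (q : G.Walk b d) :
    breaks c (p.append q) = (breaks c p ^^ breaks c q) := by
  simp only [breaks, SimpleGraph.Walk.length_append, Nat.bodd_add]
  cases p.length.bodd <;> cases q.length.bodd <;> cases c a <;> cases c b <;> cases c d <;> rfl

theorem even_card_of_involution {α : Type*} (A : Finset α) (f : α → α)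
    (hf : ∀ a ∈ A, f a ∈ A ∧ f a ≠ a ∧ f (f a) = a) : Even A.card := by
  have : ∑ a ∈ A, (1 : ZMod 2) = 0 :=
    Finset.sum_involution (fun a _ => f a) (fun _ _ => by decide) (fun a ha _ => (hf a ha).2.1)
      (fun a ha => (hf a ha).1) fun a ha => (hf a ha).2.2
  rw [Finset.sum_const, nsmul_eq_mul, mul_one] at this
  exact (ZMod.natCast_eq_zero_iff_even).1 this

/-- Two copies of every vertex outside `S` and one copy of every vertex of `S`. -/
abbrev Lift (S : Finset V) := {p : V × Bool // p.2 = true → p.1 ∉ S}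

/-- The two copies of a vertex are adjacent; edges with ends of equal colour stay in the same copy
and the other edges change the copy. -/
def liftGraph (G : SimpleGraph V) (c : V → Bool) (S : Finset V) : SimpleGraph (Lift S) where
  Adj p q := p ≠ q ∧ (p.1.1 = q.1.1 ∨ G.Adj p.1.1 q.1.1 ∧ (p.1.2 = q.1.2 ↔ c p.1.1 = c q.1.1))
  symm := ⟨fun p q h => ⟨h.1.symm, h.2.imp Eq.symm fun h' =>
    ⟨h'.1.symm, by rw [eq_comm, h'.2, eq_comm]⟩⟩⟩
  loopless := ⟨fun _ h => h.1 rfl⟩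

theorem card_lift [Fintype V] (S : Finset V) : Fintype.card (Lift S) + S.card = 2 * Fintype.card V := by
  have h1 := Fintype.card_subtype_compl (fun p : V × Bool => p.2 = true → p.1 ∉ S)
  have h2 : Fintype.card {p : V × Bool // ¬ (p.2 = true → p.1 ∉ S)} = S.card := by
    have : (Finset.univ.filter fun p : V × Bool => ¬ (p.2 = true → p.1 ∉ S)) =
        S.map ⟨fun v => (v, true), fun a b h => (Prod.mk.inj h).1⟩ := ?_
    · rw [Fintype.card_subtype, this, Finset.card_map]
    ext ⟨v, e⟩
    simp only [Finset.mem_filter, Finset.mem_univ, true_and, Finset.mem_map]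
    constructor
    · intro h
      push Not at h
      exact ⟨v, h.2, Prod.ext rfl h.1.symm⟩
    · rintro ⟨w, hw, h⟩
      obtain ⟨rfl, rfl⟩ := Prod.mk.inj h
      simpa using hw
  have h3 : Fintype.card (V × Bool) = 2 * Fintype.card V := by simp [mul_comm]
  have h4 := Fintype.card_subtype_le (fun p : V × Bool => p.2 = true → p.1 ∉ S)
  rw [h2, h3] at h1
  rw [h3] at h4
  change Fintype.card {p : V × Bool // p.2 = true → p.1 ∉ S} + _ = _
  omega

/-- The projection of a matching of the lifted graph. -/
def projGraph (μ : Lift S → Option (Lift S)) (hμ : ∀ p q, μ p = some q → μ q = some p) :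
    SimpleGraph V where
  Adj x y := x ≠ y ∧ ∃ p q, p.1.1 = x ∧ q.1.1 = y ∧ μ p = some q
  symm := ⟨fun _ _ ⟨h, p, q, h1, h2, h3⟩ => ⟨h.symm, q, p, h2, h1, hμ p q h3⟩⟩
  loopless := ⟨fun _ h => h.1 rfl⟩

/-- A walk is followed by the matching `μ` when leaving its first vertex from the copy `e`. -/
def Follows (μ : Lift S → Option (Lift S)) : ∀ {v b : V}, Bool → H.Walk v b → Prop
  | _, _, _, .nil => True
  | v, _, e, .cons (v := y) _ q =>
    ∃ p r, p.1 = (v, e) ∧ μ p = some r ∧ r.1.1 = y ∧ Follows μ (!r.1.2) q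

section
variable {μ : Lift S → Option (Lift S)} {hμ : ∀ p q, μ p = some q → μ q = some p}

/-- Consecutive edges of a path come from different copies of their common vertex, since a copy has
only one partner. So the copy of arrival determines the copy of departure, and only the copy at the
start needs a hypothesis. -/
theorem follows_of_isPath {v b : V} (q : (projGraph μ hμ).Walk v b) : ∀ (e : Bool), q.IsPath →
    (∀ p : Lift S, p.1.1 = v → ∀ z, μ p = some z → z.1.1 ∈ q.support → z.1.1 ≠ v → p.1.2 = e) →
    Follows μ e q := by
  induction q with
  | nil => intros; trivial
  | @cons v y b h q ih =>
    intro e hq he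
    rw [SimpleGraph.Walk.cons_isPath_iff] at hq
    have hy : y ∈ (SimpleGraph.Walk.cons h q).support := by simp
    obtain ⟨hne, p, r, hp, hr, hpr⟩ := id h
    have hpe := he p hp r hpr (hr.symm ▸ hy) (by rw [hr]; exact hne.symm)
    refine ⟨p, r, Prod.ext hp hpe, hpr, hr, ih _ hq.1 fun p' hp' z hz hzq hzy => ?_⟩
    by_contra hne'
    have : p' = r := Subtype.ext (Prod.ext (hp'.trans hr.symm) (by
      revert hne'; cases p'.1.2 <;> cases r.1.2 <;> simp))
    rw [this, hμ p r hpr] at hz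
    rw [← Option.some.inj hz, hp] at hzq
    exact hq.2 hzq

/-- The first vertex and its copy determine the walk step by step. It cannot continue through a
vertex of `S`: arriving in the only copy, `false`, it would have to leave from `true`, which does
not exist. The last hypothesis settles the case where one of the walks is trivial. -/
theorem Follows.end_eq {v b b' : V} (q : (projGraph μ hμ).Walk v b) (hb : b ∈ S) (hb' : b' ∈ S) :
    ∀ (e : Bool) (q' : (projGraph μ hμ).Walk v b'), Follows μ e q → Follows μ e q' →
    (v ∈ S → e = true ∨ (v ≠ b ∧ v ≠ b')) → b = b' := by
  induction q with
  | nil =>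
    rintro e (_ | ⟨_, q'⟩) - h' he
    · rfl
    · obtain ⟨p, r, hp, -⟩ := h'
      rcases he hb with h | h
      · exact absurd hb (by have := p.2; rw [hp] at this; exact this h)
      · exact absurd rfl h.1
  | @cons v y b h q ih =>
    rintro e (_ | ⟨_, q'⟩) h h' he
    · obtain ⟨p, r, hp, -⟩ := h
      rcases he hb' with h | h
      · exact absurd hb' (by have := p.2; rw [hp] at this; exact this h)
      · exact absurd rfl h.2
    · obtain ⟨p, r, hp, hpr, hr, hf⟩ := h
      obtain ⟨p', r', hp', hpr', hr', hf'⟩ := h'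
      obtain rfl : p = p' := Subtype.ext (hp.trans hp'.symm)
      obtain rfl : r = r' := Option.some.inj (hpr.symm.trans hpr')
      subst hr
      subst hr'
      refine ih hb _ q' hf hf' fun hy => Or.inl ?_
      have := r.2
      cases h2 : r.1.2
      · rfl
      · exact absurd hy (this h2)

/-- The copy of departure changes exactly at breaking edges: a bichromatic edge changes the copy,
and the passage to the other copy on arrival changes it back. At a vertex of `S` the walk arrives in
`false`, so the final state is `true`. -/
theorem Follows.breaks (hμG : ∀ p q, μ p = some q → (liftGraph G c S).Adj p q) {v b : V}
    (q : (projGraph μ hμ).Walk v b) (hb : b ∈ S) : ∀ e : Bool, Follows μ e q → (v = b → e = true) →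
    (e ^^ breaks c q) = true := by
  induction q with
  | nil => intro e _ he; simp [he rfl]
  | @cons v y b h q ih =>
    rintro e ⟨p, r, hp, hpr, hr, hf⟩ -
    have h1 := ih hb _ hf fun hyb => by
      have := r.2
      cases h2 : r.1.2
      · rfl
      · exact absurd (hr.trans hyb ▸ hb) (this h2)
    have h2 := (hμG p r hpr).2.resolve_left (by rw [hp, hr]; exact h.1)
    rw [breaks_cons]
    have h3 := h2.2
    rw [hp, hr] at h3
    dsimp only at h3
    revert h1 h3
    cases r.1.2 <;> cases e <;> cases c v <;> cases c y <;> cases ParityLinkage.breaks c q <;> simp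

end

/-- A matching of the lifted graph gives disjoint breaking paths. -/
theorem exists_breaking_paths_of_matching [Fintype V] {d m : ℕ} (hd : S.card = d + 2 * m)
    (μ : Lift S → Option (Lift S)) (hμ : ∀ p q, μ p = some q → (liftGraph G c S).Adj p q ∧ μ q = some p)
    (hμd : (Finset.univ.filter fun p => μ p = none).card ≤ d) :
    ∃ (a b : Fin m → V) (Q : ∀ i, G.Walk (a i) (b i)),
      (∀ i, (Q i).IsPath ∧ a i ∈ S ∧ b i ∈ S ∧ a i ≠ b i ∧ breaks c (Q i) = true ∧
        ∀ x ∈ (Q i).support, x ∈ S → x = a i ∨ x = b i) ∧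
      ∀ i j, i ≠ j → List.Disjoint (Q i).support (Q j).support := by
  have hμ' : ∀ p q, μ p = some q → μ q = some p := fun p q h => (hμ p q h).2
  set J := projGraph μ hμ' with hJ
  have hJG : J ≤ G := by
    rintro x y ⟨hne, p, q, rfl, rfl, h⟩
    exact ((hμ p q h).1.2.resolve_left hne).1
  have hfol : ∀ s ∈ S, ∀ b, ∀ q : J.Walk s b, q.IsPath → Follows μ false q := fun s hs b q hq =>
    follows_of_isPath q false hq fun p hp z _ _ _ => by
      have := p.2
      cases h2 : p.1.2
      · rfl
      · exact absurd (hp ▸ hs) (this h2)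
  have htwo : ∀ s ∈ S, ∀ b ∈ S, ∀ b' ∈ S, J.Reachable s b → J.Reachable s b' → s ≠ b → s ≠ b' →
      b = b' := by
    intro s hs b hb b' hb' h h' hsb hsb'
    obtain ⟨q, hq⟩ := h.exists_isPath
    obtain ⟨q', hq'⟩ := h'.exists_isPath
    exact Follows.end_eq q hb hb' false q' (hfol s hs b q hq) (hfol s hs b' q' hq')
      fun _ => Or.inr ⟨hsb, hsb'⟩
  -- A component of `J` contains at most two vertices of `S`. `S₁` collects those alone in their
  -- component, `S₂` the others; each component meeting `S₂` yields one breaking path.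
  set S₁ := S.filter fun s => ∀ s' ∈ S, J.Reachable s s' → s' = s with hS₁
  set S₂ := S.filter fun s => ¬ ∀ s' ∈ S, J.Reachable s s' → s' = s with hS₂
  have hcard : S₁.card + S₂.card = S.card := Finset.card_filter_add_card_filter_not _
  -- Over the component of `s` there is an odd number of copies, one of `s` and two of every other
  -- vertex, so the matching leaves one of them uncovered. Hence |S₁| ≤ d.
  have hdead : ∀ s : S₁, ∃ p, μ p = none ∧ J.Reachable s p.1.1 := by
    rintro ⟨s, hs⟩
    obtain ⟨hsS, hs⟩ := Finset.mem_filter.1 hs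
    by_contra hno
    push Not at hno
    set A : Finset (Lift S) := Finset.univ.filter fun p => J.Reachable s p.1.1 with hA
    have hsA : (⟨(s, false), by simp⟩ : Lift S) ∈ A := by simp [hA]
    have hsome : ∀ p ∈ A, ∃ q, μ p = some q := fun p hp =>
      Option.ne_none_iff_exists'.1 fun h => hno p h (Finset.mem_filter.1 hp).2
    have h1 : Even A.card := by
      refine even_card_of_involution A (fun p => (μ p).getD p) fun p hp => ?_
      obtain ⟨q, hq⟩ := hsome p hp
      have hqp := (hμ p q hq).2
      rw [hq, Option.getD_some]
      refine ⟨?_, (hμ p q hq).1.1.symm, by rw [hqp, Option.getD_some]⟩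
      rw [Finset.mem_filter] at hp ⊢
      refine ⟨Finset.mem_univ _, ?_⟩
      by_cases hpq : p.1.1 = q.1.1
      · rw [← hpq]; exact hp.2
      · exact hp.2.trans (SimpleGraph.Adj.reachable ⟨hpq, p, q, rfl, rfl, hq⟩)
    have h2 : Even (A.erase ⟨(s, false), by simp⟩).card := by
      refine even_card_of_involution _
        (fun p => if h : p.1.1 ∈ S then p else ⟨(p.1.1, !p.1.2), fun _ => h⟩) fun p hp => ?_
      obtain ⟨hps, hp⟩ := Finset.mem_erase.1 hp
      have hpr := (Finset.mem_filter.1 hp).2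
      have hpS : p.1.1 ∉ S := fun h => hps (Subtype.ext (Prod.ext (hs _ h hpr) (by
        have := p.2
        cases h2 : p.1.2
        · rfl
        · exact absurd h (this h2))))
      rw [dif_neg hpS]
      refine ⟨Finset.mem_erase.2 ⟨fun h => hpS ?_, ?_⟩, fun h => ?_, ?_⟩
      · have := congrArg (fun z : Lift S => z.1.1) h
        dsimp only at this
        rw [this]; exact hsS
      · rw [Finset.mem_filter]
        exact ⟨Finset.mem_univ _, hpr⟩
      · have := congrArg (fun z : Lift S => z.1.2) h
        simp at this
      · rw [dif_neg hpS]
        simp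
    rw [← Finset.card_erase_add_one hsA] at h1
    exact (Nat.even_add_one.1 h1) h2
  choose dead hdead hdeadr using hdead
  have hS₁c : S₁.card ≤ d := by
    rw [← Fintype.card_coe]
    refine le_trans (Finset.card_le_card_of_injOn (s := (Finset.univ : Finset S₁)) dead
      (fun s _ => by simpa using hdead s) fun s _ s' _ h => ?_) hμd
    have h1 := hdeadr s
    rw [show dead s = dead s' from h] at h1
    have h2 := (Finset.mem_filter.1 s.2).2 s' (Finset.mem_filter.1 s'.2).1 (h1.trans (hdeadr s').symm)
    exact Subtype.ext h2.symm
  have hfib := Finset.card_le_mul_card_image (f := J.connectedComponentMk) S₂ 2 fun K hK => by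
    obtain ⟨s, hs, rfl⟩ := Finset.mem_image.1 hK
    by_contra hlt
    push Not at hlt
    have hsf : s ∈ S₂.filter fun x => J.connectedComponentMk x = J.connectedComponentMk s :=
      Finset.mem_filter.2 ⟨hs, rfl⟩
    have h1 := Finset.card_erase_of_mem hsf
    obtain ⟨b, hb, b', hb', hbb⟩ := Finset.one_lt_card.1 (by omega :
      1 < ((S₂.filter fun x => J.connectedComponentMk x = J.connectedComponentMk s).erase s).card)
    simp only [Finset.mem_erase, Finset.mem_filter, SimpleGraph.ConnectedComponent.eq] at hb hb'
    exact hbb (htwo s (Finset.mem_filter.1 hs).1 b (Finset.mem_filter.1 hb.2.1).1 b'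
      (Finset.mem_filter.1 hb'.2.1).1 hb.2.2.symm hb'.2.2.symm hb.1.symm hb'.1.symm)
  obtain ⟨f, hfi, hf⟩ := exists_injective_of_card_le (ι := Fin m)
    (fun _ => S₂.image J.connectedComponentMk) (fun _ => by rw [Fintype.card_fin]; omega)
  have hpick : ∀ i, ∃ a ∈ S, ∃ b ∈ S, a ≠ b ∧ J.Reachable a b ∧ J.connectedComponentMk a = f i := by
    intro i
    obtain ⟨a, ha, hai⟩ := Finset.mem_image.1 (hf i)
    obtain ⟨haS, ha⟩ := Finset.mem_filter.1 ha
    push Not at ha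
    obtain ⟨b, hb, hab, hne⟩ := ha
    exact ⟨a, haS, b, hb, hne.symm, hab, hai⟩
  choose a ha b hb hab hr hai using hpick
  choose q hq using fun i => (hr i).exists_isPath
  have hsupp : ∀ i, ∀ x ∈ (q i).support, J.connectedComponentMk x = f i := fun i x hx => by
    rw [← hai i, SimpleGraph.ConnectedComponent.eq]
    exact ((q i).takeUntil x hx).reachable.symm
  refine ⟨a, b, fun i => (q i).mapLe hJG, fun i => ⟨?_, ha i, hb i, hab i, ?_, fun x hx hxS => ?_⟩,
    fun i j hij x hx hx' => ?_⟩
  · exact (SimpleGraph.Walk.isPath_mapLe hJG).2 (hq i)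
  · have := Follows.breaks (fun p q h => (hμ p q h).1) (q i) (hb i) false (hfol _ (ha i) _ _ (hq i))
      fun h => absurd h (hab i)
    simpa [breaks] using this
  · rw [SimpleGraph.Walk.support_mapLe_eq_support] at hx
    by_contra hne
    push Not at hne
    have h1 := hsupp i x hx
    rw [← hai i, SimpleGraph.ConnectedComponent.eq] at h1
    exact hne.2 (htwo (a i) (ha i) x hxS (b i) (hb i) h1.symm (hr i) hne.1.symm (hab i))
  · rw [SimpleGraph.Walk.support_mapLe_eq_support] at hx hx'
    exact hij (hfi ((hsupp i x hx).symm.trans (hsupp j x hx')))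

end Breaking

end ParityLinkage
end

section
open scoped Classical
namespace ParityLinkage

/-! ### A small hitting set from many odd parts. -/

section Hitting
variable {V : Type*} {G : SimpleGraph V} {c : V → Bool} {S : Finset V}

theorem Lift.snd_eq_not {p q : Lift S} (h : q.1.1 = p.1.1) (hne : q ≠ p) : q.1.2 = !p.1.2 := by
  by_contra hno
  refine hne (Subtype.ext (Prod.ext h ?_))
  revert hno
  cases q.1.2 <;> cases p.1.2 <;> simp

theorem Lift.snd_eq_false {p : Lift S} (h : p.1.1 ∈ S) : p.1.2 = false := by
  have := p.2
  cases h2 : p.1.2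
  · rfl
  · exact absurd h (this h2)

theorem liftGraph_adj_of_fst {p q : Lift S} (h : q.1.1 = p.1.1) (hne : q ≠ p) :
    (liftGraph G c S).Adj p q := ⟨hne.symm, Or.inl h.symm⟩

/-- `p` is the only copy of its vertex outside `Z`. -/
def IsSingle (Z : Finset (Lift S)) (p : Lift S) : Prop :=
  p ∉ Z ∧ ∀ q : Lift S, q.1.1 = p.1.1 → q ∉ Z → q = p

/-- For each vertex, the number of copies outside `Z`, plus one if this is one, plus two if it is
zero, equals 2; this is summed over all vertices and compared with `card_lift`. -/
theorem card_single [Fintype V] (Z : Finset (Lift S)) :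
    (Finset.univ.filter (IsSingle Z)).card +
      2 * (Finset.univ.filter fun v : V => ∀ p : Lift S, p.1.1 = v → p ∈ Z).card =
      S.card + Z.card := by
  have h1 := Finset.card_eq_sum_card_fiberwise (f := fun p : Lift S => p.1.1)
    (s := Zᶜ) (t := Finset.univ) (fun _ _ => by simp)
  have h2 := Finset.card_eq_sum_card_fiberwise (f := fun p : Lift S => p.1.1)
    (s := Finset.univ.filter (IsSingle Z)) (t := Finset.univ) (fun _ _ => by simp)
  have h3 : ∀ v : V, (Zᶜ.filter fun p => p.1.1 = v).card +
      ((Finset.univ.filter (IsSingle Z)).filter fun p => p.1.1 = v).card +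
      2 * (if ∀ p : Lift S, p.1.1 = v → p ∈ Z then 1 else 0) = 2 := by
    intro v
    by_cases h : ∀ p : Lift S, p.1.1 = v → p ∈ Z
    · rw [if_pos h, Finset.card_eq_zero.2, Finset.card_eq_zero.2]
      · refine Finset.filter_eq_empty_iff.2 fun p hp hpv => ?_
        exact (Finset.mem_filter.1 hp).2.1 (h p hpv)
      · refine Finset.filter_eq_empty_iff.2 fun p hp hpv => ?_
        exact Finset.mem_compl.1 hp (h p hpv)
    · rw [if_neg h]
      push Not at h
      obtain ⟨p, hpv, hpZ⟩ := h
      by_cases hs : IsSingle Z p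
      · have e1 : (Zᶜ.filter fun p => p.1.1 = v) = {p} := by
          ext q
          simp only [Finset.mem_filter, Finset.mem_compl, Finset.mem_singleton]
          exact ⟨fun hq => hs.2 q (hq.2.trans hpv.symm) hq.1, fun hq => hq ▸ ⟨hpZ, hpv⟩⟩
        have e2 : ((Finset.univ.filter (IsSingle Z)).filter fun p => p.1.1 = v) = {p} := by
          ext q
          simp only [Finset.mem_filter, Finset.mem_univ, true_and, Finset.mem_singleton]
          exact ⟨fun hq => hs.2 q (hq.2.trans hpv.symm) hq.1.1, fun hq => hq ▸ ⟨hs, hpv⟩⟩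
        rw [e1, e2]; simp
      · have hs' : ∃ q : Lift S, q.1.1 = p.1.1 ∧ q ∉ Z ∧ q ≠ p := by
          by_contra hno
          push Not at hno
          exact hs ⟨hpZ, hno⟩
        obtain ⟨q, hqp, hqZ, hne⟩ := hs'
        have e1 : (Zᶜ.filter fun p => p.1.1 = v) = {p, q} := by
          ext r
          simp only [Finset.mem_filter, Finset.mem_compl, Finset.mem_singleton, Finset.mem_insert]
          constructor
          · rintro ⟨-, hr⟩
            by_contra hcon
            push Not at hcon
            have g1 := Lift.snd_eq_not (hr.trans hpv.symm) hcon.1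
            have g2 := Lift.snd_eq_not hqp hne
            exact hcon.2 (Subtype.ext (Prod.ext (hr.trans (hqp.trans hpv).symm) (g1.trans g2.symm)))
          · rintro (rfl | rfl)
            exacts [⟨hpZ, hpv⟩, ⟨hqZ, hqp.trans hpv⟩]
        have e2 : ((Finset.univ.filter (IsSingle Z)).filter fun p => p.1.1 = v) = ∅ := by
          refine Finset.filter_eq_empty_iff.2 fun r hr hrv => ?_
          have hr := (Finset.mem_filter.1 hr).2
          exact hne ((hr.2 q (hqp.trans (hpv.trans hrv.symm)) hqZ).trans
            (hr.2 p (hpv.trans hrv.symm) hpZ).symm)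
        rw [e1, e2, Finset.card_pair hne.symm]; simp
  have h4 := Finset.sum_congr (rfl : (Finset.univ : Finset V) = Finset.univ) fun v _ => h3 v
  rw [Finset.sum_add_distrib, Finset.sum_add_distrib, ← h1, ← h2, ← Finset.mul_sum,
    ← Finset.card_filter, Finset.sum_const, Finset.card_univ, smul_eq_mul, Finset.card_compl] at h4
  have h5 := card_lift S
  have h6 := Finset.card_le_univ Z
  omega

/-- The path is lifted to the copies outside `Z`, keeping in the current component an element `w` of
`L` that is over the current vertex or off the rest of the path. If the next copy survives, it is
not single, as it would then be `w`; so the other copy survives too and the lift continues there. If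
it does not survive, the other copy is single, lies in `L`, and becomes the new `w`. At the end,
parity demands the copy `true` of a vertex of `S`, which does not exist. -/
theorem not_breaks_of_transversal [Fintype V] {Z L : Finset (Lift S)} {X : Finset V}
    (hL : ∀ w ∈ L, ∀ w' ∈ L, Conn (liftGraph G c S) Zᶜ w w' → w = w')
    (hX : ∀ v ∉ X, (∃ p : Lift S, p.1.1 = v ∧ p ∉ Z) ∧
      ∀ p : Lift S, p.1.1 = v → IsSingle Z p → p ∈ L)
    {v b : V} (q : G.Walk v b) (hb : b ∈ S) : ∀ (e : Bool) (p : Lift S), q.IsPath →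
    (∀ x ∈ q.support, x ∉ X) → (e ^^ breaks c q) = true → p.1 = (v, e) → p ∉ Z →
    (∃ w ∈ L, (w.1.1 = v ∨ w.1.1 ∉ q.support) ∧ Conn (liftGraph G c S) Zᶜ w p) → False := by
  induction q with
  | nil =>
    intro e p _ _ he hp _ _
    have := Lift.snd_eq_false (p := p) (by rw [hp]; exact hb)
    rw [hp] at this
    simp at he this
    simp [this] at he
  | @cons v y b h q ih =>
    rintro e p hq hqX he hp hpZ ⟨w, hwL, hwv, hwp⟩
    rw [SimpleGraph.Walk.cons_isPath_iff] at hq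
    set f := if c v = c y then e else !e with hf
    have he' : ((!f) ^^ breaks c q) = true := by
      rw [breaks_cons] at he
      rw [← he, hf]
      cases c v <;> cases c y <;> cases e <;> cases breaks c q <;> rfl
    have hqX' : ∀ x ∈ q.support, x ∉ X := fun x hx => hqX x (by simp [hx])
    have hyq : y ∈ q.support := q.start_mem_support
    obtain ⟨hy1, hy2⟩ := hX y (hqX' y hyq)
    by_cases hA : ∃ r : Lift S, r.1 = (y, f) ∧ r ∉ Z
    · obtain ⟨r, hr, hrZ⟩ := hA
      have hpr : (liftGraph G c S).Adj p r := by
        refine ⟨fun h' => h.ne ?_, Or.inr ?_⟩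
        · have := congrArg (fun z : Lift S => z.1.1) h'
          simpa [hp, hr] using this
        · rw [hp, hr]
          refine ⟨h, ?_⟩
          dsimp only
          rw [hf]
          cases c v <;> cases c y <;> cases e <;> simp
      have hwr := hwp.trans (Conn.of_adj hpr (Finset.mem_compl.2 hpZ) (Finset.mem_compl.2 hrZ))
      have hwq : w.1.1 ∉ q.support := by
        rcases hwv with h' | h'
        · rw [h']; exact hq.2
        · exact fun h'' => h' (by simp [h''])
      by_cases hs : IsSingle Z r
      · have := hL w hwL r (hy2 r (by rw [hr]) hs) hwr
        rw [this, hr] at hwq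
        exact hwq hyq
      · have hs' : ∃ q : Lift S, q.1.1 = r.1.1 ∧ q ∉ Z ∧ q ≠ r := by
          by_contra hno
          push Not at hno
          exact hs ⟨hrZ, hno⟩
        obtain ⟨r', hr', hrZ', hne⟩ := hs'
        refine ih hb (!f) r' hq.1 hqX' he' (Prod.ext (by rw [hr', hr]) ?_) hrZ' ⟨w, hwL, Or.inr hwq, ?_⟩
        · rw [Lift.snd_eq_not hr' hne, hr]
        · exact hwr.trans (Conn.of_adj (liftGraph_adj_of_fst hr' hne) (Finset.mem_compl.2 hrZ)
            (Finset.mem_compl.2 hrZ'))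
    · obtain ⟨r, hr, hrZ⟩ := hy1
      have hall : ∀ r : Lift S, r.1.1 = y → r ∉ Z → r.1.2 = !f := fun r hr hrZ => by
        by_contra hne
        refine hA ⟨r, Prod.ext hr ?_, hrZ⟩
        revert hne
        cases r.1.2 <;> cases f <;> simp
      refine ih hb (!f) r hq.1 hqX' he' (Prod.ext hr (hall r hr hrZ)) hrZ
        ⟨r, hy2 r hr ⟨hrZ, fun r' hr' hrZ' => ?_⟩, Or.inl hr, Conn.rfl⟩
      exact Subtype.ext (Prod.ext hr' ((hall r' (hr'.trans hr) hrZ').trans (hall r hr hrZ).symm))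

/-- Many odd parts of the lifted graph give a small set meeting all breaking paths. -/
theorem exists_hitting_of_odd_family [Fintype V] {d m : ℕ} (hd : S.card = d + 2 * m)
    {Z : Finset (Lift S)} {n : ℕ} {C : Fin n → Finset (Lift S)} (hn : Z.card + d < n)
    (hC : ∀ i, Odd (C i).card ∧ Disjoint (C i) Z ∧
      ∀ a ∈ C i, ∀ b ∉ Z, (liftGraph G c S).Adj a b → b ∈ C i)
    (hCd : ∀ i j, i ≠ j → Disjoint (C i) (C j)) :
    ∃ X : Finset V, X.card + 1 ≤ 2 * m ∧ ∀ a ∈ S, ∀ b ∈ S, ∀ q : G.Walk a b, q.IsPath →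
      breaks c q = true → ∃ x ∈ q.support, x ∈ X := by
  set F := liftGraph G c S with hF
  set comp := (res F Zᶜ).connectedComponentMk with hcomp
  set W : Finset (Lift S) := Finset.univ.filter (IsSingle Z) with hW
  set 𝒦 := W.image comp with h𝒦
  have hcompC : ∀ p q, comp p = comp q ↔ Conn F Zᶜ p q := fun p q =>
    SimpleGraph.ConnectedComponent.eq
  have hCc : ∀ i, ∀ p ∈ C i, ∀ q, Conn F Zᶜ p q → q ∈ C i := fun i p hp q hpq =>
    hpq.closed (· ∈ C i) hp fun u v hu huv _ hv => (hC i).2.2 u hu v (Finset.mem_compl.1 hv) huv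
  -- Otherwise exchanging the two copies of each vertex would be a fixed-point-free involution of an
  -- odd set.
  have hsing : ∀ i, ∃ p ∈ C i, IsSingle Z p := by
    intro i
    by_contra hno
    push Not at hno
    have hCZ : ∀ p ∈ C i, p ∉ Z := fun p hp => Finset.disjoint_left.1 (hC i).2.1 hp
    have hch : ∀ p ∈ C i, ∃ q : Lift S, q.1.1 = p.1.1 ∧ q ∉ Z ∧ q ≠ p := fun p hp => by
      by_contra hcon
      push Not at hcon
      exact hno p hp ⟨hCZ p hp, hcon⟩
    have : Nonempty (Lift S) := by
      by_contra hemp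
      have h0 : C i = ∅ := Finset.eq_empty_of_forall_notMem fun p _ => hemp ⟨p⟩
      have := (hC i).1
      rw [h0] at this
      simp at this
    choose! g hg1 hg2 hg3 using hch
    refine (Nat.not_even_iff_odd.2 (hC i).1) (even_card_of_involution _ g fun p hp => ?_)
    have hgp : g p ∈ C i := (hC i).2.2 p hp _ (hg2 p hp) (liftGraph_adj_of_fst (hg1 p hp) (hg3 p hp))
    refine ⟨hgp, hg3 p hp, Subtype.ext (Prod.ext ((hg1 _ hgp).trans (hg1 p hp)) ?_)⟩
    rw [Lift.snd_eq_not (hg1 _ hgp) (hg3 _ hgp), Lift.snd_eq_not (hg1 p hp) (hg3 p hp), Bool.not_not]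
  choose σ hσC hσ using hsing
  have hn𝒦 : n ≤ 𝒦.card := by
    have := Finset.card_le_card_of_injOn (s := (Finset.univ : Finset (Fin n))) (t := 𝒦)
      (fun i => comp (σ i)) (fun i _ => Finset.mem_image_of_mem _
        (Finset.mem_filter.2 ⟨Finset.mem_univ _, hσ i⟩)) fun i _ j _ hij => by
        by_contra hne
        exact Finset.disjoint_left.1 (hCd i j hne) (hCc i _ (hσC i) _ ((hcompC _ _).1 hij)) (hσC j)
    simpa using this
  have hrep : ∀ K : 𝒦, ∃ w ∈ W, comp w = K.1 := fun K => by
    obtain ⟨w, hw, h⟩ := Finset.mem_image.1 K.2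
    exact ⟨w, hw, h⟩
  choose g hgW hg using hrep
  set L := (Finset.univ : Finset 𝒦).image g with hL
  have hLW : L ⊆ W := fun w hw => by
    obtain ⟨K, -, rfl⟩ := Finset.mem_image.1 hw
    exact hgW K
  have hLc : L.card = 𝒦.card := by
    rw [hL, Finset.card_image_of_injective, Finset.card_univ, Fintype.card_coe]
    intro K K' h
    exact Subtype.ext ((hg K).symm.trans ((congrArg comp h).trans (hg K')))
  have hLu : ∀ w ∈ L, ∀ w' ∈ L, Conn F Zᶜ w w' → w = w' := by
    intro w hw w' hw' h
    obtain ⟨K, -, rfl⟩ := Finset.mem_image.1 hw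
    obtain ⟨K', -, rfl⟩ := Finset.mem_image.1 hw'
    have := (hcompC _ _).2 h
    rw [hg, hg] at this
    rw [Subtype.ext this]
  set B : Finset V := Finset.univ.filter fun v : V => ∀ p : Lift S, p.1.1 = v → p ∈ Z with hB
  have hcount := card_single Z
  rw [← hW, ← hB] at hcount
  -- The vertices without surviving copy, and those of all single copies except one per component.
  -- Since at least `n > |Z| + d` components contain a single copy, `card_single` bounds |X| by 2m -
  -- 1.
  set X := B ∪ (W \ L).image (fun p => p.1.1) with hXdef
  have hXv : ∀ v ∉ X, (∃ p : Lift S, p.1.1 = v ∧ p ∉ Z) ∧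
      ∀ p : Lift S, p.1.1 = v → IsSingle Z p → p ∈ L := by
    intro v hv
    rw [hXdef, Finset.mem_union, not_or] at hv
    constructor
    · by_contra hno
      push Not at hno
      exact hv.1 (Finset.mem_filter.2 ⟨Finset.mem_univ _, hno⟩)
    · intro p hp hs
      by_contra hpL
      exact hv.2 (Finset.mem_image.2 ⟨p, Finset.mem_sdiff.2
        ⟨Finset.mem_filter.2 ⟨Finset.mem_univ _, hs⟩, hpL⟩, hp⟩)
  refine ⟨X, ?_, fun a ha b hb q hq hbr => ?_⟩
  · have h1 : X.card ≤ B.card + (W \ L).card :=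
      (Finset.card_union_le _ _).trans (Nat.add_le_add_left Finset.card_image_le _)
    have h2 := Finset.card_sdiff_add_card_eq_card hLW
    omega
  · by_contra hno
    push Not at hno
    obtain ⟨⟨p, hpa, hpZ⟩, hpL⟩ := hXv a (hno a q.start_mem_support)
    have hp2 := Lift.snd_eq_false (p := p) (hpa ▸ ha)
    refine not_breaks_of_transversal hLu hXv q hb false p hq hno (by simpa using hbr)
      (Prod.ext hpa hp2) hpZ ⟨p, hpL p hpa ⟨hpZ, fun r hr _ => ?_⟩, Or.inl hpa, Conn.rfl⟩
    exact Subtype.ext (Prod.ext hr ((Lift.snd_eq_false (hr.trans hpa ▸ ha)).trans hp2.symm))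

/-- Either there are many disjoint breaking paths between vertices of `S`, or few vertices meet all
of them. -/
theorem exists_breaking_paths_or_hitting [Fintype V] (G : SimpleGraph V) (c : V → Bool) (S : Finset V)
    {m : ℕ} (hm : 2 * m ≤ S.card) :
    (∃ (a b : Fin m → V) (Q : ∀ i, G.Walk (a i) (b i)),
      (∀ i, (Q i).IsPath ∧ a i ∈ S ∧ b i ∈ S ∧ a i ≠ b i ∧ breaks c (Q i) = true ∧
        ∀ x ∈ (Q i).support, x ∈ S → x = a i ∨ x = b i) ∧
      ∀ i j, i ≠ j → List.Disjoint (Q i).support (Q j).support) ∨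
    ∃ X : Finset V, X.card + 1 ≤ 2 * m ∧ ∀ a ∈ S, ∀ b ∈ S, ∀ q : G.Walk a b, q.IsPath →
      breaks c q = true → ∃ x ∈ q.support, x ∈ X := by
  obtain ⟨d, hd⟩ : ∃ d, S.card = d + 2 * m := ⟨S.card - 2 * m, by omega⟩
  have hpar : Even (Fintype.card (Lift S) + d) := by
    have := card_lift S
    rw [Nat.even_iff]
    omega
  rcases exists_matching_or_odd_family (liftGraph G c S) hpar with ⟨μ, hμ, hμd⟩ | ⟨Z, n, C, hn, hC, hCd⟩
  · exact Or.inl (exists_breaking_paths_of_matching hd μ hμ hμd)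
  · exact Or.inr (exists_hitting_of_odd_family hd hn hC hCd)

end Hitting

end ParityLinkage
end

section
open scoped Classical
namespace ParityLinkage

/-! ### Routes of prescribed parity and odd cycles. -/

section Route
variable {V : Type*} {G H J : SimpleGraph V} {c : V → Bool} {S S' : Finset V} {a b x : V} {β β' : Bool}

theorem isPath_append {p : G.Walk a x} {q : G.Walk x b} (hp : p.IsPath) (hq : q.IsPath)
    (h : ∀ z ∈ p.support, z ∈ q.support → z = x) : (p.append q).IsPath := by
  rw [SimpleGraph.Walk.isPath_def, SimpleGraph.Walk.support_append]
  have hq' := hq.support_nodup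
  rw [← SimpleGraph.Walk.cons_tail_support] at hq'
  refine List.Nodup.append hp.support_nodup (List.nodup_cons.1 hq').2 fun z hz hz' => ?_
  have := h z hz (List.mem_of_mem_tail hz')
  rw [this] at hz'
  exact (List.nodup_cons.1 hq').1 hz'

theorem eq_of_isPath_append {p : G.Walk a x} {q : G.Walk x b} (h : (p.append q).IsPath) {z : V}
    (hz : z ∈ p.support) (hz' : z ∈ q.support) : z = x := by
  have h1 := h.support_nodup
  rw [SimpleGraph.Walk.support_append] at h1
  rw [← SimpleGraph.Walk.cons_tail_support, List.mem_cons] at hz'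
  exact hz'.resolve_right fun h2 => (List.disjoint_of_nodup_append h1) hz h2

/-- A path from `a` to `b` inside `S` with a given number of breaking edges modulo two. -/
def Route (G : SimpleGraph V) (c : V → Bool) (S : Finset V) (a b : V) (β : Bool) : Prop :=
  ∃ p : G.Walk a b, p.IsPath ∧ (∀ x ∈ p.support, x ∈ S) ∧ breaks c p = β

theorem Route.start_mem (h : Route G c S a b β) : a ∈ S := by
  obtain ⟨p, -, h, -⟩ := h
  exact h a p.start_mem_support

theorem Route.end_mem (h : Route G c S a b β) : b ∈ S := by
  obtain ⟨p, -, h, -⟩ := h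
  exact h b p.end_mem_support

theorem Route.mono (h : Route G c S a b β) (hS : S ⊆ S') : Route G c S' a b β := by
  obtain ⟨p, h1, h2, h3⟩ := h
  exact ⟨p, h1, fun x hx => hS (h2 x hx), h3⟩

theorem Route.mono_graph (h : Route H c S a b β) (hG : H ≤ G) : Route G c S a b β := by
  obtain ⟨p, h1, h2, h3⟩ := h
  refine ⟨p.mapLe hG, (SimpleGraph.Walk.isPath_mapLe hG).2 h1, fun x hx => ?_, ?_⟩
  · rw [SimpleGraph.Walk.support_mapLe_eq_support] at hx
    exact h2 x hx
  · rw [← h3]; simp [breaks]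

theorem Route.symm (h : Route G c S a b β) : Route G c S b a β := by
  obtain ⟨p, h1, h2, h3⟩ := h
  refine ⟨p.reverse, h1.reverse, fun x hx => h2 x (by simpa using hx), ?_⟩
  rw [← h3, breaks, breaks, SimpleGraph.Walk.length_reverse, Bool.xor_comm (c b)]

theorem Route.append (h : Route G c S a x β) (h' : Route G c S' x b β')
    (hS : ∀ z ∈ S, z ∈ S' → z = x) : Route G c (S ∪ S') a b (β ^^ β') := by
  obtain ⟨p, h1, h2, h3⟩ := h
  obtain ⟨p', h1', h2', h3'⟩ := h'
  refine ⟨p.append p', isPath_append h1 h1' fun z hz hz' => hS z (h2 z hz) (h2' z hz'),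
    fun z hz => ?_, by rw [breaks_append, h3, h3']⟩
  rcases (SimpleGraph.Walk.mem_support_append_iff _ _).1 hz with hz | hz
  · exact Finset.mem_union_left _ (h2 z hz)
  · exact Finset.mem_union_right _ (h2' z hz)

theorem Route.refl (ha : a ∈ S) : Route G c S a a false :=
  ⟨.nil, by simp, by simpa using ha, breaks_nil⟩

theorem Route.of_adj (h : G.Adj a b) : Route G c {a, b} a b (!(c a ^^ c b)) :=
  ⟨.cons h .nil, by simp [h.ne], by simp, by rw [breaks_cons]; simp⟩

theorem Route.of_isPath {p : G.Walk a b} (hp : p.IsPath) :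
    Route G c p.support.toFinset a b (breaks c p) :=
  ⟨p, hp, fun x hx => by simpa using hx, rfl⟩

theorem Conn.exists_route (h : Conn G S a b) (ha : a ∈ S) : ∃ β, Route G c S a b β := by
  obtain ⟨p, h1, h2⟩ := h.exists_walk ha
  exact ⟨_, p, h1, h2, rfl⟩

theorem breaks_eq_false (hc : ∀ a b, H.Adj a b → c a ≠ c b) (p : H.Walk a b) :
    breaks c p = false := by
  induction p with
  | nil => simp
  | cons h p ih =>
    rw [breaks_cons, ih]
    have := hc _ _ h
    revert this
    rename_i u v w
    cases c u <;> cases c v <;> simp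

theorem Conn.route (hc : ∀ a b, H.Adj a b → c a ≠ c b) (h : Conn H S a b) (ha : a ∈ S) :
    Route H c S a b false := by
  obtain ⟨p, h1, h2⟩ := h.exists_walk ha
  exact ⟨p, h1, h2, breaks_eq_false hc p⟩

/-- The two arcs of an odd cycle, given as a path closed up by an edge. -/
theorem route_arcs {u v x y : V} (huv : J.Adj u v) {p₁ : J.Walk v x} {p₂ : J.Walk x y}
    {p₃ : J.Walk y u} (hp : (p₁.append (p₂.append p₃)).IsPath)
    (hlen : Even (p₁.append (p₂.append p₃)).length) (hxy : x ≠ y) {O : Finset V}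
    (hO : ∀ z ∈ (p₁.append (p₂.append p₃)).support, z ∈ O) : Route J c O x y β := by
  have hp' := hp.of_append_right
  have hO' : ∀ z, z ∈ p₁.support ∨ z ∈ p₂.support ∨ z ∈ p₃.support → z ∈ O := fun z hz =>
    hO z (by rw [SimpleGraph.Walk.mem_support_append_iff, SimpleGraph.Walk.mem_support_append_iff]
             exact hz)
  have hdis : ∀ z ∈ p₁.support, z ∉ p₃.support := fun z hz hz' => by
    have h1 := eq_of_isPath_append hp hz
      ((SimpleGraph.Walk.mem_support_append_iff _ _).2 (Or.inr hz'))
    exact hxy (eq_of_isPath_append hp' p₂.start_mem_support (h1 ▸ hz'))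
  have r₁ : Route J c O x y (breaks c p₂) :=
    ⟨p₂, hp'.of_append_left, fun z hz => hO' z (Or.inr (Or.inl hz)), rfl⟩
  have r₂ : Route J c O y x (breaks c p₃ ^^ (!(c u ^^ c v) ^^ breaks c p₁)) := by
    refine ⟨p₃.append (.cons huv p₁), isPath_append hp'.of_append_right ?_ fun z hz hz' => ?_,
      fun z hz => ?_, by rw [breaks_append, breaks_cons]⟩
    · rw [SimpleGraph.Walk.cons_isPath_iff]
      exact ⟨hp.of_append_left, fun h => hdis u h p₃.end_mem_support⟩
    · rw [SimpleGraph.Walk.support_cons, List.mem_cons] at hz'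
      exact hz'.resolve_right fun h => hdis z h hz
    · rw [SimpleGraph.Walk.mem_support_append_iff, SimpleGraph.Walk.support_cons, List.mem_cons] at hz
      rcases hz with h | rfl | h
      exacts [hO' z (Or.inr (Or.inr h)), hO' z (Or.inr (Or.inr p₃.end_mem_support)), hO' z (Or.inl h)]
  have hsum : (breaks c p₂ ^^ (breaks c p₃ ^^ (!(c u ^^ c v) ^^ breaks c p₁))) = true := by
    have h1 : breaks c (p₁.append (p₂.append p₃)) = (c v ^^ c u) := by
      rw [breaks]
      have : (p₁.append (p₂.append p₃)).length.bodd = false := by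
        obtain ⟨n, hn⟩ := hlen
        rw [hn, Nat.bodd_add]; simp
      rw [this]; simp
    rw [breaks_append, breaks_append] at h1
    revert h1
    cases breaks c p₁ <;> cases breaks c p₂ <;> cases breaks c p₃ <;> cases c u <;> cases c v <;> simp
  by_cases hβ : breaks c p₂ = β
  · exact hβ ▸ r₁
  · convert r₂.symm using 1
    revert hβ hsum
    generalize (breaks c p₃ ^^ (!(c u ^^ c v) ^^ breaks c p₁)) = γ
    cases breaks c p₂ <;> cases β <;> cases γ <;> simp

/-- A graph that is not bipartite contains an odd cycle: a set in which any two vertices are joined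
by paths of both parities. -/
theorem exists_odd_cycle (hJ : ¬ J.Colorable 2) : ∃ O : Finset V, 2 ≤ O.card ∧
    (∀ x ∈ O, ∃ y, J.Adj x y) ∧ ∀ x ∈ O, ∀ y ∈ O, x ≠ y → ∀ β, Route J c O x y β := by
  -- A shortest odd closed walk, seen as one edge followed by an even walk back; a repeated vertex
  -- would split off a shorter one, so the walk is a path.
  have hex : ∃ n, ∃ (u v : V) (_ : J.Adj u v) (p : J.Walk v u), Even p.length ∧ p.length = n := by
    rw [SimpleGraph.two_colorable_iff_forall_loop_even] at hJ
    push Not at hJ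
    obtain ⟨u, w, hw⟩ := hJ
    cases w with
    | nil => simp at hw
    | cons h p =>
      rw [SimpleGraph.Walk.length_cons, Nat.not_even_iff_odd, Nat.odd_add_one, Nat.not_odd_iff_even] at hw
      exact ⟨_, _, _, h, p, hw, rfl⟩
  obtain ⟨u, v, huv, p, hp, hpn⟩ := Nat.find_spec hex
  have hmin : ∀ (u v : V) (_ : J.Adj u v) (q : J.Walk v u), Even q.length → p.length ≤ q.length :=
    fun u v h q hq => hpn ▸ Nat.find_min' hex ⟨u, v, h, q, hq, rfl⟩
  clear hpn
  have hpath : p.IsPath := by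
    rw [SimpleGraph.Walk.isPath_iff_isSubwalk_imp_nil]
    rintro z w ⟨r, r', hr⟩
    by_contra hnil
    have hlen := congrArg SimpleGraph.Walk.length hr
    rw [SimpleGraph.Walk.length_append, SimpleGraph.Walk.length_append] at hlen
    have hpos : 0 < w.length := by
      by_contra h0
      exact hnil (SimpleGraph.Walk.length_eq_zero_iff.1 (by omega))
    by_cases hw : Even w.length
    · have := hmin u v huv (r.append r') (by
        rw [SimpleGraph.Walk.length_append, Nat.even_iff]
        rw [Nat.even_iff] at hw hp
        omega)
      rw [SimpleGraph.Walk.length_append] at this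
      omega
    · cases w with
      | nil => simp at hpos
      | cons h q =>
        rw [SimpleGraph.Walk.length_cons] at hlen hw
        have := hmin _ _ h q (by rw [Nat.even_iff] at hw ⊢; omega)
        omega
  refine ⟨p.support.toFinset, ?_, fun x hx => ?_, fun x hx y hy hxy β => ?_⟩
  · rw [← Finset.card_pair huv.ne]
    refine Finset.card_le_card fun z hz => ?_
    rw [Finset.mem_insert, Finset.mem_singleton] at hz
    rw [List.mem_toFinset]
    rcases hz with rfl | rfl
    exacts [p.end_mem_support, p.start_mem_support]
  · rw [List.mem_toFinset] at hx
    clear hmin hp hpath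
    induction p with
    | nil => exact absurd huv (by simp)
    | cons h q ih =>
      rw [SimpleGraph.Walk.support_cons, List.mem_cons] at hx
      rcases hx with rfl | hx
      · exact ⟨_, h⟩
      · cases q with
        | nil => rw [SimpleGraph.Walk.support_nil, List.mem_singleton] at hx; exact hx ▸ ⟨_, h.symm⟩
        | cons h' q' =>
          rw [SimpleGraph.Walk.support_cons, List.mem_cons] at hx
          rcases hx with rfl | hx
          · exact ⟨_, h'⟩
          · obtain ⟨n, h1, h2⟩ := SimpleGraph.Walk.mem_support_iff_exists_getVert.1 hx
            by_cases hn : n < q'.length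
            · exact ⟨_, h1 ▸ q'.adj_getVert_succ hn⟩
            · rw [show n = q'.length by omega, SimpleGraph.Walk.getVert_length] at h1
              exact ⟨_, h1 ▸ huv⟩
  · rw [List.mem_toFinset] at hx hy
    have hspec := p.take_spec hx
    have hy' := hy
    rw [← hspec, SimpleGraph.Walk.mem_support_append_iff] at hy'
    rcases hy' with hy' | hy'
    · have h2 := (p.takeUntil x hx).take_spec hy'
      have h3 : ((p.takeUntil x hx).takeUntil y hy').append
          (((p.takeUntil x hx).dropUntil y hy').append (p.dropUntil x hx)) = p := by
        rw [SimpleGraph.Walk.append_assoc, h2, hspec]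
      exact (route_arcs huv (h3.symm ▸ hpath) (h3.symm ▸ hp) hxy.symm fun z hz => by
        rw [h3] at hz; simpa using hz).symm
    · have h2 := (p.dropUntil x hx).take_spec hy'
      have h3 : (p.takeUntil x hx).append (((p.dropUntil x hx).takeUntil y hy').append
          ((p.dropUntil x hx).dropUntil y hy')) = p := by
        rw [h2, hspec]
      exact route_arcs huv (h3.symm ▸ hpath) (h3.symm ▸ hp) hxy fun z hz => by
        rw [h3] at hz; simpa using hz

/-- In a `2`-connected graph that is not bipartite, two of any vertices are joined by a breaking
path. -/
theorem exists_breaking_route [Fintype V] {C : Finset V}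
    (hconn : ∀ Z : Finset V, Z.card ≤ 1 → ∀ a ∈ C \ Z, ∀ b ∈ C \ Z, Conn G (C \ Z) a b)
    (hC : ¬ (res G C).Colorable 2) {S : Finset V} (hSC : S ⊆ C) (hS : 2 ≤ S.card) :
    ∃ a ∈ S, ∃ b ∈ S, Route (res G C) c C a b true := by
  obtain ⟨O, hO2, hOadj, hO⟩ := exists_odd_cycle (c := c) hC
  have hOC : O ⊆ C := fun x hx => by
    obtain ⟨y, hy⟩ := hOadj x hx
    exact hy.2.1
  -- Two disjoint connectors from `S` to the odd cycle; the arc between their ends is chosen so that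
  -- the whole path breaks.
  obtain ⟨T, hTd, hT⟩ := menger (G := res G C) S O 2 fun Z hZ => by
    by_contra hlt
    obtain ⟨a, ha, haZ⟩ := Finset.exists_mem_notMem_of_card_lt_card (by omega : Z.card < S.card)
    obtain ⟨o, ho, hoZ⟩ := Finset.exists_mem_notMem_of_card_lt_card (by omega : Z.card < O.card)
    refine hZ a ha o ho haZ hoZ ?_
    refine (hconn Z (by omega) a (Finset.mem_sdiff.2 ⟨hSC ha, haZ⟩) o
      (Finset.mem_sdiff.2 ⟨hOC ho, hoZ⟩)).closed (fun w => Conn (res G C) Zᶜ a w) Conn.rfl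
      fun u v hu huv huS hvS => ?_
    rw [Finset.mem_sdiff] at huS hvS
    exact hu.trans (Conn.of_adj ⟨huv, huS.1, hvS.1⟩ (by simpa using huS.2) (by simpa using hvS.2))
  choose a ha b hb haT hbT hab using hT
  choose T' hT'T o ho haT' hTO hTc _ using fun i => (hab i).trim (haT i) (hb i)
  have hd : Disjoint (T' 0) (T' 1) := (hTd (by decide : (0 : Fin 2) ≠ 1)).mono (hT'T 0) (hT'T 1)
  have hoT : ∀ i, o i ∈ T' i := fun i =>
    (Finset.mem_inter.1 ((hTO i).symm ▸ Finset.mem_singleton_self _ : o i ∈ T' i ∩ O)).1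
  have hne : o 0 ≠ o 1 := fun h => Finset.disjoint_left.1 hd (hoT 0) (h ▸ hoT 1)
  obtain ⟨β₀, r₀⟩ := (hTc 0).exists_route (c := c) (haT' 0)
  obtain ⟨β₁, r₁⟩ := (hTc 1).exists_route (c := c) (haT' 1)
  have hinter : ∀ i, ∀ z ∈ T' i, z ∈ O → z = o i := fun i z h1 h2 => by
    have : z ∈ T' i ∩ O := Finset.mem_inter.2 ⟨h1, h2⟩
    rw [hTO] at this
    exact Finset.mem_singleton.1 this
  have hr := (r₀.append (hO _ (ho 0) _ (ho 1) hne (!(β₀ ^^ β₁))) (hinter 0)).append r₁.symm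
    fun z hz hz' => by
      rcases Finset.mem_union.1 hz with hz | hz
      · exact absurd hz' (Finset.disjoint_left.1 hd hz)
      · exact hinter 1 z hz' hz
  obtain ⟨p, h1, h2, h3⟩ := hr
  refine ⟨a 0, ha 0, a 1, ha 1, p, h1, fun z hz => ?_, by rw [h3]; cases β₀ <;> cases β₁ <;> rfl⟩
  by_cases hnil : p.Nil
  · rw [SimpleGraph.Walk.nil_iff_support_eq.1 hnil, List.mem_singleton] at hz
    exact hz ▸ hSC (ha 0)
  · obtain ⟨n, h4, h5⟩ := SimpleGraph.Walk.mem_support_iff_exists_getVert.1 hz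
    by_cases hn : n < p.length
    · exact h4 ▸ (p.adj_getVert_succ hn).2.1
    · rw [show n = p.length by omega, SimpleGraph.Walk.getVert_length] at h4
      exact h4 ▸ hSC (ha 1)

end Route

end ParityLinkage
end

section
open scoped Classical
namespace ParityLinkage

/-! ### Assembling routes from fixed pieces and a linkage. -/

section Plan
variable {V : Type*} {G H : SimpleGraph V} {c : V → Bool} {U X M A B Q : Finset V}
  {s t x y a b : V} {β β' β'' : Bool}

/-- Joining certain disjoint pairs of vertices of `M ∩ U` by disjoint non-breaking paths that meet
`M` only in their ends results in a path from `s` to `t` with the prescribed number of breaking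
edges modulo two. -/
def Plan (G : SimpleGraph V) (c : V → Bool) (U M : Finset V) (s t : V) (β : Bool) : Prop :=
  ∃ (n : ℕ) (src dst : Fin n → V), Function.Injective (Sum.elim src dst) ∧
    (∀ j, src j ∈ M ∧ src j ∈ U ∧ dst j ∈ M ∧ dst j ∈ U) ∧
    ∀ L : Fin n → Finset V, Pairwise (fun i j => Disjoint (L i) (L j)) →
      (∀ j, Route G c (L j) (src j) (dst j) false) →
      (∀ j, ∀ z ∈ L j, z ∈ M → z = src j ∨ z = dst j) →
      Route G c (M ∪ Finset.univ.biUnion L) s t β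

theorem Plan.symm (h : Plan G c U M s t β) : Plan G c U M t s β := by
  obtain ⟨n, src, dst, h1, h2, h3⟩ := h
  exact ⟨n, src, dst, h1, h2, fun L hL hr hM => (h3 L hL hr hM).symm⟩

theorem Route.plan (h : Route G c A s t β) (hA : A ⊆ M) : Plan G c U M s t β :=
  ⟨0, Fin.elim0, Fin.elim0, fun z => z.elim (fun i => i.elim0) fun i => i.elim0, fun i => i.elim0,
    fun _ _ _ _ => h.mono (hA.trans Finset.subset_union_left)⟩

/-- Only the join from `x` to `y` is left to the linkage, and it contributes nothing to the parity.
-/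
theorem Plan.of_arms (hA : Route G c A s x β) (hB : Route G c B y t β') (hAB : Disjoint A B)
    (hAM : A ⊆ M) (hBM : B ⊆ M) (hx : x ∈ U) (hy : y ∈ U) : Plan G c U M s t (β ^^ β') := by
  have hxA := hA.end_mem
  have hyB := hB.start_mem
  have hd := Finset.disjoint_left.1 hAB
  have hxy : x ≠ y := fun h => hd hxA (h ▸ hyB)
  refine ⟨1, fun _ => x, fun _ => y, ?_, fun _ => ⟨hAM hxA, hx, hBM hyB, hy⟩, fun L _ hr hM => ?_⟩
  · rintro (i | i) (j | j) h
    · rw [Subsingleton.elim i j]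
    · exact absurd (h : x = y) hxy
    · exact absurd (h : y = x) hxy.symm
    · rw [Subsingleton.elim i j]
  · have m0 : ∀ z ∈ L 0, z ∈ M → z = x ∨ z = y := hM 0
    have h1 := (hA.append (hr 0) fun z hz hz' =>
      (m0 z hz' (hAM hz)).resolve_right fun h => hd hz (h ▸ hyB)).append hB fun z hz hz' => by
        rcases Finset.mem_union.1 hz with hz | hz
        · exact absurd hz' (hd hz)
        · exact (m0 z hz (hBM hz')).resolve_left fun h => hd hxA (h ▸ hz')
    rw [Bool.xor_false] at h1
    refine h1.mono (Finset.union_subset (Finset.union_subset (hAM.trans Finset.subset_union_left)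
      ?_) (hBM.trans Finset.subset_union_left))
    exact (Finset.subset_biUnion_of_mem L (Finset.mem_univ 0)).trans Finset.subset_union_right

/-- A middle piece replaces the single join by two, from `x` to `a` and from `b` to `y`; this is how
a breaking detour is inserted. -/
theorem Plan.of_arms_mid (hA : Route G c A s x β) (hQ : Route G c Q a b β'')
    (hB : Route G c B y t β') (hAB : Disjoint A B) (hAQ : Disjoint A Q) (hQB : Disjoint Q B)
    (hne : a ≠ b) (hAM : A ⊆ M) (hQM : Q ⊆ M) (hBM : B ⊆ M) (hx : x ∈ U) (ha : a ∈ U) (hb : b ∈ U)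
    (hy : y ∈ U) : Plan G c U M s t (β ^^ β'' ^^ β') := by
  have hxA := hA.end_mem
  have hyB := hB.start_mem
  have haQ := hQ.start_mem
  have hbQ := hQ.end_mem
  have d1 := Finset.disjoint_left.1 hAB
  have d2 := Finset.disjoint_left.1 hAQ
  have d3 := Finset.disjoint_left.1 hQB
  have nxa : x ≠ a := fun h => d2 hxA (h ▸ haQ)
  have nxb : x ≠ b := fun h => d2 hxA (h ▸ hbQ)
  have nxy : x ≠ y := fun h => d1 hxA (h ▸ hyB)
  have nay : a ≠ y := fun h => d3 haQ (h ▸ hyB)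
  have nby : b ≠ y := fun h => d3 hbQ (h ▸ hyB)
  refine ⟨2, ![x, b], ![a, y], ?_, ?_, fun L hL hr hM => ?_⟩
  · rintro (i | i) (j | j) h <;> fin_cases i <;> fin_cases j <;> simp_all [eq_comm]
  · intro j
    fin_cases j
    · exact ⟨hAM hxA, hx, hQM haQ, ha⟩
    · exact ⟨hQM hbQ, hb, hBM hyB, hy⟩
  · have r0 : Route G c (L 0) x a false := hr 0
    have r1 : Route G c (L 1) b y false := hr 1
    have m0 : ∀ z ∈ L 0, z ∈ M → z = x ∨ z = a := hM 0
    have m1 : ∀ z ∈ L 1, z ∈ M → z = b ∨ z = y := hM 1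
    have dL := Finset.disjoint_left.1 (hL (by decide : (0 : Fin 2) ≠ 1))
    have e1 := hA.append r0 fun z hz hz' =>
      (m0 z hz' (hAM hz)).resolve_right fun h => d2 hz (h ▸ haQ)
    have e2 := e1.append hQ fun z hz hz' => by
      rcases Finset.mem_union.1 hz with hz | hz
      · exact absurd hz' (d2 hz)
      · exact (m0 z hz (hQM hz')).resolve_left fun h => d2 hxA (h ▸ hz')
    have e3 := e2.append r1 fun z hz hz' => by
      rcases Finset.mem_union.1 hz with hz | hz
      · rcases Finset.mem_union.1 hz with hz | hz
        · rcases m1 z hz' (hAM hz) with rfl | rfl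
          exacts [rfl, absurd hyB (d1 hz)]
        · exact absurd hz' (dL hz)
      · exact (m1 z hz' (hQM hz)).resolve_right fun h => d3 hz (h ▸ hyB)
    have e4 := e3.append hB fun z hz hz' => by
      rcases Finset.mem_union.1 hz with hz | hz
      · rcases Finset.mem_union.1 hz with hz | hz
        · rcases Finset.mem_union.1 hz with hz | hz
          · exact absurd hz' (d1 hz)
          · rcases m0 z hz (hBM hz') with rfl | rfl
            exacts [absurd hz' (d1 hxA), absurd hz' (d3 haQ)]
        · exact absurd hz' (d3 hz)
      · exact (m1 z hz (hBM hz')).resolve_left fun h => d3 hbQ (h ▸ hz')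
    rw [Bool.xor_false, Bool.xor_false] at e4
    refine e4.mono fun z hz => ?_
    simp only [Finset.mem_union] at hz
    rw [Finset.mem_union, Finset.mem_biUnion]
    rcases hz with (((hz | hz) | hz) | hz) | hz
    exacts [Or.inl (hAM hz), Or.inr ⟨0, Finset.mem_univ _, hz⟩, Or.inl (hQM hz),
      Or.inr ⟨1, Finset.mem_univ _, hz⟩, Or.inl (hBM hz)]

/-- Disjoint plans can be completed simultaneously inside a linked set. -/
theorem Linked.exists_routes {k : ℕ} (hHG : H ≤ G) (hc : ∀ a b, H.Adj a b → c a ≠ c b)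
    (hL : Linked H U X) {M : Fin k → Finset V} (hM : Pairwise fun i j => Disjoint (M i) (M j))
    (hMX : ∀ i, M i ∩ U ⊆ X) {s t : Fin k → V} {β : Fin k → Bool}
    (hP : ∀ i, Plan G c U (M i) (s i) (t i) (β i)) :
    ∃ N : Fin k → Finset V, (Pairwise fun i j => Disjoint (N i) (N j)) ∧
      ∀ i, Route G c (N i) (s i) (t i) (β i) := by
  choose n src dst hinj hmem hP using hP
  have hdisj : ∀ i j z, z ∈ M i → z ∈ M j → i = j := fun i j z h1 h2 => by
    by_contra h
    exact Finset.disjoint_left.1 (hM h) h1 h2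
  have hX : ∀ i z, z ∈ M i → z ∈ U → z ∈ X := fun i z h1 h2 => hMX i (Finset.mem_inter.2 ⟨h1, h2⟩)
  obtain ⟨S, hS, hSd⟩ := hL (Σ i, Fin (n i)) (fun p => src p.1 p.2) (fun p => dst p.1 p.2) (by
      rintro (⟨i, x⟩ | ⟨i, x⟩) (⟨j, y⟩ | ⟨j, y⟩) h
      · obtain rfl := hdisj i j _ (hmem i x).1 (by simp at h; exact h ▸ (hmem j y).1)
        have := hinj i (a₁ := Sum.inl x) (a₂ := Sum.inl y) (by simpa using h)
        simp_all
      · obtain rfl := hdisj i j _ (hmem i x).1 (by simp at h; exact h ▸ (hmem j y).2.2.1)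
        have := hinj i (a₁ := Sum.inl x) (a₂ := Sum.inr y) (by simpa using h)
        simp_all
      · obtain rfl := hdisj i j _ (hmem i x).2.2.1 (by simp at h; exact h ▸ (hmem j y).1)
        have := hinj i (a₁ := Sum.inr x) (a₂ := Sum.inl y) (by simpa using h)
        simp_all
      · obtain rfl := hdisj i j _ (hmem i x).2.2.1 (by simp at h; exact h ▸ (hmem j y).2.2.1)
        have := hinj i (a₁ := Sum.inr x) (a₂ := Sum.inr y) (by simpa using h)
        simp_all)
    (fun p => hX p.1 _ (hmem p.1 p.2).1 (hmem p.1 p.2).2.1)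
    (fun p => hX p.1 _ (hmem p.1 p.2).2.2.1 (hmem p.1 p.2).2.2.2)
  -- A connector meets `X`, and so every `M i` within `U`, only in its own two ends.
  have hSM : ∀ p i z, z ∈ S p → z ∈ M i → i = p.1 ∧ (z = src p.1 p.2 ∨ z = dst p.1 p.2) := by
    intro p i z h1 h2
    have h3 := (hS p).2.2.2.1 z h1 (hX i z h2 ((hS p).1 h1))
    refine ⟨?_, h3⟩
    rcases h3 with rfl | rfl
    exacts [hdisj _ _ _ h2 (hmem p.1 p.2).1, hdisj _ _ _ h2 (hmem p.1 p.2).2.2.1]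
  refine ⟨fun i => M i ∪ Finset.univ.biUnion fun x => S ⟨i, x⟩, fun i j hij => ?_, fun i => ?_⟩
  · refine Finset.disjoint_left.2 fun z hz hz' => ?_
    simp only [Finset.mem_union, Finset.mem_biUnion, Finset.mem_univ, true_and] at hz hz'
    rcases hz with hz | ⟨x, hz⟩ <;> rcases hz' with hz' | ⟨y, hz'⟩
    · exact hij (hdisj i j z hz hz')
    · exact hij (hSM _ _ _ hz' hz).1
    · exact hij (hSM _ _ _ hz hz').1.symm
    · exact Finset.disjoint_left.1 (hSd fun h => hij (congrArg Sigma.fst h)) hz hz'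
  · refine hP i _ (fun x y hxy => hSd fun h => hxy (by simpa using h)) (fun x => ?_) fun x z h1 h2 =>
      (hSM _ _ _ h1 h2).2
    exact ((hS ⟨i, x⟩).2.2.2.2.route hc (hS ⟨i, x⟩).2.1).mono_graph hHG

end Plan

end ParityLinkage
end

section
open scoped Classical
namespace ParityLinkage

/-! ### Consequences of high connectivity. -/

section VertexConnected

theorem conn_of_induce_reachable {V : Type*} {G : SimpleGraph V} {X : Set V} {Z : Finset V} (hXZ : ∀ x ∉ X, x ∈ Z) {a b : (Xᶜ : Set V)}
    (h : (G.induce Xᶜ).Reachable a b) : Conn G Z a.1 b.1 := by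
  obtain ⟨p⟩ := h
  induction p with
  | nil => rfl
  | @cons u v w hadj _ ih =>
    have huv : G.Adj u.1 v.1 := hadj
    exact (Conn.of_adj huv (hXZ _ u.2) (hXZ _ v.2)).trans ih

variable {V : Type*} [Fintype V] {G : SimpleGraph V} {c : V → Bool} {n : ℕ}

theorem IsVertexConnected.conn (hG : IsVertexConnected G n) {Z : Finset V} (hZ : Z.card < n) {a b : V}
    (ha : a ∉ Z) (hb : b ∉ Z) : Conn G Zᶜ a b :=
  conn_of_induce_reachable (X := (Z : Set V)) (a := ⟨a, by simpa using ha⟩) (b := ⟨b, by simpa using hb⟩)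
    (by simp) ((hG.2 (Z : Set V) (by rwa [Set.ncard_coe_finset])).preconnected _ _)

theorem IsVertexConnected.lt_card (hG : IsVertexConnected G n) : n < Fintype.card V := by
  simpa using hG.1

theorem IsVertexConnected.le_card_nb (hG : IsVertexConnected G n) (v : V) :
    n ≤ (nb G Finset.univ v).card := by
  by_contra hlt
  have hcard := hG.lt_card
  have hv : v ∉ nb G Finset.univ v := by simp
  obtain ⟨w, -, hw⟩ := Finset.exists_mem_notMem_of_card_lt_card
    (s := insert v (nb G Finset.univ v)) (t := Finset.univ) (by
      rw [Finset.card_insert_of_notMem hv, Finset.card_univ]; omega)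
  rw [Finset.mem_insert, not_or] at hw
  refine hw.1 ((hG.conn (by omega) hv hw.2).closed (fun u => u = v) rfl ?_)
  rintro u x rfl hux - hx
  exact absurd hux (by simpa using hx)

theorem IsVertexConnected.le_card_of_separates (hG : IsVertexConnected G n) {A B Z : Finset V} {r : ℕ}
    (hA : r ≤ A.card) (hB : r ≤ B.card) (hr : r ≤ n) (hZ : Separates G A B Z) : r ≤ Z.card := by
  by_contra hlt
  obtain ⟨a, ha, haZ⟩ := Finset.exists_mem_notMem_of_card_lt_card (by omega : Z.card < A.card)
  obtain ⟨b, hb, hbZ⟩ := Finset.exists_mem_notMem_of_card_lt_card (by omega : Z.card < B.card)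
  exact hZ a ha b hb haZ hbZ (hG.conn (by omega) haZ hbZ)

/-- A set that meets all breaking paths between vertices of a large set of vertices outside `R` is,
together with `R`, an odd cycle cover. -/
theorem IsVertexConnected.isOddCycleCover_of_hitting (hG : IsVertexConnected G n) {R S Z : Finset V}
    (hn : R.card + Z.card + 1 < n) (hSR : Disjoint S R) (hS : Z.card + 2 ≤ S.card)
    (hZ : ∀ a ∈ S, ∀ b ∈ S, ∀ q : (res G Rᶜ).Walk a b, q.IsPath → breaks c q = true →
      ∃ x ∈ q.support, x ∈ Z) : IsOddCycleCover G ((R ∪ Z : Finset V) : Set V) := by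
  have hcol : (res G (R ∪ Z)ᶜ).Colorable 2 := by
    by_contra hcol
    -- Deleting one vertex more still removes fewer than `n`, so `G - R - Z` is 2-connected; if it
    -- were not bipartite, it would contain a breaking path that misses `Z`.
    obtain ⟨a, ha, b, hb, p, hp, hpC, hpb⟩ := exists_breaking_route (G := G) (c := c)
      (S := S \ Z) (fun Y hY a ha b hb => by
        have hcard := Finset.card_union_le (R ∪ Z) Y
        have hcard' := Finset.card_union_le R Z
        have h : (R ∪ Z)ᶜ \ Y = (R ∪ Z ∪ Y)ᶜ := by ext; simp; tauto
        rw [h] at ha hb ⊢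
        exact hG.conn (by omega) (by simpa using ha) (by simpa using hb)) hcol
      (fun x hx => by
        rw [Finset.mem_sdiff] at hx
        simp [hx.2, Finset.disjoint_left.1 hSR hx.1])
      (by have := Finset.le_card_sdiff Z S; omega)
    have hle : res G (R ∪ Z)ᶜ ≤ res G Rᶜ :=
      res_mono le_rfl (Finset.compl_subset_compl.2 Finset.subset_union_left)
    obtain ⟨x, hx, hxZ⟩ := hZ a (Finset.mem_sdiff.1 ha).1 b (Finset.mem_sdiff.1 hb).1 (p.mapLe hle)
      ((SimpleGraph.Walk.isPath_mapLe hle).2 hp) (by rw [← hpb]; simp [breaks])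
    rw [SimpleGraph.Walk.support_mapLe_eq_support] at hx
    have := hpC x hx
    simp [hxZ] at this
  obtain ⟨f⟩ := hcol
  exact ⟨SimpleGraph.Coloring.mk (fun v => f v.1) fun {u v} h =>
    f.valid ⟨h, by simpa using u.2, by simpa using v.2⟩⟩

/-- Highly connected bipartite parts are linked. -/
theorem linked_of_conn {H : SimpleGraph V} {U : Finset V} {K r : ℕ} (hK : 0 < K) (hr : 20 * K ≤ r)
    (hU : r < U.card) (hdeg : ∀ v ∈ U, r ≤ (nb H U v).card)
    (hconn : ∀ Z ⊆ U, Z.card < r → ∀ a ∈ U \ Z, ∀ b ∈ U \ Z, Conn H (U \ Z) a b) {X : Finset V}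
    (hXU : X ⊆ U) (hX : X.card ≤ 2 * K) : Linked H U X := by
  refine Massed.isLinked hXU hX ⟨?_, fun A B hAB hXA hlt => ?_⟩
  -- Degrees of at least 20K exceed the density 12K required of a massed pair.
  · have hsum : ∑ v ∈ U \ X, (nb H U v).card ≤ mass H U (U \ X) := by
      rw [mass, ← Finset.card_sigma]
      refine Finset.card_le_card_of_injOn (fun p => (p.1, p.2)) (fun p hp => ?_) ?_
      · rw [Finset.mem_coe, Finset.mem_sigma, mem_nb] at hp
        rw [Finset.mem_coe, Finset.mem_filter, Finset.mem_product]
        exact ⟨⟨(Finset.mem_sdiff.1 hp.1).1, hp.2.1⟩, hp.2.2, Or.inl hp.1⟩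
      · rintro ⟨a, b⟩ - ⟨a', b'⟩ - h
        simp at h
        simp [h]
    have hpos : 0 < (U \ X).card := by
      have := Finset.le_card_sdiff X U
      omega
    have := Finset.card_nsmul_le_sum (U \ X) (fun v => (nb H U v).card) (20 * K) fun v hv =>
      hr.trans (hdeg v (Finset.mem_sdiff.1 hv).1)
    rw [smul_eq_mul] at this
    nlinarith
  · obtain ⟨a, ha, haAB⟩ := Finset.exists_mem_notMem_of_card_lt_card hlt
    have hAU : A ⊆ U := hAB.1 ▸ Finset.subset_union_left
    have hBU : B ⊆ U := hAB.1 ▸ Finset.subset_union_right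
    have haB : a ∉ B := fun h => haAB (Finset.mem_inter.2 ⟨hXA ha, h⟩)
    have hBA : B \ A = ∅ := by
      by_contra hne
      obtain ⟨b, hb⟩ := Finset.nonempty_iff_ne_empty.2 hne
      rw [Finset.mem_sdiff] at hb
      refine hb.2 ((hconn (A ∩ B) (Finset.inter_subset_left.trans hAU) (by omega) a
        (Finset.mem_sdiff.2 ⟨hXU ha, haAB⟩) b (Finset.mem_sdiff.2 ⟨hBU hb.1, fun h =>
          hb.2 (Finset.mem_inter.1 h).1⟩)).closed (fun w => w ∈ A) (hXA ha) fun u v hu huv huU hvU => ?_)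
      by_contra hv
      have huB : u ∉ B := fun h => (Finset.mem_sdiff.1 huU).2 (Finset.mem_inter.2 ⟨hu, h⟩)
      have hvB : v ∈ B := by
        have := (Finset.mem_sdiff.1 hvU).1
        rw [← hAB.1, Finset.mem_union] at this
        exact this.resolve_left hv
      exact hAB.2 u (Finset.mem_sdiff.2 ⟨hu, huB⟩) v (Finset.mem_sdiff.2 ⟨hvB, hv⟩) huv
    simp [hBA, mass]

end VertexConnected

/-! ### Rerouting walks so that few breaking paths are touched. -/

section Untouched
variable {V : Type*} {G : SimpleGraph V}

/-- Disjoint walks from given vertices to `U` can be chosen so that each of the disjoint paths `Q j`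
that meets one of them contains the last vertex of one of them. -/
theorem exists_walks_touching {ι κ : Type*} [Fintype ι] {U : Finset V} {tm : ι → V}
    (hex : ∃ W : ∀ z, Σ v, G.Walk (tm z) v, (∀ z, (W z).1 ∈ U) ∧
      Pairwise fun z z' => List.Disjoint (W z).2.support (W z').2.support)
    {a b : κ → V} (Q : ∀ j, G.Walk (a j) (b j)) (ha : ∀ j, a j ∈ U)
    (hQ : Pairwise fun i j => List.Disjoint (Q i).support (Q j).support) :
    ∃ W : ∀ z, Σ v, G.Walk (tm z) v, (∀ z, (W z).1 ∈ U) ∧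
      (Pairwise fun z z' => List.Disjoint (W z).2.support (W z').2.support) ∧
      ∀ j z x, x ∈ (W z).2.support → x ∈ (Q j).support → ∃ z', (W z').1 ∈ (Q j).support := by
  -- The number of edges that lie on none of the paths `Q`, to be minimised.
  let cost : (∀ z, Σ v, G.Walk (tm z) v) → ℕ := fun W =>
    ∑ z, ((W z).2.edges.filter fun e => ∀ j, e ∉ (Q j).edges).length
  have hex' : ∃ n, ∃ W : ∀ z, Σ v, G.Walk (tm z) v, ((∀ z, (W z).1 ∈ U) ∧
      Pairwise fun z z' => List.Disjoint (W z).2.support (W z').2.support) ∧ cost W = n := by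
    obtain ⟨W, hW⟩ := hex
    exact ⟨_, W, hW, rfl⟩
  obtain ⟨W, ⟨hWU, hWd⟩, hWn⟩ := Nat.find_spec hex'
  have hmin : ∀ W' : ∀ z, Σ v, G.Walk (tm z) v, (∀ z, (W' z).1 ∈ U) →
      (Pairwise fun z z' => List.Disjoint (W' z).2.support (W' z').2.support) → cost W ≤ cost W' :=
    fun W' h1 h2 => hWn ▸ Nat.find_min' hex' ⟨W', ⟨h1, h2⟩, rfl⟩
  clear hWn
  refine ⟨W, hWU, hWd, fun j z₀ x₀ hx₀ hx₀Q => ?_⟩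
  -- the first vertex of `Q j` on one of the walks
  have hfirst : ∃ x, ∃ q : G.Walk (a j) x, (∃ z, x ∈ (W z).2.support) ∧
      (∀ y ∈ q.support, y ∈ (Q j).support) ∧ (∀ e ∈ q.edges, e ∈ (Q j).edges) ∧
      ∀ y ∈ q.support, (∃ z, y ∈ (W z).2.support) → y = x := by
    have hgen : ∀ {u v : V} (q : G.Walk u v), (∃ y ∈ q.support, ∃ z, y ∈ (W z).2.support) →
        ∃ x, ∃ q' : G.Walk u x, (∃ z, x ∈ (W z).2.support) ∧
        (∀ y ∈ q'.support, y ∈ q.support) ∧ (∀ e ∈ q'.edges, e ∈ q.edges) ∧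
        ∀ y ∈ q'.support, (∃ z, y ∈ (W z).2.support) → y = x := by
      intro u v q
      induction q with
      | nil =>
        rintro ⟨y, hy, hz⟩
        rw [SimpleGraph.Walk.support_nil, List.mem_singleton] at hy
        subst hy
        exact ⟨y, .nil, hz, by simp, by simp, by simp⟩
      | cons h q ih =>
        rename_i u u' w
        intro hq
        by_cases hu : ∃ z, u ∈ (W z).2.support
        · exact ⟨u, .nil, hu, by simp, by simp, by simp⟩
        · obtain ⟨x, q', h1, h2, h3, h4⟩ := ih (by
            obtain ⟨y, hy, hz⟩ := hq
            rw [SimpleGraph.Walk.support_cons, List.mem_cons] at hy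
            rcases hy with rfl | hy
            exacts [absurd hz hu, ⟨y, hy, hz⟩])
          refine ⟨x, .cons h q', h1, fun y hy => ?_, fun e he => ?_, fun y hy hz => ?_⟩
          · rw [SimpleGraph.Walk.support_cons, List.mem_cons] at hy ⊢
            exact hy.imp_right (h2 y)
          · rw [SimpleGraph.Walk.edges_cons, List.mem_cons] at he ⊢
            exact he.imp_right (h3 e)
          · rw [SimpleGraph.Walk.support_cons, List.mem_cons] at hy
            rcases hy with rfl | hy
            exacts [absurd hz hu, h4 y hy hz]
    exact hgen (Q j) ⟨x₀, hx₀Q, z₀, hx₀⟩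
  obtain ⟨x, q, ⟨r, hr⟩, hqs, hqe, hqf⟩ := hfirst
  refine ⟨r, ?_⟩
  have hxQ : x ∈ (Q j).support := hqs x q.end_mem_support
  -- Walk `r` is redirected at `x` back along `Q j` to `a j`; no other walk is met, because `x` is
  -- the first vertex of `Q j` on any walk. By minimality the abandoned end of walk `r` uses only
  -- edges of the paths `Q`, so it stays on `Q j` and its last vertex is there.
  let W' : ∀ z, Σ v, G.Walk (tm z) v :=
    Function.update W r ⟨a j, ((W r).2.takeUntil x hr).append q.reverse⟩
  have hW'r : W' r = ⟨a j, ((W r).2.takeUntil x hr).append q.reverse⟩ := Function.update_self _ _ _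
  have hW' : ∀ z, z ≠ r → W' z = W z := fun z hz => Function.update_of_ne hz _ _
  have hsupp : ∀ y ∈ (W' r).2.support, y ∈ (W r).2.support ∨ (y ∈ q.support) := by
    intro y hy
    rw [hW'r] at hy
    rcases (SimpleGraph.Walk.mem_support_append_iff _ _).1 hy with hy | hy
    · exact Or.inl (SimpleGraph.Walk.support_takeUntil_subset_support _ _ hy)
    · exact Or.inr (by simpa using hy)
  have hdr : ∀ z, z ≠ r → List.Disjoint (W' r).2.support (W' z).2.support := by
    intro z hz y hy hy'
    rw [hW' z hz] at hy'
    rcases hsupp y hy with h | h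
    · exact hWd hz.symm h hy'
    · exact hWd hz.symm (hqf y h ⟨z, hy'⟩ ▸ hr) hy'
  have hle := hmin W' (fun z => by
      by_cases hz : z = r
      · subst hz; rw [hW'r]; exact ha j
      · rw [hW' z hz]; exact hWU z) (fun z z' hzz => by
      by_cases hz : z = r
      · subst hz; exact hdr z' hzz.symm
      · by_cases hz' : z' = r
        · subst hz'; exact (hdr z hz).symm
        · show List.Disjoint (W' z).2.support (W' z').2.support
          rw [hW' z hz, hW' z' hz']; exact hWd hzz)
  have hcost : ∀ W'' : ∀ z, Σ v, G.Walk (tm z) v, cost W'' =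
      ((W'' r).2.edges.filter fun e => ∀ j, e ∉ (Q j).edges).length + 
      ∑ z ∈ Finset.univ.erase r, ((W'' z).2.edges.filter fun e => ∀ j, e ∉ (Q j).edges).length :=
    fun W'' => (Finset.add_sum_erase _ _ (Finset.mem_univ r)).symm
  have hsum : ∑ z ∈ Finset.univ.erase r,
      ((W' z).2.edges.filter fun e => ∀ j, e ∉ (Q j).edges).length = ∑ z ∈ Finset.univ.erase r,
      ((W z).2.edges.filter fun e => ∀ j, e ∉ (Q j).edges).length :=
    Finset.sum_congr rfl fun z hz => by rw [hW' z (Finset.ne_of_mem_erase hz)]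
  rw [hcost, hcost, hsum] at hle
  have hle' := Nat.le_of_add_le_add_right hle
  have hspec := (W r).2.take_spec hr
  have hq0 : (q.edges.filter fun e => ∀ j, e ∉ (Q j).edges) = [] := by
    rw [List.filter_eq_nil_iff]
    intro e he
    simp only [decide_eq_true_eq, not_forall, not_not]
    exact ⟨j, hqe e he⟩
  have hd0 : (((W r).2.dropUntil x hr).edges.filter fun e => ∀ j, e ∉ (Q j).edges) = [] := by
    have h1 : (W r).2.edges = ((W r).2.takeUntil x hr).edges ++ ((W r).2.dropUntil x hr).edges := by
      rw [← SimpleGraph.Walk.edges_append, hspec]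
    have h2 : (W' r).2.edges = ((W r).2.takeUntil x hr).edges ++ q.edges.reverse := by
      rw [hW'r, SimpleGraph.Walk.edges_append, SimpleGraph.Walk.edges_reverse]
    rw [h1, h2, List.filter_append, List.filter_append, List.filter_reverse, hq0, List.length_append,
      List.length_append, List.reverse_nil, List.length_nil] at hle'
    exact List.length_eq_zero_iff.1 (by omega)
  have hstay : ∀ {u v : V} (p : G.Walk u v), (∀ e ∈ p.edges, ∃ i, e ∈ (Q i).edges) →
      u ∈ (Q j).support → v ∈ (Q j).support := by
    intro u v p
    induction p with
    | nil => exact fun _ h => h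
    | cons h p ih =>
      intro hp hu
      obtain ⟨i, hi⟩ := hp _ (by rw [SimpleGraph.Walk.edges_cons]; exact List.mem_cons_self)
      have h1 := (Q i).fst_mem_support_of_mem_edges hi
      have h2 := (Q i).snd_mem_support_of_mem_edges hi
      have hij : i = j := by
        by_contra hij
        exact hQ hij h1 hu
      exact ih (fun e he => hp e (by rw [SimpleGraph.Walk.edges_cons]; exact List.mem_cons_of_mem _ he))
        (hij ▸ h2)
  refine hstay ((W r).2.dropUntil x hr) (fun e he => ?_) hxQ
  rw [List.filter_eq_nil_iff] at hd0
  simpa using hd0 e he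

end Untouched

end ParityLinkage
end

section
open scoped Classical
namespace ParityLinkage

/-! ### The case of many disjoint breaking paths. -/

section ManyBreakingPaths
variable {V : Type*} {G H : SimpleGraph V} {c : V → Bool} {U : Finset V} {k : ℕ} {I : Finset (Fin k)}

theorem sum_two_add_ite (I : Finset (Fin k)) :
    ∑ i, (2 + if i ∈ I then 2 else 0) = 2 * (k + I.card) := by
  rw [Finset.sum_add_distrib, Finset.sum_ite_mem]
  simp
  ring

/-- Disjoint walks from the terminals into a linked bipartite subgraph together with many disjoint
breaking paths between vertices of that subgraph allow one to prescribe parities. -/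
theorem exists_routes_of_breaking_paths (hHG : H ≤ G) (hc : ∀ a b, H.Adj a b → c a ≠ c b)
    (hL : ∀ X ⊆ U, X.card ≤ 2 * (k + I.card) → Linked H U X) {s t : Fin k → V}
    (hW : ∃ W : ∀ z, Σ v, G.Walk (Sum.elim s t z) v, (∀ z, (W z).1 ∈ U) ∧
      Pairwise fun z z' => List.Disjoint (W z).2.support (W z').2.support)
    {a b : Fin (2 * k + I.card) → V} (Q : ∀ j, G.Walk (a j) (b j))
    (hQ : ∀ j, (Q j).IsPath ∧ a j ∈ U ∧ b j ∈ U ∧ a j ≠ b j ∧ breaks c (Q j) = true ∧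
      ∀ x ∈ (Q j).support, x ∈ U → x = a j ∨ x = b j)
    (hQd : Pairwise fun i j => List.Disjoint (Q i).support (Q j).support) (β : Fin k → Bool) :
    ∃ N : Fin k → Finset V, (Pairwise fun i j => Disjoint (N i) (N j)) ∧
      ∃ β' : Fin k → Bool, (∀ i ∈ I, β' i = β i) ∧ ∀ i, Route G c (N i) (s i) (t i) (β' i) := by
  obtain ⟨W, hWU, hWd, hWQ⟩ := exists_walks_touching hW Q (fun j => (hQ j).2.1) hQd
  have hT : ∀ z, ∃ T ⊆ (W z).2.support.toFinset, ∃ y ∈ U, T ∩ U = {y} ∧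
      ∃ γ, Route G c T (Sum.elim s t z) y γ := fun z => by
    obtain ⟨T, h1, y, h2, h3, h4, h5, -⟩ := (Conn.of_walk (S := (W z).2.support.toFinset) (W z).2
      (by simp)).trim (by simp) (hWU z)
    obtain ⟨γ, h6⟩ := h5.exists_route (c := c) h3
    exact ⟨T, h1, y, h2, h4, γ, h6⟩
  choose T hTW y hyU hTU γ hγ using hT
  have hTd : ∀ z z', z ≠ z' → Disjoint (T z) (T z') := fun z z' hz =>
    Finset.disjoint_left.2 fun x hx hx' => hWd hz (List.mem_toFinset.1 (hTW z hx))
      (List.mem_toFinset.1 (hTW z' hx'))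
  -- The paths met by some walk. Each contains the last vertex of a walk, and disjoint paths contain
  -- different ones, so there are at most 2k and |I| paths are left untouched.
  let E : Finset (Fin (2 * k + I.card)) :=
    Finset.univ.filter fun j => ∃ z, ∃ x, x ∈ (W z).2.support ∧ x ∈ (Q j).support
  have hE : E.card ≤ 2 * k := by
    have hz : ∀ j : E, ∃ z', (W z').1 ∈ (Q j).support := fun j => by
      obtain ⟨z, x, h1, h2⟩ := (Finset.mem_filter.1 j.2).2
      exact hWQ j z x h1 h2
    choose g hg using hz
    have := Fintype.card_le_of_injective g fun j j' h => Subtype.ext (by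
      by_contra hne
      exact hQd hne (hg j) (h ▸ hg j'))
    rw [Fintype.card_coe, Fintype.card_sum, Fintype.card_fin] at this
    omega
  obtain ⟨f, hf, hfE⟩ := exists_injective_of_card_le (ι := I) (fun _ => Eᶜ) fun _ => by
    rw [Fintype.card_coe, Finset.card_compl, Fintype.card_fin]
    omega
  let P : Fin k → Finset V := fun i => if h : i ∈ I then (Q (f ⟨i, h⟩)).support.toFinset else ∅
  have hP : ∀ i (h : i ∈ I), P i = (Q (f ⟨i, h⟩)).support.toFinset := fun i h => dif_pos h
  have hmemP : ∀ i x, x ∈ P i → ∃ h : i ∈ I, x ∈ (Q (f ⟨i, h⟩)).support := fun i x hx => by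
    by_cases h : i ∈ I
    · exact ⟨h, by rw [hP i h] at hx; simpa using hx⟩
    · simp [P, h] at hx
  have hTP : ∀ z i, Disjoint (T z) (P i) := fun z i => Finset.disjoint_left.2 fun x hx hx' => by
    obtain ⟨h, hx'⟩ := hmemP i x hx'
    refine Finset.mem_compl.1 (hfE ⟨i, h⟩) (Finset.mem_filter.2 ⟨Finset.mem_univ _, z, x, ?_, hx'⟩)
    simpa using hTW z hx
  have hPP : ∀ i j, i ≠ j → Disjoint (P i) (P j) := fun i j hij =>
    Finset.disjoint_left.2 fun x hx hx' => by
      obtain ⟨h, hx⟩ := hmemP i x hx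
      obtain ⟨h', hx'⟩ := hmemP j x hx'
      exact hQd (fun he => hij (congrArg Subtype.val (hf he))) hx hx'
  have hPU : ∀ i, (P i ∩ U).card ≤ if i ∈ I then 2 else 0 := fun i => by
    by_cases h : i ∈ I
    · rw [if_pos h]
      refine (Finset.card_le_card fun x hx => ?_).trans
        (Finset.card_le_two (a := a (f ⟨i, h⟩)) (b := b (f ⟨i, h⟩)))
      rw [Finset.mem_inter, hP i h, List.mem_toFinset] at hx
      simpa using (hQ _).2.2.2.2.2 x hx.1 hx.2
    · simp [P, h]
  let M : Fin k → Finset V := fun i => T (Sum.inl i) ∪ T (Sum.inr i) ∪ P i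
  have hMd : Pairwise fun i j => Disjoint (M i) (M j) := fun i j hij => by
    have h1 : Sum.inl (β := Fin k) i ≠ Sum.inl j := fun h => hij (Sum.inl_injective h)
    have h2 : Sum.inr (α := Fin k) i ≠ Sum.inr j := fun h => hij (Sum.inr_injective h)
    simp only [M, Finset.disjoint_union_left, Finset.disjoint_union_right]
    have h3 := hTd (Sum.inl i) (Sum.inr j) (by simp)
    have h4 := hTd (Sum.inr i) (Sum.inl j) (by simp)
    have h5 := fun z => (hTP z i).symm
    simp only [h3, h4, h5, hTd _ _ h1, hTd _ _ h2, hTP, hPP i j hij, and_self]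
  have hMU : ∀ i, (M i ∩ U).card ≤ 2 + if i ∈ I then 2 else 0 := fun i => by
    simp only [M, Finset.union_inter_distrib_right, hTU]
    exact (Finset.card_union_le _ _).trans (add_le_add ((Finset.card_union_le _ _).trans (by simp))
      (hPU i))
  -- Outside `I` no detour is provided, and the parity is whatever the two arms give.
  let β' : Fin k → Bool := fun i => if i ∈ I then β i else (γ (Sum.inl i) ^^ γ (Sum.inr i))
  have hplan : ∀ i, Plan G c U (M i) (s i) (t i) (β' i) := fun i => by
    have hA := hγ (Sum.inl i)
    have hB := (hγ (Sum.inr i)).symm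
    have hAB := hTd (Sum.inl i) (Sum.inr i) (by simp)
    have hAM : T (Sum.inl i) ⊆ M i := Finset.subset_union_left.trans Finset.subset_union_left
    have hBM : T (Sum.inr i) ⊆ M i := Finset.subset_union_right.trans Finset.subset_union_left
    by_cases h : β' i = (γ (Sum.inl i) ^^ γ (Sum.inr i))
    · rw [h]
      exact .of_arms hA hB hAB hAM hBM (hyU _) (hyU _)
    · have hi : i ∈ I := by
        by_contra hi
        exact h (if_neg hi)
      have hb : β' i = (γ (Sum.inl i) ^^ true ^^ γ (Sum.inr i)) := by
        revert h
        cases β' i <;> cases γ (Sum.inl i) <;> cases γ (Sum.inr i) <;> simp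
      obtain ⟨q1, q2, q3, q4, q5, -⟩ := hQ (f ⟨i, hi⟩)
      have hR := Route.of_isPath (c := c) q1
      rw [q5, ← hP i hi] at hR
      rw [hb]
      exact .of_arms_mid hA hR hB hAB (hTP _ _) (hTP _ _).symm q4 hAM Finset.subset_union_right hBM
        (hyU _) q2 q3 (hyU _)
  have hX : (Finset.univ.biUnion fun i => M i ∩ U).card ≤ 2 * (k + I.card) :=
    Finset.card_biUnion_le.trans ((Finset.sum_le_sum fun i _ => hMU i).trans (sum_two_add_ite I).le)
  obtain ⟨N, hN, hNr⟩ := (hL _ (Finset.biUnion_subset.2 fun i _ => Finset.inter_subset_right)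
    hX).exists_routes hHG hc hMd
    (fun i => Finset.subset_biUnion_of_mem (fun i => M i ∩ U) (Finset.mem_univ i)) hplan
  exact ⟨N, hN, β', fun i hi => if_pos hi, hNr⟩

end ManyBreakingPaths

end ParityLinkage
end

section
open scoped Classical
namespace ParityLinkage

/-! ### The case of a small odd cycle cover. -/

section SmallCover
variable {V : Type*} [Fintype V] {G : SimpleGraph V} {c : V → Bool} {X : Finset V} {n r : ℕ}

theorem card_nb_univ_le (X : Finset V) (v : V) :
    (nb G Finset.univ v).card ≤ (nb G Xᶜ v).card + X.card := by
  refine (Finset.card_le_card fun w hw => ?_).trans (Finset.card_union_le _ _)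
  rw [Finset.mem_union, mem_nb, Finset.mem_compl]
  by_cases h : w ∈ X
  · exact Or.inr h
  · exact Or.inl ⟨h, by simpa using hw⟩

/-- The complement of a small odd cycle cover is linked. -/
theorem IsVertexConnected.linked_compl (hG : IsVertexConnected G n) {K : ℕ} (hK : 0 < K)
    (hr : 20 * K ≤ r) (hX : X.card + r ≤ n)
    (hcov : ∀ u v, G.Adj u v → u ∉ X → v ∉ X → c u ≠ c v) {Y : Finset V} (hYX : Y ⊆ Xᶜ)
    (hY : Y.card ≤ 2 * K) : Linked (biGraph G c) Xᶜ Y := by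
  refine linked_of_conn hK hr ?_ (fun v hv => ?_) (fun Z _ hZ a ha b hb => ?_) hYX hY
  · rw [Finset.card_compl]
    have := hG.lt_card
    omega
  · have h1 := hG.le_card_nb v
    have h2 := card_nb_univ_le (G := G) X v
    have h3 : nb G Xᶜ v ⊆ nb (biGraph G c) Xᶜ v := fun w hw => by
      rw [mem_nb] at hw ⊢
      exact ⟨hw.1, hw.2, hcov _ _ hw.2 (Finset.mem_compl.1 hv) (Finset.mem_compl.1 hw.1)⟩
    have := Finset.card_le_card h3
    omega
  · have h : Xᶜ \ Z = (X ∪ Z)ᶜ := by ext; simp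
    have hcard := Finset.card_union_le X Z
    rw [h] at ha hb ⊢
    refine (hG.conn (by omega) (Finset.mem_compl.1 ha) (Finset.mem_compl.1 hb)).closed
      (fun w => Conn (biGraph G c) (X ∪ Z)ᶜ a w) Conn.rfl fun u v hu huv huS hvS =>
        hu.trans (Conn.of_adj ⟨huv, ?_⟩ huS hvS)
    simp only [Finset.compl_union, Finset.mem_inter, Finset.mem_compl] at huS hvS
    exact hcov _ _ huv huS.1 hvS.1

/-- Vertices in a small cover can be moved along disjoint non-breaking edges to the outside. -/
theorem exists_feet {F : Finset V} (hdeg : ∀ x ∈ X, F.card + F.card ≤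
      ((nb G Xᶜ x).filter fun w => c x ≠ c w).card) :
    ∃ f : V → V, (∀ v ∈ F, f v ∉ X ∧ Route G c {v, f v} v (f v) false) ∧
      (∀ v ∈ F, ∀ w ∈ F, v ≠ w → Disjoint ({v, f v} : Finset V) {w, f w}) ∧
      ∀ v ∈ F, ∀ w ∈ ({v, f v} : Finset V), w ∉ X → w = f v := by
  -- Of the 2|F| bichromatic neighbours outside `X` at least |F| avoid `F`, enough for distinct
  -- representatives.
  obtain ⟨g, hg, hgm⟩ := exists_injective_of_card_le (ι := (F ∩ X : Finset V))
    (fun x => ((nb G Xᶜ x.1).filter fun w => c x.1 ≠ c w) \ F) fun x => by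
      have h1 := hdeg x.1 (Finset.mem_inter.1 x.2).2
      have h2 := Finset.le_card_sdiff F ((nb G Xᶜ x.1).filter fun w => c x.1 ≠ c w)
      have h3 := Finset.card_le_card (Finset.inter_subset_left : F ∩ X ⊆ F)
      rw [Fintype.card_coe]
      omega
  have hgm' : ∀ x, g x ∉ X ∧ G.Adj x.1 (g x) ∧ c x.1 ≠ c (g x) ∧ g x ∉ F := fun x => by
    have := hgm x
    simp only [Finset.mem_sdiff, Finset.mem_filter, mem_nb, Finset.mem_compl] at this
    exact ⟨this.1.1.1, this.1.1.2, this.1.2, this.2⟩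
  let f : V → V := fun v => if h : v ∈ F ∩ X then g ⟨v, h⟩ else v
  have hf : ∀ v ∈ F, (f v = v ∧ v ∉ X) ∨ ∃ h : v ∈ F ∩ X, f v = g ⟨v, h⟩ := fun v hv => by
    by_cases h : v ∈ X
    · exact Or.inr ⟨Finset.mem_inter.2 ⟨hv, h⟩, dif_pos (Finset.mem_inter.2 ⟨hv, h⟩)⟩
    · exact Or.inl ⟨dif_neg fun h' => h (Finset.mem_inter.1 h').2, h⟩
  refine ⟨f, fun v hv => ?_, fun v hv w hw hvw => ?_, fun v hv w hw hwX => ?_⟩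
  · rcases hf v hv with ⟨h1, h2⟩ | ⟨h1, h2⟩
    · rw [h1]
      exact ⟨h2, Route.refl (by simp)⟩
    · obtain ⟨h3, h4, h5, -⟩ := hgm' ⟨v, h1⟩
      rw [h2]
      refine ⟨h3, ?_⟩
      have := Route.of_adj (c := c) h4
      rwa [show (!(c v ^^ c (g ⟨v, h1⟩))) = false by revert h5; cases c v <;> simp] at this
  · simp only [Finset.disjoint_insert_left, Finset.disjoint_singleton_left, Finset.mem_insert,
      Finset.mem_singleton, not_or]
    rcases hf v hv with ⟨h1, h2⟩ | ⟨h1, h2⟩ <;> rcases hf w hw with ⟨h3, h4⟩ | ⟨h3, h4⟩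
    · rw [h1, h3]
      exact ⟨⟨hvw, hvw⟩, hvw, hvw⟩
    · rw [h1, h4]
      have := fun h : v = g ⟨w, h3⟩ => (hgm' ⟨w, h3⟩).2.2.2 (h ▸ hv)
      exact ⟨⟨hvw, this⟩, hvw, this⟩
    · rw [h2, h3]
      have := fun h : g ⟨v, h1⟩ = w => (hgm' ⟨v, h1⟩).2.2.2 (h ▸ hw)
      exact ⟨⟨hvw, hvw⟩, this, this⟩
    · rw [h2, h4]
      refine ⟨⟨hvw, fun h => (hgm' ⟨w, h3⟩).2.2.2 (h ▸ hv)⟩,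
        fun h => (hgm' ⟨v, h1⟩).2.2.2 (h ▸ hw), fun h => hvw (congrArg Subtype.val (hg h))⟩
  · simp only [Finset.mem_insert, Finset.mem_singleton] at hw
    rcases hw with rfl | hw
    · rcases hf w hv with ⟨h1, h2⟩ | ⟨h1, h2⟩
      exacts [h1.symm, absurd (Finset.mem_inter.1 h1).2 hwX]
    · exact hw

variable {k : ℕ} {I : Finset (Fin k)} {s t p q : Fin k → V}

/-- Given a small odd cycle cover whose vertices have at least as many neighbours of the other colour
as of their own, a matching of monochromatic edges allows one to prescribe parities. -/
theorem exists_routes_of_small_cover (hG : IsVertexConnected G (26 * k + 24 * I.card)) (hk : 0 < k)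
    (hX : X.card ≤ 6 * k + 2 * I.card) (hcov : ∀ u v, G.Adj u v → u ∉ X → v ∉ X → c u ≠ c v)
    (hnice : ∀ x ∈ X, ((nb G Xᶜ x).filter fun w => c x = c w).card ≤
      ((nb G Xᶜ x).filter fun w => c x ≠ c w).card)
    (hst : ∀ i, s i ≠ t i) (hpq : ∀ i ∈ I, G.Adj (p i) (q i) ∧ c (p i) = c (q i))
    (hF : Pairwise fun i j => Disjoint ({s i, t i} ∪ if i ∈ I then {p i, q i} else ∅ : Finset V)
      ({s j, t j} ∪ if j ∈ I then {p j, q j} else ∅)) (β : Fin k → Bool) :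
    ∃ N : Fin k → Finset V, (Pairwise fun i j => Disjoint (N i) (N j)) ∧
      ∃ β' : Fin k → Bool, (∀ i ∈ I, β' i = β i) ∧ ∀ i, Route G c (N i) (s i) (t i) (β' i) := by
  let F : Fin k → Finset V := fun i => {s i, t i} ∪ if i ∈ I then {p i, q i} else ∅
  let F' : Finset V := Finset.univ.biUnion F
  have hFF' : ∀ i, F i ⊆ F' := fun i => Finset.subset_biUnion_of_mem F (Finset.mem_univ i)
  have hsF : ∀ i, s i ∈ F i := fun i => by simp [F]
  have htF : ∀ i, t i ∈ F i := fun i => by simp [F]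
  have hpF : ∀ i ∈ I, p i ∈ F i := fun i hi => by simp [F, hi]
  have hqF : ∀ i ∈ I, q i ∈ F i := fun i hi => by simp [F, hi]
  have hF' : F'.card ≤ 2 * (k + I.card) := by
    refine Finset.card_biUnion_le.trans ((Finset.sum_le_sum fun i _ => ?_).trans (sum_two_add_ite I).le)
    refine (Finset.card_union_le _ _).trans (add_le_add Finset.card_le_two ?_)
    split_ifs
    exacts [Finset.card_le_two, by simp]
  -- A vertex of `X` has at least 20k + 22|I| neighbours outside `X`, and at least half of these are
  -- bichromatic; only 2|F'| ≤ 4(k + |I|) are needed.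
  obtain ⟨f, hf1, hf2, hf3⟩ := exists_feet (G := G) (c := c) (X := X) (F := F') fun x hx => by
    have h1 := hG.le_card_nb x
    have h2 := card_nb_univ_le (G := G) X x
    have h3 := hnice x hx
    have h4 := Finset.card_filter_add_card_filter_not (s := nb G Xᶜ x) (fun w => c x = c w)
    simp only [ne_eq] at h3 ⊢
    omega
  let M : Fin k → Finset V := fun i => (F i).biUnion fun v => {v, f v}
  have hM : ∀ i, ∀ v ∈ F i, ({v, f v} : Finset V) ⊆ M i := fun i v hv =>
    Finset.subset_biUnion_of_mem (fun v => ({v, f v} : Finset V)) hv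
  have hMd : Pairwise fun i j => Disjoint (M i) (M j) := fun i j hij => by
    simp only [M, Finset.disjoint_biUnion_left, Finset.disjoint_biUnion_right]
    intro w hw v hv
    exact hf2 _ (hFF' _ (by assumption)) _ (hFF' _ (by assumption)) fun h =>
      Finset.disjoint_left.1 (hF hij) (by assumption) (by rw [h]; assumption)
  have hfU : ∀ i, ∀ v ∈ F i, f v ∈ Xᶜ := fun i v hv => Finset.mem_compl.2 (hf1 v (hFF' i hv)).1
  have hplan : ∀ i, ∃ γ, Plan G c Xᶜ (M i) (s i) (t i) γ ∧ (i ∈ I → γ = β i) := fun i => by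
    have hA := fun v hv => (hf1 v (hFF' i hv)).2
    have hd := fun v hv w hw => hf2 v (hFF' i hv) w (hFF' i hw)
    have h0 := Plan.of_arms (hA _ (hsF i)) (hA _ (htF i)).symm (hd _ (hsF i) _ (htF i) (hst i))
      (hM i _ (hsF i)) (hM i _ (htF i)) (hfU i _ (hsF i)) (hfU i _ (htF i))
    -- The direct plan through the feet of `s i` and `t i` does not break, so the matching edge is
    -- needed only when `true` is requested.
    by_cases hi : i ∈ I ∧ β i = true
    swap
    · refine ⟨_, h0, fun h => ?_⟩
      rw [eq_comm]
      simpa [h] using hi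
    obtain ⟨hi, hβ⟩ := hi
    refine ⟨true, ?_, fun _ => hβ.symm⟩
    -- the general shape of the detour along the edge `u v`
    have main : ∀ u v, u ∈ F i → v ∈ F i → G.Adj u v → c u = c v → ∀ x y, x ∈ F i → y ∈ F i →
        x ≠ y → x ≠ v → y ≠ u → y ≠ v → Plan G c Xᶜ (M i) x y true := by
      intro u v hu hv huv hcuv x y hx hy hxy hxv hyu hyv
      have hbr : Route G c {u, v} u v true := by
        have := Route.of_adj (c := c) huv
        rwa [hcuv, Bool.xor_self] at this
      have huv' := hd u hu v hv huv.ne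
      have r1 := hbr.append (hA v hv) fun z hz hz' => by
        rcases Finset.mem_insert.1 hz with rfl | hz
        · exact absurd hz' (Finset.disjoint_left.1 huv' (by simp))
        · exact Finset.mem_singleton.1 hz
      have hsub1 : ({u, v} ∪ {v, f v} : Finset V) ⊆ {u, f u} ∪ {v, f v} := by
        intro z; simp; tauto
      have hsub2 : ({u, f u} ∪ {v, f v} : Finset V) ⊆ M i := Finset.union_subset (hM i u hu) (hM i v hv)
      by_cases hxu : x = u
      · subst hxu
        exact .of_arms r1 (hA y hy).symm ((Finset.disjoint_union_left.2
          ⟨hd x hu y hy hxy, hd v hv y hy hyv.symm⟩).mono_left hsub1) (hsub1.trans hsub2) (hM i y hy)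
          (hfU i v hv) (hfU i y hy)
      · have r2 := (hA u hu).symm.append r1 fun z hz hz' => by
          rcases Finset.mem_union.1 hz' with hz' | hz'
          · rcases Finset.mem_insert.1 hz' with rfl | hz'
            · rfl
            · rw [Finset.mem_singleton] at hz'
              exact absurd (hz' ▸ hz) (Finset.disjoint_right.1 huv' (by simp))
          · exact absurd hz' (Finset.disjoint_left.1 huv' hz)
        have hsub3 : ({u, f u} ∪ ({u, v} ∪ {v, f v}) : Finset V) ⊆ {u, f u} ∪ {v, f v} :=
          Finset.union_subset Finset.subset_union_left hsub1
        refine .of_arms_mid (hA x hx) r2 (hA y hy).symm (hd x hx y hy hxy) ?_ ?_ ?_ (hM i x hx)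
          (hsub3.trans hsub2) (hM i y hy) (hfU i x hx) (hfU i u hu) (hfU i v hv) (hfU i y hy)
        · exact (Finset.disjoint_union_right.2 ⟨hd x hx u hu hxu, hd x hx v hv hxv⟩).mono_right hsub3
        · exact (Finset.disjoint_union_left.2 ⟨hd u hu y hy hyu.symm, hd v hv y hy hyv.symm⟩).mono_left
            hsub3
        · exact fun h => Finset.disjoint_left.1 huv' (by simp : f u ∈ _) (by rw [h]; simp)
    obtain ⟨hadj, hcpq⟩ := hpq i hi
    have hp := hpF i hi
    have hq := hqF i hi
    have hs := hsF i
    have ht := htF i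
    have hdirect : ∀ u v, u ∈ F i → v ∈ F i → G.Adj u v → c u = c v → Plan G c Xᶜ (M i) u v true := by
      intro u v hu hv huv hcuv
      have := Route.of_adj (c := c) huv
      rw [hcuv, Bool.xor_self] at this
      refine this.plan (Finset.insert_subset (hM i u hu (by simp)) ?_)
      simpa using hM i v hv (by simp)
    -- The matching edge may share ends with its own pair. Unless it joins the two terminals, edge
    -- and pair can be oriented so that the second terminal is off the edge, as `main` requires.
    by_cases h1 : s i = p i
    · by_cases h2 : t i = q i
      · rw [h1, h2]
        exact hdirect _ _ hp hq hadj hcpq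
      · exact main _ _ hp hq hadj hcpq _ _ hs ht (hst i) (h1 ▸ hadj.ne) (h1 ▸ (hst i).symm) h2
    · by_cases h2 : s i = q i
      · by_cases h3 : t i = p i
        · rw [h2, h3]
          exact hdirect _ _ hq hp hadj.symm hcpq.symm
        · exact main _ _ hq hp hadj.symm hcpq.symm _ _ hs ht (hst i) h1 (h2 ▸ (hst i).symm) h3
      · by_cases h3 : t i = q i
        · exact (main _ _ hq hp hadj.symm hcpq.symm _ _ ht hs (hst i).symm (h3 ▸ hadj.ne') h2 h1).symm
        · by_cases h4 : t i = p i
          · exact (main _ _ hp hq hadj hcpq _ _ ht hs (hst i).symm h3 h1 h2).symm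
          · exact main _ _ hp hq hadj hcpq _ _ hs ht (hst i) h2 h4 h3
  choose γ hγ hγI using hplan
  have hlink : Linked (biGraph G c) Xᶜ (F'.image f) :=
    hG.linked_compl (K := k + I.card) (r := 20 * (k + I.card)) (by omega) le_rfl (by omega) hcov
      (Finset.image_subset_iff.2 fun v hv => Finset.mem_compl.2 (hf1 v hv).1)
      (Finset.card_image_le.trans hF')
  obtain ⟨N, hN, hNr⟩ := hlink.exists_routes (biGraph_le c) (fun _ _ h => h.2) hMd (fun i w hw => by
    rw [Finset.mem_inter, Finset.mem_biUnion, Finset.mem_compl] at hw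
    obtain ⟨⟨v, hv, hwv⟩, hwX⟩ := hw
    rw [hf3 v (hFF' i hv) w hwv hwX]
    exact Finset.mem_image_of_mem f (hFF' i hv)) hγ
  exact ⟨N, hN, γ, hγI, hNr⟩

end SmallCover

end ParityLinkage
end

section
open scoped Classical
namespace ParityLinkage

/-! ### From nice partitions and length parities to routes. -/

section Parity
variable {V : Type*} {G : SimpleGraph V} {k : ℕ} {I : Finset (Fin k)} {s t : Fin k → V} {A B : Set V}

theorem natCast_zmod_two_eq (n : ℕ) (x : ZMod 2) (h : n.bodd = decide (x = 1)) : (n : ZMod 2) = x := by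
  rcases Nat.even_or_odd n with hn | hn
  · have h1 : n.bodd = false := by
      obtain ⟨r, rfl⟩ := hn
      rw [Nat.bodd_add, Bool.xor_self]
    rw [h1] at h
    rw [(ZMod.natCast_eq_zero_iff_even).2 hn]
    revert x
    decide
  · have h1 : n.bodd = true := by
      obtain ⟨r, rfl⟩ := hn
      rw [two_mul, Nat.bodd_add, Nat.bodd_add, Bool.xor_self]; rfl
    rw [h1] at h
    rw [(ZMod.natCast_eq_one_iff_odd).2 hn]
    simpa [eq_comm] using h

/-- Modulo two the length is `breaks` corrected by the colours of the two ends, so a requested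
length parity becomes a requested value of `breaks`, with an arbitrary request outside `I`. -/
theorem exists_paths_of_routes (c : V → Bool)
    (h : ∀ β : Fin k → Bool, ∃ N : Fin k → Finset V, (Pairwise fun i j => Disjoint (N i) (N j)) ∧
      ∃ β' : Fin k → Bool, (∀ i ∈ I, β' i = β i) ∧ ∀ i, Route G c (N i) (s i) (t i) (β' i))
    (parity : I → ZMod 2) : ∃ P : ∀ i : Fin k, G.Walk (s i) (t i), (∀ i, (P i).IsPath) ∧
      (∀ i j, i ≠ j → List.Disjoint (P i).support (P j).support) ∧
      (∀ i : I, ((P i).length : ZMod 2) = parity i) := by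
  obtain ⟨N, hN, β', hβ', hr⟩ := h fun i =>
    (if h : i ∈ I then decide (parity ⟨i, h⟩ = 1) else false) ^^ (c (s i) ^^ c (t i))
  choose P hP hPN hPb using hr
  refine ⟨P, hP, fun i j hij x hx hx' => Finset.disjoint_left.1 (hN hij) (hPN i x hx) (hPN j x hx'),
    fun i => natCast_zmod_two_eq _ _ ?_⟩
  have := (hPb i).trans (hβ' i i.2)
  rw [breaks, dif_pos i.2] at this
  simpa using this

theorem support_subset_of_res {S : Finset V} {a b : V} (p : (res G S).Walk a b) (ha : a ∈ S) :
    ∀ x ∈ p.support, x ∈ S := by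
  induction p with
  | nil => simpa using ha
  | cons h p ih =>
    intro x hx
    rw [SimpleGraph.Walk.support_cons, List.mem_cons] at hx
    rcases hx with rfl | hx
    exacts [ha, ih h.2.2 x hx]

theorem exists_disjoint_walks [Fintype V] {n : ℕ} (hG : IsVertexConnected G n) {ι : Type*} [Fintype ι]
    (hn : Fintype.card ι ≤ n) {tm : ι → V} (htm : Function.Injective tm) {U : Finset V}
    (hU : Fintype.card ι ≤ U.card) : ∃ W : ∀ z, Σ v, G.Walk (tm z) v, (∀ z, (W z).1 ∈ U) ∧
      Pairwise fun z z' => List.Disjoint (W z).2.support (W z').2.support := by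
  have hR : (Finset.univ.image tm).card = Fintype.card ι := Finset.card_image_of_injective _ htm
  obtain ⟨T, e, hT, hTd⟩ := menger_from (G := G) (A := Finset.univ.image tm) (B := U) fun Z hZ =>
    hG.le_card_of_separates le_rfl (hR.trans_le hU) (hR.trans_le hn) hZ
  have hmem : ∀ z, tm z ∈ Finset.univ.image tm := fun z => Finset.mem_image_of_mem _ (Finset.mem_univ z)
  choose p _ hp using fun z => (hT _ (hmem z)).2.2.2.2.exists_walk (hT _ (hmem z)).1
  exact ⟨fun z => ⟨_, p z⟩, fun z => (hT _ (hmem z)).2.1, fun z z' hz x hx hx' =>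
    Finset.disjoint_left.1 (hTd _ (hmem z) _ (hmem z') (htm.ne hz)) (hp z x hx) (hp z' x hx')⟩

theorem sideGraph_adj {u v : V} : (sideGraph G A B).Adj u v ↔
    G.Adj u v ∧ (u ∈ A ∧ v ∈ A ∨ u ∈ B ∧ v ∈ B) := by
  simp [sideGraph]
  tauto

theorem Induces.adj {X : Set V} (h : Induces G X A B) {u v : V} (huv : G.Adj u v) (hu : u ∉ X)
    (hv : v ∉ X) : decide (u ∈ A) ≠ decide (v ∈ A) := by
  obtain ⟨-, hAB, ⟨-, hside⟩, -⟩ := h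
  have hB : ∀ w, w ∉ A → w ∈ B := fun w hw => by
    rw [← hAB.compl_eq]
    exact hw
  have hadj : ¬ (sideGraph (G.induce Xᶜ) (Subtype.val ⁻¹' A) (Subtype.val ⁻¹' B)).Adj ⟨u, hu⟩ ⟨v, hv⟩ := by
    rw [hside]
    simp
  rw [sideGraph_adj] at hadj
  simp only [SimpleGraph.comap_adj, Function.Embedding.subtype_apply, Set.mem_preimage, not_and_or, not_or] at hadj
  have := hB u
  have := hB v
  by_cases u ∈ A <;> by_cases v ∈ A <;> simp_all

theorem Induces.card_le [Fintype V] {X : Finset V} (h : Induces G X A B) {x : V} (hx : x ∈ X) :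
    ((nb G Xᶜ x).filter fun w => decide (x ∈ A) = decide (w ∈ A)).card ≤
      ((nb G Xᶜ x).filter fun w => decide (x ∈ A) ≠ decide (w ∈ A)).card := by
  obtain ⟨-, hAB, -, hnice⟩ := h
  have hB : ∀ w, w ∈ B ↔ w ∉ A := fun w => by
    rw [← hAB.compl_eq]
    rfl
  have hncA : ((nb G Xᶜ x).filter (· ∈ A)).card = (G.neighborSet x ∩ (A \ X)).ncard := by
    rw [← Set.ncard_coe_finset]
    congr 1
    ext w
    simp
    tauto
  have hncB : ((nb G Xᶜ x).filter (· ∉ A)).card = (G.neighborSet x ∩ (B \ X)).ncard := by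
    rw [← Set.ncard_coe_finset]
    congr 1
    ext w
    simp [hB]
    tauto
  obtain ⟨h1, h2⟩ := hnice x hx
  rw [hB] at h2
  rw [← hncA, ← hncB] at h1 h2
  by_cases hxA : x ∈ A
  · simp only [hxA, decide_true, ne_eq, true_eq_decide_iff]
    by_contra hlt
    exact h2 (by omega) hxA
  · simp only [hxA, decide_false, ne_eq, false_eq_decide_iff, not_not]
    by_contra hlt
    exact hxA (h1 (by omega))

/-- Colouring by membership in `A` makes the edges of G[A] ∪ G[B] the breaking ones. The matching
conditions say that the sets formed by each pair and its matching edge are disjoint, as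
`exists_routes_of_small_cover` needs. -/
theorem exists_routes_of_induces [Fintype V] (hG : IsVertexConnected G (26 * k + 24 * I.card))
    (hk : 0 < k) (hst : Function.Injective (Sum.elim s t)) {X : Set V} (hX : Induces G X A B)
    (hXc : X.ncard ≤ 6 * k + 2 * I.card) {m : I → Sym2 V}
    (hm : IsParityBreakingMatching G A B s t I m) (β : Fin k → Bool) :
    ∃ N : Fin k → Finset V, (Pairwise fun i j => Disjoint (N i) (N j)) ∧
      ∃ β' : Fin k → Bool, (∀ i ∈ I, β' i = β i) ∧
        ∀ i, Route G (fun v => decide (v ∈ A)) (N i) (s i) (t i) (β' i) := by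
  obtain ⟨X, rfl⟩ : ∃ Y : Finset V, X = Y := ⟨X.toFinset, by simp⟩
  rw [Set.ncard_coe_finset] at hXc
  obtain ⟨hm1, hm2, hm3⟩ := hm
  have hpq : ∀ i : Fin k, ∃ p q, ∀ h : i ∈ I, m ⟨i, h⟩ = s(p, q) := fun i => by
    by_cases h : i ∈ I
    · obtain ⟨⟨p, q⟩, hpq⟩ := (m ⟨i, h⟩).exists_rep
      exact ⟨p, q, fun _ => hpq.symm⟩
    -- A dummy value for indices outside `I`.
    · exact ⟨s i, s i, fun h' => absurd h' h⟩
  choose p q hpq using hpq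
  have hadj : ∀ i ∈ I, (sideGraph G A B).Adj (p i) (q i) := fun i hi => by
    have := hm1 ⟨i, hi⟩
    rwa [hpq i hi] at this
  have hmem : ∀ i, ∀ x ∈ ({s i, t i} ∪ if i ∈ I then {p i, q i} else ∅ : Finset V),
      x = s i ∨ x = t i ∨ ∃ h : i ∈ I, x ∈ m ⟨i, h⟩ := fun i x hx => by
    by_cases hi : i ∈ I
    · simp only [hi, if_true, Finset.mem_union, Finset.mem_insert, Finset.mem_singleton] at hx
      have h : x = p i ∨ x = q i → x ∈ m ⟨i, hi⟩ := fun h => by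
        rw [hpq i hi, Sym2.mem_iff]
        exact h
      tauto
    · simp [hi] at hx
      tauto
  refine exists_routes_of_small_cover (p := p) (q := q) hG hk hXc (fun u v huv hu hv => hX.adj huv hu hv)
    (fun x hx => hX.card_le hx) (fun i h => ?_) (fun i hi => ?_) (fun i j hij => ?_) β
  · exact Sum.inl_ne_inr (hst (a₁ := Sum.inl i) (a₂ := Sum.inr i) h)
  · obtain ⟨h1, h2⟩ := sideGraph_adj.1 (hadj i hi)
    refine ⟨h1, ?_⟩
    rcases h2 with h2 | h2
    · simp [h2]
    · have hd := Set.disjoint_right.1 hX.2.1.disjoint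
      simp [hd h2.1, hd h2.2]
  · refine Finset.disjoint_left.2 fun x hx hx' => ?_
    have hss : s i ≠ s j := fun h => hij (Sum.inl_injective (hst (a₁ := Sum.inl i) (a₂ := Sum.inl j) h))
    have hts : t i ≠ s j := fun h => Sum.inr_ne_inl (hst (a₁ := Sum.inr i) (a₂ := Sum.inl j) h)
    have hst' : s i ≠ t j := fun h => Sum.inl_ne_inr (hst (a₁ := Sum.inl i) (a₂ := Sum.inr j) h)
    have htt : t i ≠ t j := fun h => hij (Sum.inr_injective (hst (a₁ := Sum.inr i) (a₂ := Sum.inr j) h))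
    rcases hmem i x hx with rfl | rfl | ⟨hi, h⟩ <;> rcases hmem j _ hx' with h' | h' | ⟨hj, h'⟩
    · exact hss h'
    · exact hst' h'
    · exact (hm3 ⟨j, hj⟩ i hij.symm).1 h'
    · exact hts h'
    · exact htt h'
    · exact (hm3 ⟨j, hj⟩ i hij.symm).2 h'
    · exact (hm3 ⟨i, hi⟩ j hij).1 (h' ▸ h)
    · exact (hm3 ⟨i, hi⟩ j hij).2 (h' ▸ h)
    · exact hm2 ⟨i, hi⟩ ⟨j, hj⟩ (fun he => hij (congrArg Subtype.val he)) x h h'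

/-- Either parities of linkages can be prescribed with respect to some colouring, or there is a small
odd cycle cover. -/
theorem exists_routes_or_small_cover [Fintype V] (hG : IsVertexConnected G (26 * k + 24 * I.card))
    (hk : 0 < k) (hst : Function.Injective (Sum.elim s t)) :
    (∃ c : V → Bool, ∀ β : Fin k → Bool, ∃ N : Fin k → Finset V,
      (Pairwise fun i j => Disjoint (N i) (N j)) ∧ ∃ β' : Fin k → Bool, (∀ i ∈ I, β' i = β i) ∧
        ∀ i, Route G c (N i) (s i) (t i) (β' i)) ∨
    ∃ Y : Set V, IsOddCycleCover G Y ∧ Y.ncard ≤ 6 * k + 2 * I.card := by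
  have hI : I.card ≤ k := by simpa using Finset.card_le_univ I
  have hne : Nonempty V := ⟨s ⟨0, hk⟩⟩
  obtain ⟨c, hc⟩ := exists_maxCut G
  -- Since |I| ≤ k, the connectivity is at least 25(k + |I|), and the maximum cut keeps half of
  -- every degree.
  obtain ⟨U, hU, hL⟩ := exists_linked_subset (K := k + I.card) (H := biGraph G c) (c := c) (by omega)
    (fun _ _ h => h.2) fun v => by
      have h1 := hG.le_card_nb v
      have h2 := hc v
      omega
  let R : Finset V := Finset.univ.image (Sum.elim s t)
  have hR : R.card = 2 * k := by
    rw [Finset.card_image_of_injective _ hst, Finset.card_univ, Fintype.card_sum, Fintype.card_fin]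
    ring
  have hS := Finset.le_card_sdiff R U
  -- The number of paths is the 2k that the walks may spoil plus one for each index in `I`. A
  -- hitting set then has fewer than 4k + 2|I| vertices, and with the terminals at most 6k + 2|I|.
  rcases exists_breaking_paths_or_hitting (res G Rᶜ) c (U \ R) (m := 2 * k + I.card) (by omega) with
    ⟨a, b, Q, hQ, hQd⟩ | ⟨Z, hZ, hZQ⟩
  · left
    have hle : res G Rᶜ ≤ G := fun _ _ h => h.1
    refine ⟨c, fun β => exists_routes_of_breaking_paths (biGraph_le c) (fun _ _ h => h.2) hL
      (exists_disjoint_walks hG (by simp; omega) hst (by simp; omega)) (fun j => (Q j).mapLe hle)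
      (fun j => ?_) (fun i j hij => ?_) β⟩
    · obtain ⟨h1, h2, h3, h4, h5, h6⟩ := hQ j
      have h2' := Finset.mem_sdiff.1 h2
      refine ⟨(SimpleGraph.Walk.isPath_mapLe hle).2 h1, h2'.1, (Finset.mem_sdiff.1 h3).1, h4,
        by rw [← h5]; simp [breaks], fun x hx hxU => ?_⟩
      rw [SimpleGraph.Walk.support_mapLe_eq_support] at hx
      have := support_subset_of_res (Q j) (Finset.mem_compl.2 h2'.2) x hx
      exact h6 x hx (Finset.mem_sdiff.2 ⟨hxU, Finset.mem_compl.1 this⟩)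
    · have := hQd i j hij
      simpa only [SimpleGraph.Walk.support_mapLe_eq_support] using this
  · right
    refine ⟨_, hG.isOddCycleCover_of_hitting (c := c) (R := R) (S := U \ R) (Z := Z) (by omega)
      Finset.sdiff_disjoint (by omega) hZQ, ?_⟩
    rw [Set.ncard_coe_finset]
    have := Finset.card_union_le R Z
    omega

end Parity

end ParityLinkage
end
-- The theorem.
theorem theorem2p1 {V : Type*} [Finite V] (G : SimpleGraph V) (k : ℕ) (I : Finset (Fin k))
    (hG : ParityLinkage.IsVertexConnected G (26 * k + 24 * I.card))
    (s t : Fin k → V) (hst : Function.Injective (Sum.elim s t))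
    (A B : Set V) (hAB : ParityLinkage.IsNicePartition G A B)
    (m : I → Sym2 V) (hm : ParityLinkage.IsParityBreakingMatching G A B s t I m)
    (parity : I → ZMod 2) :
    ∃ P : ∀ i : Fin k, G.Walk (s i) (t i),
      (∀ i, (P i).IsPath) ∧
      (∀ i j, i ≠ j → List.Disjoint (P i).support (P j).support) ∧
      (∀ i : I, ((P i).length : ZMod 2) = parity i) := by
  have := Fintype.ofFinite V
  rcases Nat.eq_zero_or_pos k with rfl | hk
  · exact ⟨fun i => i.elim0, fun i => i.elim0, fun i => i.elim0, fun i => i.1.elim0⟩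
  · rcases ParityLinkage.exists_routes_or_small_cover hG hk hst with ⟨c, hc⟩ | ⟨Y, hY, hYc⟩
    · exact ParityLinkage.exists_paths_of_routes c hc parity
    -- The cover behind the nice partition is a minimum one, so it is no larger than `Y`.
    · obtain ⟨X, hX⟩ := hAB
      exact ParityLinkage.exists_paths_of_routes _ (ParityLinkage.exists_routes_of_induces hG hk hst hX
        ((hX.1.2 Y hY).trans hYc) hm) parity
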